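/- Let $d \ge 2$ and let $O \subset \mathbb{R}^d$ be open, bounded and of class $C^1$, with exterior unit normal $\nu$ on $\partial O$. Let $H(\operatorname{div}, O) = \{u \in [L^2(O)]^d : \operatorname{div} u \in L^2(O)\}$, where $\operatorname{div} u$ is the weak divergence; fields may be real or complex valued. Let $H^{1/2}(\partial O)$ be the space of $\varphi \in L^2(\partial O)$ (with respect to the surface measure $\sigma$) with $$\|\varphi\|_{H^{1/2}(\partial O)}^2 = \int_{\partial O} |\varphi|^2 \, d\sigma + \int_{\partial O}\int_{\partial O} \frac{|\varphi(x)-\varphi(y)|^2}{|x-y|^d} \, d\sigma(x) \, d\sigma(y) < \infty,$$ and let $H^{-1/2}(\partial O)$ be its dual space with the dual norm. Then there is a constant $C > 0$, depending only on $O$, such that every $u \in H(\operatorname{div}, O)$ has a unique normal trace $u \cdot \nu \in H^{-1/2}(\partial O)$, that is, a unique element of $H^{-1/2}(\partial O)$ with $$\langle u \cdot \nu, \Phi|_{\partial O} \rangle = \int_O \big( u \cdot \nabla \Phi + (\operatorname{div} u) \, \Phi \big) \, dx \quad \text{for all } \Phi \in C_c^\infty(\mathbb{R}^d),$$ and it satisfies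 $$\| u \cdot \nu \|_{H^{-1/2}(\partial O)}^2 \le C \, \| u \|_{L^2(O)} \Big( \| u \|_{L^2(O)} + \| \operatorname{div} u \|_{L^2(O)} \Big).$$ -/

import Mathlib

open MeasureTheory Set

/-- Bounded open sets of class `C¹` in `ℝ^d`: near each boundary point, after an orthogonal change
of coordinates, the set is the strict epigraph of a `C¹` function of `d - 1` variables. -/
class IsC1Domain {d : ℕ} (O : Set (EuclideanSpace ℝ (Fin d))) : Prop where
  isOpen : IsOpen O
  isBounded : Bornology.IsBounded O
  exists_graph : ∀ x ∈ frontier O, ∃ r : ℝ, 0 < r ∧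
    ∃ (A : EuclideanSpace ℝ (Fin d) ≃ₗᵢ[ℝ] WithLp 2 (EuclideanSpace ℝ (Fin (d - 1)) × ℝ))
      (γ : EuclideanSpace ℝ (Fin (d - 1)) → ℝ),
      ContDiff ℝ 1 γ ∧
      O ∩ Metric.ball x r = {y | y ∈ Metric.ball x r ∧ γ (A y).fst < (A y).snd}

/-- Surface measure on `∂O`: the `(d-1)`-dimensional Hausdorff measure, with the normalization
that makes it agree with Lebesgue measure on `ℝ^(d-1)`. -/
noncomputable def boundaryMeasure {d : ℕ} (O : Set (EuclideanSpace ℝ (Fin d))) :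
    Measure (EuclideanSpace ℝ (Fin d)) :=
  (μHE[d - 1] : Measure (EuclideanSpace ℝ (Fin d))).restrict (frontier O)

/-- The surface measure of a bounded `C¹` set is finite (needed for products of measures). -/
instance isFiniteMeasure_boundaryMeasure {d : ℕ} (O : Set (EuclideanSpace ℝ (Fin d)))
    [hO : IsC1Domain O] : IsFiniteMeasure (boundaryMeasure O) := by
  have hcpt : IsCompact (frontier O) :=
    Metric.isCompact_of_isClosed_isBounded isClosed_frontier
      (hO.isBounded.closure.subset frontier_subset_closure)
  have key : ∀ x ∈ frontier O, ∃ t ∈ nhdsWithin x (frontier O),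
      (μHE[d - 1] : Measure (EuclideanSpace ℝ (Fin d))) t < ⊤ := by
    intro x hx
    obtain ⟨r, hr, A, γ, hγ, hEq⟩ := hO.exists_graph x hx
    refine ⟨Metric.ball x r ∩ frontier O,
      Filter.inter_mem (mem_nhdsWithin_of_mem_nhds (Metric.ball_mem_nhds x hr))
        self_mem_nhdsWithin, ?_⟩
    set G : EuclideanSpace ℝ (Fin (d - 1)) → EuclideanSpace ℝ (Fin d) :=
      fun z => A.symm (WithLp.toLp 2 (z, γ z)) with hG
    have hGd : ContDiff ℝ 1 G := by
      refine A.symm.contDiff.comp ?_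
      exact (WithLp.prodContinuousLinearEquiv 2 ℝ _ _).symm.contDiff.comp (contDiff_id.prodMk hγ)
    set K : Set (EuclideanSpace ℝ (Fin (d - 1))) := Metric.closedBall (A x).fst r with hK
    have hKc : IsCompact K := isCompact_closedBall _ _
    obtain ⟨L, hL⟩ := hGd.contDiffOn.exists_lipschitzOnWith (s := K) one_ne_zero
      (convex_closedBall _ _) hKc
    have hsub : Metric.ball x r ∩ frontier O ⊆ G '' K := by
      rintro y ⟨hyb, hyf⟩
      have hyO : y ∉ O := by
        rw [hO.isOpen.frontier_eq] at hyf
        exact hyf.2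
      have hle1 : (A y).snd ≤ γ (A y).fst := by
        by_contra hcon
        have : y ∈ O ∩ Metric.ball x r := by
          rw [hEq]
          exact ⟨hyb, not_le.mp hcon⟩
        exact hyO this.1
      have hfst : Continuous fun y => (A y).fst := by fun_prop
      have hsnd : Continuous fun y => (A y).snd := by fun_prop
      have hle2 : γ (A y).fst ≤ (A y).snd := by
        by_contra hcon
        have hopen : IsOpen {z | (A z).snd < γ (A z).fst} :=
          isOpen_lt hsnd (hγ.continuous.comp hfst)
        have hycl : y ∈ closure O := frontier_subset_closure hyf
        obtain ⟨z, hz, hzO⟩ := mem_closure_iff.mp hycl _ (hopen.inter Metric.isOpen_ball)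
          ⟨not_le.mp hcon, hyb⟩
        have hz' : z ∈ O ∩ Metric.ball x r := ⟨hzO, hz.2⟩
        rw [hEq] at hz'
        exact lt_asymm hz.1 hz'.2
      refine ⟨(A y).fst, ?_, ?_⟩
      · rw [hK, Metric.mem_closedBall, dist_eq_norm]
        have h1 : ‖(A y - A x).fst‖ ≤ ‖A y - A x‖ := WithLp.norm_fst_le _ _
        have h2 : ‖A y - A x‖ = dist y x := by
          rw [← map_sub, A.norm_map, dist_eq_norm]
        exact h1.trans (h2.le.trans (Metric.mem_ball.mp hyb).le)
      · have : WithLp.toLp 2 ((A y).fst, γ (A y).fst) = A y := by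
          rw [le_antisymm hle2 hle1]
          rfl
        simp only [hG, this, A.symm_apply_apply]
    refine (measure_mono hsub).trans_lt ?_
    rw [Measure.euclideanHausdorffMeasure_def, Measure.smul_apply]
    refine ENNReal.mul_lt_top ENNReal.coe_lt_top ?_
    refine (hL.hausdorffMeasure_image_le (Nat.cast_nonneg _)).trans_lt ?_
    exact ENNReal.mul_lt_top (ENNReal.rpow_lt_top_of_nonneg (Nat.cast_nonneg _)
      ENNReal.coe_ne_top) hKc.measure_lt_top
  exact ⟨by
    rw [boundaryMeasure, Measure.restrict_apply_univ]
    exact hcpt.measure_lt_top_of_nhdsWithin key⟩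

/-- The difference quotient `(φ(x) - φ(y)) / |x - y|^(d/2)`. The integral of its square over
`∂O × ∂O` is the squared Gagliardo seminorm of order `1/2` on the `(d-1)`-dimensional `∂O`. -/
noncomputable def gagliardoQuotient {𝕜 : Type*} [RCLike 𝕜] {d : ℕ}
    (φ : EuclideanSpace ℝ (Fin d) → 𝕜) :
    EuclideanSpace ℝ (Fin d) × EuclideanSpace ℝ (Fin d) → 𝕜 :=
  fun p => (‖p.1 - p.2‖ ^ ((d : ℝ) / 2))⁻¹ • (φ p.1 - φ p.2)

/-- `H^{1/2}(∂O)`: the functions `φ ∈ L²(∂O)` with Gagliardo quotient in `L²(∂O × ∂O)`. Such a `φ`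
is stored together with its Gagliardo quotient, so that the norm inherited from the `L²`-product is
`‖φ‖² = ∫_{∂O} |φ|² + ∫_{∂O} ∫_{∂O} |φ(x) - φ(y)|² / |x - y|^d`. -/
def HHalf (𝕜 : Type*) [RCLike 𝕜] {d : ℕ} (O : Set (EuclideanSpace ℝ (Fin d))) [IsC1Domain O] :
    Submodule 𝕜 (WithLp 2 (Lp 𝕜 2 (boundaryMeasure O) ×
      Lp 𝕜 2 ((boundaryMeasure O).prod (boundaryMeasure O)))) where
  carrier := {w | w.snd =ᵐ[(boundaryMeasure O).prod (boundaryMeasure O)] gagliardoQuotient w.fst}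
  add_mem' := by
    intro v w hv hw
    simp only [mem_ofPred_eq] at hv hw ⊢
    have h := Lp.coeFn_add v.fst w.fst
    have h1 := Measure.quasiMeasurePreserving_fst (μ := boundaryMeasure O)
      (ν := boundaryMeasure O) |>.ae h
    have h2 := Measure.quasiMeasurePreserving_snd (μ := boundaryMeasure O)
      (ν := boundaryMeasure O) |>.ae h
    have h3 := Lp.coeFn_add v.snd w.snd
    filter_upwards [hv, hw, h1, h2, h3] with p hvp hwp h1p h2p h3p
    simp only [gagliardoQuotient, WithLp.add_fst, WithLp.add_snd, Pi.add_apply] at *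
    rw [h3p, hvp, hwp, h1p, h2p, ← smul_add]
    congr 1
    ring
  zero_mem' := by
    simp only [mem_ofPred_eq]
    have h := Lp.coeFn_zero 𝕜 2 (boundaryMeasure O)
    have h1 := Measure.quasiMeasurePreserving_fst (μ := boundaryMeasure O)
      (ν := boundaryMeasure O) |>.ae h
    have h2 := Measure.quasiMeasurePreserving_snd (μ := boundaryMeasure O)
      (ν := boundaryMeasure O) |>.ae h
    have h3 := Lp.coeFn_zero 𝕜 2 ((boundaryMeasure O).prod (boundaryMeasure O))
    filter_upwards [h1, h2, h3] with p h1p h2p h3p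
    simp only [gagliardoQuotient, WithLp.zero_fst, WithLp.zero_snd, Pi.zero_apply] at *
    rw [h3p, h1p, h2p]
    simp
  smul_mem' := by
    intro c w hw
    simp only [mem_ofPred_eq] at hw ⊢
    have h := Lp.coeFn_smul c w.fst
    have h1 := Measure.quasiMeasurePreserving_fst (μ := boundaryMeasure O)
      (ν := boundaryMeasure O) |>.ae h
    have h2 := Measure.quasiMeasurePreserving_snd (μ := boundaryMeasure O)
      (ν := boundaryMeasure O) |>.ae h
    have h3 := Lp.coeFn_smul c w.snd
    filter_upwards [hw, h1, h2, h3] with p hp h1p h2p h3p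
    simp only [gagliardoQuotient, WithLp.smul_fst, WithLp.smul_snd, Pi.smul_apply] at *
    rw [h3p, hp, h1p, h2p, smul_comm, smul_sub]

/-- `H^{-1/2}(∂O)`, the dual of `H^{1/2}(∂O)` with the dual norm. -/
abbrev HMinusHalf (𝕜 : Type*) [RCLike 𝕜] {d : ℕ} (O : Set (EuclideanSpace ℝ (Fin d)))
    [IsC1Domain O] : Type _ :=
  StrongDual 𝕜 (HHalf 𝕜 O)

/-- The bilinear expression `v · ∇Φ(x) = ∑ i, v_i ∂_i Φ(x)`. -/
noncomputable def dotGrad {𝕜 : Type*} [RCLike 𝕜] {d : ℕ} (v : EuclideanSpace 𝕜 (Fin d))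
    (Φ : EuclideanSpace ℝ (Fin d) → 𝕜) (x : EuclideanSpace ℝ (Fin d)) : 𝕜 :=
  ∑ i, v i * fderiv ℝ Φ x (EuclideanSpace.single i 1)

/-- `u ∈ L²(O)^d` belongs to `H(div, O)` and its weak divergence is `g ∈ L²(O)`. -/
def HasWeakDiv {𝕜 : Type*} [RCLike 𝕜] {d : ℕ} (O : Set (EuclideanSpace ℝ (Fin d)))
    (u : Lp (EuclideanSpace 𝕜 (Fin d)) 2 (volume.restrict O))
    (g : Lp 𝕜 2 (volume.restrict O)) : Prop :=
  ∀ Φ : EuclideanSpace ℝ (Fin d) → 𝕜, ContDiff ℝ (⊤ : ℕ∞) Φ → HasCompactSupport Φ →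
    tsupport Φ ⊆ O → ∫ x in O, g x * Φ x = - ∫ x in O, dotGrad (u x) Φ x

/-- `T ∈ H^{-1/2}(∂O)` is the normal trace `u · ν` (`ν` the outward unit normal) of the field
`u ∈ H(div, O)` with divergence `g`, in the sense of Green's formula
`⟨u · ν, Φ|_{∂O}⟩ = ∫_O (u · ∇Φ + (div u) Φ)` for all `Φ ∈ C_c^∞(ℝ^d)`. -/
def IsNormalTrace {𝕜 : Type*} [RCLike 𝕜] {d : ℕ} (O : Set (EuclideanSpace ℝ (Fin d)))
    [IsC1Domain O] (u : Lp (EuclideanSpace 𝕜 (Fin d)) 2 (volume.restrict O))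
    (g : Lp 𝕜 2 (volume.restrict O)) (T : HMinusHalf 𝕜 O) : Prop :=
  ∀ Φ : EuclideanSpace ℝ (Fin d) → 𝕜, ContDiff ℝ (⊤ : ℕ∞) Φ → HasCompactSupport Φ →
    ∀ φ : HHalf 𝕜 O, (φ : WithLp 2 (Lp 𝕜 2 (boundaryMeasure O) ×
      Lp 𝕜 2 ((boundaryMeasure O).prod (boundaryMeasure O)))).fst =ᵐ[boundaryMeasure O] Φ →
      T φ = ∫ x in O, (dotGrad (u x) Φ x + g x * Φ x)

/-! The right-hand side of Green's formula depends only on the boundary values of `Φ`: if `Φ`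
vanishes near `∂O`, the weak divergence identity makes it zero
(`greenIntegral_eq_zero_of_eventually_eq_zero`). So `Φ` may be traded for a better extension `Ψ` of
its boundary values. Take `Ψ` supported in a layer of width `δ ≤ 1` around `∂O` and equal there, up
to a cutoff, to the average of `Φ` over `∂O` at a scale `r(x)` comparable to the distance to `∂O`.
Then `‖Ψ‖² ≲ δ ‖φ‖²` and `‖∇Ψ‖² ≲ δ⁻¹ ‖φ‖²`, with `L²` norms on the left and the `H^{1/2}` norm of
`φ = Φ|_{∂O}` on the right (`exists_lintegral_layerExtension_sq_le`). Cauchy–Schwarz bounds the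
pairing by `(δ^{-1/2} ‖u‖ + δ^{1/2} ‖div u‖) ‖φ‖` up to a constant, and `δ = ‖u‖ / (‖u‖ + ‖div u‖)`
gives the claimed product.

The boundary is never flattened after the first step: averages are taken against the surface
measure, and all that is used of it is that balls of radius `s` have mass comparable to `s^m`, `m =
d - 1`. The Gagliardo seminorm appears through Tonelli. The gradient of the average at `x` is
controlled by differences `φ(y) - φ(z)` with `y, z` within `6 r(x)` of `x`; integrating the weight
`r(x)^{-2m-2}` over all `x` that see a given pair produces `|y - z|^{-(m+1)}`.

The scale `r` is smooth and strictly positive, so `Ψ` is smooth on the whole space and is a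
legitimate test function. The price is that `Ψ` differs from `Φ` on `∂O`. Since `Φ` is Lipschitz,
the mismatch, cut off to a layer of width `t`, is bounded in `C¹` uniformly in `t`, and its
contribution vanishes as `t → 0` (`exists_enorm_greenIntegral_le`).

Existence of the trace is then Hahn–Banach. Uniqueness is density of restrictions of test functions
in `H^{1/2}(∂O)`, proved with the same averages at scale `ε → 0` on the boundary: the part of the
energy away from the diagonal is controlled by `L²` convergence, the part near the diagonal by the
small near-diagonal energy of `φ` itself. -/

open scoped ContDiff
set_option linter.unusedSectionVars false

/-! ### Ahlfors regularity of the surface measure. -/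

/-- Two-sided `m`-dimensional bounds for the measure of balls: from below for balls of radius at
most `2` centred on `F`, from above for all balls. -/
structure IsAhlforsRegular {E : Type*} [NormedAddCommGroup E] [MeasurableSpace E]
    (σ : Measure E) (F : Set E) (m : ℕ) (c C : ℝ) : Prop where
  pos : 0 < c
  nonneg : 0 ≤ C
  le_ball : ∀ y ∈ F, ∀ r, 0 < r → r ≤ 2 → ENNReal.ofReal (c * r ^ m) ≤ σ (Metric.ball y r)
  ball_le : ∀ x r, 0 < r → σ (Metric.ball x r) ≤ ENNReal.ofReal (C * r ^ m)

theorem LipschitzOnWith.euclideanHausdorffMeasure_image_le {X Y : Type*} [EMetricSpace X]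
    [MeasurableSpace X] [BorelSpace X] [EMetricSpace Y] [MeasurableSpace Y] [BorelSpace Y]
    {K : NNReal} {f : X → Y} {s : Set X} (h : LipschitzOnWith K f s) (n : ℕ) :
    (μHE[n] : Measure Y) (f '' s) ≤ (K : ENNReal) ^ n * (μHE[n] : Measure X) s := by
  have h1 := h.hausdorffMeasure_image_le (Nat.cast_nonneg n)
  rw [ENNReal.rpow_natCast] at h1
  simp only [Measure.euclideanHausdorffMeasure_def, Measure.smul_apply, ENNReal.smul_def,
    smul_eq_mul]
  rw [mul_left_comm]
  gcongr

/-- Near `x` the boundary is the image of the graph map `G`, which is Lipschitz on a compact disc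
and has the 1-Lipschitz projection as left inverse. The map `G` gives the upper bound, the
projection the lower one. -/
theorem exists_ball_bounds_of_graph {d : ℕ} (O : Set (EuclideanSpace ℝ (Fin d)))
    [hO : IsC1Domain O] (x : EuclideanSpace ℝ (Fin d)) (hx : x ∈ frontier O) :
    ∃ ρ > 0, ∃ c > 0, ∃ C ≥ 0, ∀ y ∈ frontier O ∩ Metric.ball x ρ, ∀ r, 0 < r → r ≤ ρ →
      ENNReal.ofReal (c * r ^ (d - 1)) ≤ boundaryMeasure O (Metric.ball y r) ∧
      boundaryMeasure O (Metric.ball y r) ≤ ENNReal.ofReal (C * r ^ (d - 1)) := by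
  obtain ⟨r₀, hr, A, γ, hγ, hEq⟩ := hO.exists_graph x hx
  set G : EuclideanSpace ℝ (Fin (d - 1)) → EuclideanSpace ℝ (Fin d) :=
    fun z => A.symm (WithLp.toLp 2 (z, γ z)) with hG
  have hGd : ContDiff ℝ 1 G := by
    refine A.symm.contDiff.comp ?_
    exact (WithLp.prodContinuousLinearEquiv 2 ℝ _ _).symm.contDiff.comp (contDiff_id.prodMk hγ)
  set K : Set (EuclideanSpace ℝ (Fin (d - 1))) := Metric.closedBall (A x).fst r₀ with hK
  have hKc : IsCompact K := isCompact_closedBall _ _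
  obtain ⟨L, hL⟩ := hGd.contDiffOn.exists_lipschitzOnWith (s := K) one_ne_zero
    (convex_closedBall _ _) hKc
  have hfst : LipschitzWith 1 fun y => (A y).fst := by
    refine LipschitzWith.of_dist_le_mul fun y z => ?_
    rw [NNReal.coe_one, one_mul, dist_eq_norm, dist_eq_norm, ← A.norm_map (y - z), map_sub]
    exact WithLp.norm_fst_le _ (A y - A z)
  have hfstd : ∀ y z, dist (A y).fst (A z).fst ≤ dist y z := fun y z => by
    simpa using hfst.dist_le_mul y z
  have hsnd : Continuous fun y => (A y).snd := by fun_prop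
  have hgraph : ∀ y ∈ frontier O ∩ Metric.ball x r₀, G (A y).fst = y := by
    rintro y ⟨hyf, hyb⟩
    have hyO : y ∉ O := by
      rw [hO.isOpen.frontier_eq] at hyf
      exact hyf.2
    have hle1 : (A y).snd ≤ γ (A y).fst := by
      by_contra hcon
      have : y ∈ O ∩ Metric.ball x r₀ := by
        rw [hEq]
        exact ⟨hyb, not_le.mp hcon⟩
      exact hyO this.1
    have hle2 : γ (A y).fst ≤ (A y).snd := by
      by_contra hcon
      have hopen : IsOpen {z | (A z).snd < γ (A z).fst} :=
        isOpen_lt hsnd (hγ.continuous.comp hfst.continuous)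
      have hycl : y ∈ closure O := frontier_subset_closure hyf
      obtain ⟨z, hz, hzO⟩ := mem_closure_iff.mp hycl _ (hopen.inter Metric.isOpen_ball)
        ⟨not_le.mp hcon, hyb⟩
      have hz' : z ∈ O ∩ Metric.ball x r₀ := ⟨hzO, hz.2⟩
      rw [hEq] at hz'
      exact lt_asymm hz.1 hz'.2
    have : WithLp.toLp 2 ((A y).fst, γ (A y).fst) = A y := by
      rw [le_antisymm hle2 hle1]
      rfl
    simp only [hG, this, A.symm_apply_apply]
  -- A graph point is not in `O`, but moving it upwards by small `s > 0` lands in `O`.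
  have hmemf : ∀ z, G z ∈ Metric.ball x r₀ → G z ∈ frontier O := by
    intro z hz
    rw [hO.isOpen.frontier_eq]
    have hAG : A (G z) = WithLp.toLp 2 (z, γ z) := by simp [hG]
    constructor
    · set p : ℝ → EuclideanSpace ℝ (Fin d) :=
        fun s => A.symm (WithLp.toLp 2 (z, γ z + s)) with hp
      have hpc : Continuous p := by fun_prop
      have hp0 : p 0 = G z := by simp [hp, hG]
      have ht : Filter.Tendsto p (nhdsWithin 0 (Ioi 0)) (nhds (G z)) := by
        rw [← hp0]
        exact hpc.continuousAt.tendsto.mono_left nhdsWithin_le_nhds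
      refine mem_closure_of_tendsto ht ?_
      filter_upwards [ht.eventually (Metric.isOpen_ball.mem_nhds hz), self_mem_nhdsWithin]
        with s hs hs0
      have : p s ∈ O ∩ Metric.ball x r₀ := by
        rw [hEq]
        refine ⟨hs, ?_⟩
        have hs0' : (0 : ℝ) < s := hs0
        simp [hp, hs0']
      exact this.1
    · intro hmem
      have : G z ∈ O ∩ Metric.ball x r₀ := ⟨hmem, hz⟩
      rw [hEq] at this
      have h2 := this.2
      rw [hAG] at h2
      exact lt_irrefl _ h2
  set v : ℝ := (volume (Metric.ball (0 : EuclideanSpace ℝ (Fin (d - 1))) 1)).toReal with hv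
  have hvfin : volume (Metric.ball (0 : EuclideanSpace ℝ (Fin (d - 1))) 1) ≠ ⊤ :=
    measure_ball_lt_top.ne
  have hv0 : 0 < v := ENNReal.toReal_pos (Metric.measure_ball_pos _ _ one_pos).ne' hvfin
  have hvol : ∀ (z : EuclideanSpace ℝ (Fin (d - 1))) (s : ℝ), 0 ≤ s →
      (volume (Metric.closedBall z s) = ENNReal.ofReal (s ^ (d - 1) * v)) := by
    intro z s hs
    rw [Measure.addHaar_closedBall _ _ hs, ENNReal.ofReal_mul (by positivity), hv,
      ENNReal.ofReal_toReal hvfin, finrank_euclideanSpace_fin]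
  -- With this `κ` both `L κ < 1` and `κ < 1`: `G` sends the disc of radius `κ r` into the ball of
  -- radius `r`, and that disc stays in `K`.
  set κ : ℝ := 1 / (L + 2) with hκ
  have hL0 : (0 : ℝ) ≤ L := L.coe_nonneg
  have hκ0 : 0 < κ := by positivity
  have hκL : L * κ < 1 := by
    rw [hκ, mul_one_div, div_lt_one (by positivity)]; linarith
  have hκ1 : κ < 1 := by
    rw [hκ, div_lt_one (by positivity)]; linarith
  -- Half of `r₀`, so that a ball of radius at most `r₀ / 2` centred within `r₀ / 2` of `x` stays
  -- inside the chart.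
  refine ⟨r₀ / 2, by positivity, κ ^ (d - 1) * v, by positivity, L ^ (d - 1) * v, by positivity,
    ?_⟩
  rintro y ⟨hyf, hyb⟩ r hr0 hrr
  rw [Metric.mem_ball] at hyb
  have hyGy := hgraph y ⟨hyf, by rw [Metric.mem_ball]; linarith⟩
  rw [boundaryMeasure, Measure.restrict_apply Metric.isOpen_ball.measurableSet]
  have hyK : (A y).fst ∈ K := by
    rw [hK, Metric.mem_closedBall]
    exact (hfstd y x).trans (by linarith)
  constructor
  · have hsub : Metric.closedBall (A y).fst (κ * r) ⊆
        (fun y => (A y).fst) '' (Metric.ball y r ∩ frontier O) := by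
      intro z hz
      rw [Metric.mem_closedBall] at hz
      have hκr : κ * r < r := by nlinarith
      have hzK : z ∈ K := by
        rw [hK, Metric.mem_closedBall]
        have := dist_triangle z (A y).fst (A x).fst
        have := hfstd y x
        linarith
      have hd1 : dist (G z) y < r := by
        have h1 := hL.dist_le_mul z hzK _ hyK
        rw [hyGy] at h1
        have : (L : ℝ) * dist z (A y).fst ≤ L * (κ * r) := by gcongr
        nlinarith
      have hGf : G z ∈ frontier O := by
        refine hmemf z ?_
        rw [Metric.mem_ball]
        have := dist_triangle (G z) y x
        linarith
      exact ⟨G z, ⟨hd1, hGf⟩, by simp [hG]⟩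
    have h1 : (volume : Measure (EuclideanSpace ℝ (Fin (d - 1))))
        (Metric.closedBall (A y).fst (κ * r)) ≤ _ := measure_mono hsub
    rw [hvol _ _ (by positivity)] at h1
    have h2 := (hfst.lipschitzOnWith (s := Metric.ball y r ∩ frontier O)
      ).euclideanHausdorffMeasure_image_le (d - 1)
    rw [EuclideanSpace.euclideanHausdorffMeasure_eq_volume] at h2
    simp only [ENNReal.coe_one, one_pow, one_mul] at h2
    refine le_trans (le_of_eq ?_) (h1.trans h2)
    congr 1
    ring
  · have hsub : Metric.ball y r ∩ frontier O ⊆ G '' (Metric.closedBall (A y).fst r ∩ K) := by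
      rintro z ⟨hzb, hzf⟩
      rw [Metric.mem_ball] at hzb
      have hzx : dist z x < r₀ := by
        have := dist_triangle z y x
        linarith
      refine ⟨(A z).fst, ⟨?_, ?_⟩, hgraph z ⟨hzf, hzx⟩⟩
      · exact (hfstd z y).trans hzb.le
      · exact (hfstd z x).trans hzx.le
    refine (measure_mono hsub).trans ?_
    refine ((hL.mono inter_subset_right).euclideanHausdorffMeasure_image_le _).trans ?_
    rw [EuclideanSpace.euclideanHausdorffMeasure_eq_volume]
    calc (L : ENNReal) ^ (d - 1) * volume (Metric.closedBall (A y).fst r ∩ K)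
        ≤ (L : ENNReal) ^ (d - 1) * volume (Metric.closedBall (A y).fst r) := by
          gcongr; exact inter_subset_left
      _ = _ := by
          rw [hvol _ _ hr0.le, ← ENNReal.ofReal_coe_nnreal, ← ENNReal.ofReal_pow hL0,
            ← ENNReal.ofReal_mul (by positivity)]
          congr 1
          ring

theorem isAhlforsRegular_boundaryMeasure {d : ℕ} (O : Set (EuclideanSpace ℝ (Fin d)))
    [hO : IsC1Domain O] :
    ∃ c C : ℝ, IsAhlforsRegular (boundaryMeasure O) (frontier O) (d - 1) c C := by
  set F := frontier O with hF
  set σ := boundaryMeasure O with hσ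
  have hcpt : IsCompact F :=
    Metric.isCompact_of_isClosed_isBounded isClosed_frontier
      (hO.isBounded.closure.subset frontier_subset_closure)
  obtain ⟨ρ, hρ, c, hc, C, hC, h⟩ : ∃ ρ > 0, ∃ c > 0, ∃ C ≥ 0, ∀ y ∈ F ∩ F, ∀ r, 0 < r → r ≤ ρ →
      ENNReal.ofReal (c * r ^ (d - 1)) ≤ σ (Metric.ball y r) ∧
      σ (Metric.ball y r) ≤ ENNReal.ofReal (C * r ^ (d - 1)) := by
    refine hcpt.induction_on (p := fun s => ∃ ρ > 0, ∃ c > 0, ∃ C ≥ 0, ∀ y ∈ F ∩ s, ∀ r, 0 < r →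
      r ≤ ρ → ENNReal.ofReal (c * r ^ (d - 1)) ≤ σ (Metric.ball y r) ∧
      σ (Metric.ball y r) ≤ ENNReal.ofReal (C * r ^ (d - 1))) ?_ ?_ ?_ ?_
    · exact ⟨1, one_pos, 1, one_pos, 1, zero_le_one, by simp⟩
    · rintro s t hst ⟨ρ, hρ, c, hc, C, hC, h⟩
      exact ⟨ρ, hρ, c, hc, C, hC, fun y hy => h y ⟨hy.1, hst hy.2⟩⟩
    · rintro s t ⟨ρ, hρ, c, hc, C, hC, h⟩ ⟨ρ', hρ', c', hc', C', hC', h'⟩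
      refine ⟨min ρ ρ', lt_min hρ hρ', min c c', lt_min hc hc', max C C', le_max_of_le_left hC, ?_⟩
      rintro y ⟨hyF, hy⟩ r hr hrr
      have hrm : 0 ≤ r ^ (d - 1) := by positivity
      rcases hy with hy | hy
      · obtain ⟨h1, h2⟩ := h y ⟨hyF, hy⟩ r hr (hrr.trans (min_le_left _ _))
        exact ⟨(ENNReal.ofReal_le_ofReal (by gcongr; exact min_le_left _ _)).trans h1,
          h2.trans (ENNReal.ofReal_le_ofReal (by gcongr; exact le_max_left _ _))⟩
      · obtain ⟨h1, h2⟩ := h' y ⟨hyF, hy⟩ r hr (hrr.trans (min_le_right _ _))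
        exact ⟨(ENNReal.ofReal_le_ofReal (by gcongr; exact min_le_right _ _)).trans h1,
          h2.trans (ENNReal.ofReal_le_ofReal (by gcongr; exact le_max_right _ _))⟩
    · intro x hx
      obtain ⟨ρ, hρ, c, hc, C, hC, h⟩ := exists_ball_bounds_of_graph O x hx
      exact ⟨Metric.ball x ρ, mem_nhdsWithin_of_mem_nhds (Metric.ball_mem_nhds x hρ),
        ρ, hρ, c, hc, C, hC, h⟩
  -- Multiplying by `t` brings every radius up to `2` below `ρ`, at the cost of the factor `t ^ (d -
  -- 1)` in the lower bound.
  set t : ℝ := min ρ 2 / 2 with ht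
  have ht0 : 0 < t := by positivity
  have ht1 : t ≤ 1 := by rw [ht]; linarith [min_le_right ρ 2]
  have ht2 : t * 2 ≤ ρ := by rw [ht]; linarith [min_le_left ρ 2]
  set M : ℝ := (σ univ).toReal with hM
  have hM0 : 0 ≤ M := ENNReal.toReal_nonneg
  have hMe : σ univ = ENNReal.ofReal M := (ENNReal.ofReal_toReal (measure_ne_top _ _)).symm
  -- In the upper constant, `2 ^ (d - 1)` pays for recentring a small ball at a boundary point with
  -- doubled radius; for radii above `ρ / 2` the total mass `M` suffices.
  refine ⟨c * t ^ (d - 1), max (C * 2 ^ (d - 1)) (M * (2 / ρ) ^ (d - 1)), by positivity,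
    le_max_of_le_left (by positivity), ?_, ?_⟩
  · intro y hy r hr hr2
    have h1 := (h y ⟨hy, hy⟩ (t * r) (by positivity) (by nlinarith)).1
    rw [mul_assoc, ← mul_pow]
    exact h1.trans (measure_mono (Metric.ball_subset_ball (by nlinarith)))
  · intro x r hr
    have hrm : 0 ≤ r ^ (d - 1) := by positivity
    by_cases h2r : 2 * r ≤ ρ
    · by_cases hne : (Metric.ball x r ∩ F).Nonempty
      · obtain ⟨y, hyb, hyF⟩ := hne
        have hsub : Metric.ball x r ⊆ Metric.ball y (2 * r) := by
          refine Metric.ball_subset_ball' ?_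
          rw [Metric.mem_ball, dist_comm] at hyb
          linarith
        refine (measure_mono hsub).trans ((h y ⟨hyF, hyF⟩ (2 * r) (by positivity) h2r).2.trans ?_)
        refine ENNReal.ofReal_le_ofReal ?_
        rw [mul_pow, ← mul_assoc]
        gcongr
        exact le_max_left _ _
      · rw [not_nonempty_iff_eq_empty] at hne
        rw [hσ, boundaryMeasure, Measure.restrict_apply Metric.isOpen_ball.measurableSet, ← hF, hne]
        simp
    · refine (measure_mono (subset_univ _)).trans ?_
      rw [hMe]
      refine ENNReal.ofReal_le_ofReal ?_
      calc M = M * 1 := (mul_one M).symm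
        _ ≤ M * ((2 / ρ) * r) ^ (d - 1) := by
          gcongr
          refine one_le_pow₀ ?_
          rw [div_mul_eq_mul_div, one_le_div hρ]
          exact (not_le.mp h2r).le
        _ = M * (2 / ρ) ^ (d - 1) * r ^ (d - 1) := by rw [mul_pow, mul_assoc]
        _ ≤ _ := by gcongr; exact le_max_right _ _

/-! ### A smooth, strictly positive substitute for the distance to the boundary. -/

section SmoothDistance

variable {E : Type*} [NormedAddCommGroup E] [InnerProductSpace ℝ E] [FiniteDimensional ℝ E]

/-- A smooth `1`-Lipschitz function dominating the distance to `F`. -/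
structure IsScale (F : Set E) (r : E → ℝ) : Prop where
  contDiff : ContDiff ℝ ∞ r
  lipschitz : LipschitzWith 1 r
  infDist_lt : ∀ x, Metric.infDist x F < r x

/-- Mollification at radius `ε` keeps the Lipschitz constant `1` and moves the distance function by
at most `ε`; adding `2 * ε` makes the result dominate it strictly. -/
theorem exists_isScale (F : Set E) {ε : ℝ} (hε : 0 < ε) :
    ∃ r : E → ℝ, IsScale F r ∧
      ∀ x, Metric.infDist x F + ε ≤ r x ∧ r x ≤ Metric.infDist x F + 3 * ε := by
  borelize E
  let μ : Measure E := Measure.addHaar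
  set f : E → ℝ := fun x => Metric.infDist x F with hf
  have hfl : LipschitzWith 1 f := Metric.lipschitz_infDist_pt F
  let φ : ContDiffBump (0 : E) := ⟨ε / 2, ε, half_pos hε, half_lt_self hε⟩
  set g : E → ℝ := convolution (φ.normed μ) f (ContinuousLinearMap.lsmul ℝ ℝ) μ with hg
  have hgf : ∀ x, |g x - f x| ≤ ε := by
    intro x
    rw [← Real.dist_eq]
    refine φ.dist_normed_convolution_le hfl.continuous.aestronglyMeasurable fun y hy => ?_
    have h1 := hfl.dist_le_mul y x
    rw [NNReal.coe_one, one_mul] at h1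
    exact h1.trans (Metric.mem_ball.mp hy).le
  have hgs : ContDiff ℝ ∞ g :=
    φ.hasCompactSupport_normed.contDiff_convolution_left _ φ.contDiff_normed
      hfl.continuous.locallyIntegrable
  have hint : ∀ x, Integrable (fun t => φ.normed μ t * f (x - t)) μ := by
    intro x
    refine Continuous.integrable_of_hasCompactSupport ?_ ?_
    · exact φ.continuous_normed.mul (hfl.continuous.comp (by fun_prop))
    · exact φ.hasCompactSupport_normed.mul_right
  have hgl : LipschitzWith 1 g := by
    refine LipschitzWith.of_dist_le_mul fun x y => ?_
    rw [NNReal.coe_one, one_mul, Real.dist_eq]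
    have e1 : g x - g y = ∫ t, φ.normed μ t * (f (x - t) - f (y - t)) ∂μ := by
      simp only [hg, convolution_def, ContinuousLinearMap.lsmul_apply, smul_eq_mul]
      rw [← integral_sub (hint x) (hint y)]
      congr 1
      ext t
      ring
    have hI : Integrable (φ.normed μ) μ := φ.integrable_normed
    rw [e1, ← Real.norm_eq_abs]
    calc ‖∫ t, φ.normed μ t * (f (x - t) - f (y - t)) ∂μ‖
        ≤ ∫ t, φ.normed μ t * dist x y ∂μ := by
          refine norm_integral_le_of_norm_le (hI.mul_const _) (Filter.Eventually.of_forall ?_)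
          intro t
          rw [norm_mul, Real.norm_of_nonneg (φ.nonneg_normed t), ← dist_eq_norm]
          refine mul_le_mul_of_nonneg_left ?_ (φ.nonneg_normed t)
          have h1 := hfl.dist_le_mul (x - t) (y - t)
          rwa [NNReal.coe_one, one_mul, dist_sub_right] at h1
      _ = dist x y := by
          rw [integral_mul_const, φ.integral_normed, one_mul]
  have hbd : ∀ x, Metric.infDist x F + ε ≤ g x + 2 * ε ∧
      g x + 2 * ε ≤ Metric.infDist x F + 3 * ε := by
    intro x
    have h := abs_le.mp (hgf x)
    simp only [hf] at h
    constructor <;> linarith [h.1, h.2]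
  refine ⟨fun x => g x + 2 * ε, ⟨hgs.add contDiff_const, ?_, fun x => ?_⟩, hbd⟩
  · refine LipschitzWith.of_dist_le_mul fun x y => ?_
    rw [dist_add_right]
    exact hgl.dist_le_mul x y
  · linarith [(hbd x).1]

namespace IsScale

variable {F : Set E} {r : E → ℝ}

theorem pos (hr : IsScale F r) (x : E) : 0 < r x :=
  Metric.infDist_nonneg.trans_lt (hr.infDist_lt x)

theorem abs_sub_le (hr : IsScale F r) (x y : E) : |r x - r y| ≤ dist x y := by
  simpa [Real.dist_eq] using hr.lipschitz.dist_le_mul x y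

theorem continuous (hr : IsScale F r) : Continuous r := hr.lipschitz.continuous

end IsScale

end SmoothDistance

/-! ### Normalized averaging kernels at variable scale. -/

section Kernel

variable {E : Type*} [NormedAddCommGroup E] [InnerProductSpace ℝ E] [FiniteDimensional ℝ E]

/-- A fixed bump function, equal to `1` on the ball of radius `2` and supported in the ball of
radius `3`. -/
noncomputable def unitBump (E : Type*) [NormedAddCommGroup E] [InnerProductSpace ℝ E] :
    ContDiffBump (0 : E) := ⟨2, 3, by norm_num, by norm_num⟩

theorem exists_lipschitzWith_unitBump (E : Type*) [NormedAddCommGroup E] [InnerProductSpace ℝ E]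
    [FiniteDimensional ℝ E] : ∃ M, LipschitzWith M (unitBump E) :=
  ContDiff.lipschitzWith_of_hasCompactSupport (𝕂 := ℝ) (n := 1) (unitBump E).hasCompactSupport
    (unitBump E).contDiff one_ne_zero

/-- The unnormalized averaging weight at scale `r x` around `x`. -/
noncomputable def avgWeight (r : E → ℝ) (x y : E) : ℝ := unitBump E ((r x)⁻¹ • (x - y))

theorem avgWeight_nonneg (r : E → ℝ) (x y : E) : 0 ≤ avgWeight r x y := (unitBump E).nonneg

theorem avgWeight_le_one (r : E → ℝ) (x y : E) : avgWeight r x y ≤ 1 := (unitBump E).le_one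

theorem continuous_avgWeight (r : E → ℝ) (x : E) : Continuous (avgWeight r x) :=
  (unitBump E).continuous.comp (by fun_prop)

theorem norm_inv_smul_sub {r : ℝ} (hr : 0 < r) (x y : E) : ‖r⁻¹ • (x - y)‖ = dist y x / r := by
  rw [norm_smul, Real.norm_of_nonneg (inv_nonneg.mpr hr.le), dist_comm, dist_eq_norm,
    inv_mul_eq_div]

variable {F : Set E} {r : E → ℝ}

theorem avgWeight_eq_one (hr : IsScale F r) {x y : E} (h : dist y x ≤ 2 * r x) :
    avgWeight r x y = 1 := by
  refine (unitBump E).one_of_mem_closedBall ?_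
  rw [mem_closedBall_zero_iff, norm_inv_smul_sub (hr.pos x), div_le_iff₀ (hr.pos x)]
  exact h

theorem avgWeight_eq_zero (hr : IsScale F r) {x y : E} (h : 3 * r x ≤ dist y x) :
    avgWeight r x y = 0 := by
  refine (unitBump E).zero_of_le_dist ?_
  rw [dist_zero_right, norm_inv_smul_sub (hr.pos x), le_div_iff₀ (hr.pos x)]
  exact h

/-- The constant is `4 = 1 + 3`: moving the centre costs `1`, and changing the scale costs `3`
because `y` lies within `3 * r x'` of `x'`. -/
theorem dist_smul_sub_le (hr : IsScale F r) {x x' y : E} (h : dist y x' ≤ 3 * r x') :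
    dist ((r x)⁻¹ • (x - y)) ((r x')⁻¹ • (x' - y)) ≤ 4 * dist x x' / r x := by
  have h0 := hr.pos x
  have h0' := hr.pos x'
  have e : (r x)⁻¹ • (x - y) - (r x')⁻¹ • (x' - y) =
      (r x)⁻¹ • (x - x') + ((r x' - r x) * (r x)⁻¹ * (r x')⁻¹) • (x' - y) := by
    have : (r x' - r x) * (r x)⁻¹ * (r x')⁻¹ = (r x)⁻¹ - (r x')⁻¹ := by field_simp
    rw [this]
    module
  rw [dist_eq_norm, e]
  have h1 : ‖(r x)⁻¹ • (x - x')‖ = dist x x' / r x := by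
    rw [norm_inv_smul_sub h0, dist_comm]
  have h2 : ‖((r x' - r x) * (r x)⁻¹ * (r x')⁻¹) • (x' - y)‖ ≤ 3 * (dist x x' / r x) := by
    rw [norm_smul, norm_mul, norm_mul, Real.norm_eq_abs, Real.norm_of_nonneg (inv_nonneg.mpr h0.le),
      Real.norm_of_nonneg (inv_nonneg.mpr h0'.le), ← dist_eq_norm, dist_comm x' y]
    have h3 : |r x' - r x| ≤ dist x x' := by rw [dist_comm]; exact hr.abs_sub_le _ _
    calc |r x' - r x| * (r x)⁻¹ * (r x')⁻¹ * dist y x'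
        ≤ dist x x' * (r x)⁻¹ * (r x')⁻¹ * (3 * r x') := by gcongr
      _ = 3 * (dist x x' / r x) := by field_simp
  calc _ ≤ _ := norm_add_le _ _
    _ ≤ dist x x' / r x + 3 * (dist x x' / r x) := add_le_add h1.le h2
    _ = _ := by ring

theorem IsScale.half_le (hr : IsScale F r) {x x' : E} (h : dist x x' ≤ r x / 2) :
    r x / 2 ≤ r x' ∧ r x' ≤ 3 / 2 * r x := by
  have := abs_le.mp (hr.abs_sub_le x x')
  constructor <;> linarith [this.1, this.2]

/-- If `y` is in neither support, both weights vanish; otherwise `dist_smul_sub_le` applies, based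
at whichever centre sees `y`. The two scales differ by a factor of at most `2`, whence `8 = 2 * 4`,
and both supports lie in the ball of radius `6 * r x`. -/
theorem abs_avgWeight_sub_le (hr : IsScale F r) {M : NNReal} (hM : LipschitzWith M (unitBump E))
    {x x' : E} (h : dist x x' ≤ r x / 2) (y : E) :
    |avgWeight r x y - avgWeight r x' y| ≤
      (Metric.ball x (6 * r x)).indicator (fun _ => 8 * M * dist x x' / r x) y := by
  have h0 := hr.pos x
  have h0' := hr.pos x'
  obtain ⟨hh1, hh2⟩ := hr.half_le h
  have hM0 := M.coe_nonneg
  have hd : 0 ≤ dist x x' := dist_nonneg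
  have key : ∀ {s : ℝ}, dist ((r x)⁻¹ • (x - y)) ((r x')⁻¹ • (x' - y)) ≤ s →
      |avgWeight r x y - avgWeight r x' y| ≤ M * s := by
    intro s hs
    have := hM.dist_le_mul ((r x)⁻¹ • (x - y)) ((r x')⁻¹ • (x' - y))
    rw [Real.dist_eq] at this
    exact this.trans (by gcongr)
  have hK : 0 ≤ 8 * M * dist x x' / r x := by positivity
  by_cases h1 : dist y x' < 3 * r x'
  · have hmem : y ∈ Metric.ball x (6 * r x) := by
      rw [Metric.mem_ball]
      have := dist_triangle y x' x
      rw [dist_comm x' x] at this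
      linarith
    rw [indicator_of_mem hmem]
    refine (key (dist_smul_sub_le hr h1.le)).trans ?_
    rw [← mul_div_assoc]
    gcongr ?_ / _
    nlinarith
  · have hw' : avgWeight r x' y = 0 := avgWeight_eq_zero hr (not_lt.mp h1)
    by_cases h2 : dist y x < 3 * r x
    · have hmem : y ∈ Metric.ball x (6 * r x) := by
        rw [Metric.mem_ball]
        linarith
      rw [indicator_of_mem hmem]
      have h3 := dist_smul_sub_le hr (x := x') h2.le
      rw [dist_comm, dist_comm x' x] at h3
      refine (key h3).trans ?_
      have : 4 * dist x x' / r x' ≤ 4 * dist x x' / (r x / 2) := by gcongr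
      calc M * (4 * dist x x' / r x') ≤ M * (4 * dist x x' / (r x / 2)) := by gcongr
        _ = _ := by field_simp; ring
    · rw [hw', avgWeight_eq_zero hr (not_lt.mp h2), sub_zero, abs_zero]
      exact indicator_nonneg (fun _ _ => hK) _

variable [MeasurableSpace E] [BorelSpace E] {σ : Measure E} [IsFiniteMeasure σ]

/-- The total mass of the averaging weight. -/
noncomputable def avgMass (σ : Measure E) (r : E → ℝ) (x : E) : ℝ := ∫ y, avgWeight r x y ∂σ

/-- The averaging kernel: the averaging weight normalized to be a probability density. -/
noncomputable def avgKernel (σ : Measure E) (r : E → ℝ) (x y : E) : ℝ :=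
  avgWeight r x y / avgMass σ r x

theorem integrable_avgWeight (r : E → ℝ) (x : E) : Integrable (avgWeight r x) σ :=
  Integrable.of_bound (continuous_avgWeight r x).aestronglyMeasurable 1
    (Filter.Eventually.of_forall fun y => by
      rw [Real.norm_of_nonneg (avgWeight_nonneg r x y)]; exact avgWeight_le_one r x y)

theorem avgKernel_nonneg (σ : Measure E) (r : E → ℝ) (x y : E) : 0 ≤ avgKernel σ r x y :=
  div_nonneg (avgWeight_nonneg r x y) (integral_nonneg (avgWeight_nonneg r x))

theorem continuous_avgKernel (σ : Measure E) (r : E → ℝ) (x : E) : Continuous (avgKernel σ r x) :=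
  (continuous_avgWeight r x).div_const _

theorem integrable_avgKernel (r : E → ℝ) (x : E) : Integrable (avgKernel σ r x) σ :=
  (integrable_avgWeight r x).div_const _

variable {m : ℕ} {c C : ℝ}

theorem measureReal_ball_le_avgMass (hr : IsScale F r) (x : E) :
    σ.real (Metric.ball x (2 * r x)) ≤ avgMass σ r x := by
  rw [avgMass, ← integral_indicator_one Metric.isOpen_ball.measurableSet]
  refine integral_mono ?_ (integrable_avgWeight r x) fun y => ?_
  · exact (integrable_const (1 : ℝ)).indicator Metric.isOpen_ball.measurableSet
  · by_cases hy : y ∈ Metric.ball x (2 * r x)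
    · rw [indicator_of_mem hy, avgWeight_eq_one hr (Metric.mem_ball.mp hy).le]; simp
    · rw [indicator_of_notMem hy]; exact avgWeight_nonneg r x y

theorem IsAhlforsRegular.le_measureReal_ball (hσ : IsAhlforsRegular σ F m c C) {y : E}
    (hy : y ∈ F) {s : ℝ} (hs : 0 < s) (hs2 : s ≤ 2) : c * s ^ m ≤ σ.real (Metric.ball y s) := by
  have := hσ.le_ball y hy s hs hs2
  rwa [ENNReal.ofReal_le_iff_le_toReal (measure_ne_top _ _)] at this

theorem IsAhlforsRegular.measureReal_ball_le (hσ : IsAhlforsRegular σ F m c C) (x : E)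
    {s : ℝ} (hs : 0 < s) : σ.real (Metric.ball x s) ≤ C * s ^ m := by
  have := hσ.ball_le x s hs
  refine ENNReal.toReal_le_of_le_ofReal (mul_nonneg hσ.nonneg (by positivity)) this

theorem IsScale.exists_mem_dist_lt (hr : IsScale F r) (hF : F.Nonempty) (x : E) :
    ∃ y ∈ F, dist x y < r x := (Metric.infDist_lt_iff hF).mp (hr.infDist_lt x)

/-- Some point of `F` is within `r x` of `x`, and the ball of radius `s` around it fits into the
ball of radius `2 * r x`. This is why the bump equals `1` out to radius `2`. -/
theorem measureReal_ball_two_mul_ge (hσ : IsAhlforsRegular σ F m c C) (hF : F.Nonempty)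
    (hr : IsScale F r) {x : E} {s : ℝ} (hs : 0 < s) (hs2 : s ≤ 2) (hsr : s ≤ r x) :
    c * s ^ m ≤ σ.real (Metric.ball x (2 * r x)) := by
  obtain ⟨y, hy, hxy⟩ := hr.exists_mem_dist_lt hF x
  refine (hσ.le_measureReal_ball hy hs hs2).trans (measureReal_mono ?_)
  refine Metric.ball_subset_ball' ?_
  rw [dist_comm]
  linarith

theorem avgMass_pos (hσ : IsAhlforsRegular σ F m c C) (hF : F.Nonempty) (hr : IsScale F r) (x : E) :
    0 < avgMass σ r x := by
  have hs : 0 < min (r x) 2 := lt_min (hr.pos x) two_pos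
  have := measureReal_ball_two_mul_ge hσ hF hr hs (min_le_right _ _) (min_le_left _ _)
  have hc := hσ.pos
  exact lt_of_lt_of_le (by positivity) (this.trans (measureReal_ball_le_avgMass hr x))

theorem le_avgMass (hσ : IsAhlforsRegular σ F m c C) (hF : F.Nonempty) (hr : IsScale F r) {x : E}
    (hx : r x ≤ 2) : c * r x ^ m ≤ avgMass σ r x :=
  (measureReal_ball_two_mul_ge hσ hF hr (hr.pos x) hx le_rfl).trans
    (measureReal_ball_le_avgMass hr x)

theorem integral_avgKernel (hσ : IsAhlforsRegular σ F m c C) (hF : F.Nonempty) (hr : IsScale F r)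
    (x : E) : ∫ y, avgKernel σ r x y ∂σ = 1 := by
  simp only [avgKernel]
  rw [integral_div]
  exact div_self (avgMass_pos hσ hF hr x).ne'

theorem abs_avgMass_sub_le (hσ : IsAhlforsRegular σ F m c C) (hr : IsScale F r) {M : NNReal}
    (hM : LipschitzWith M (unitBump E)) {x x' : E} (h : dist x x' ≤ r x / 2) :
    |avgMass σ r x - avgMass σ r x'| ≤ 8 * M * dist x x' / r x * (C * (6 * r x) ^ m) := by
  have h0 := hr.pos x
  rw [avgMass, avgMass, ← integral_sub (integrable_avgWeight r x) (integrable_avgWeight r x'),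
    ← Real.norm_eq_abs]
  refine (norm_integral_le_of_norm_le
    (g := (Metric.ball x (6 * r x)).indicator (fun _ => 8 * M * dist x x' / r x))
    ((integrable_const _).indicator Metric.isOpen_ball.measurableSet)
    (Filter.Eventually.of_forall fun y => abs_avgWeight_sub_le hr hM h y)).trans ?_
  rw [integral_indicator_const _ Metric.isOpen_ball.measurableSet, smul_eq_mul, mul_comm]
  gcongr
  exact hσ.measureReal_ball_le x (by positivity)

theorem avgKernel_le (hσ : IsAhlforsRegular σ F m c C) (hF : F.Nonempty) (hr : IsScale F r) {x : E}
    (hx : r x ≤ 1) (y : E) :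
    avgKernel σ r x y ≤ (Metric.ball x (3 * r x)).indicator (fun _ => c⁻¹ * (r x)⁻¹ ^ m) y := by
  have h0 := hr.pos x
  have hc := hσ.pos
  by_cases hy : y ∈ Metric.ball x (3 * r x)
  · rw [indicator_of_mem hy, inv_pow, ← mul_inv, avgKernel, div_eq_mul_inv]
    calc avgWeight r x y * (avgMass σ r x)⁻¹ ≤ 1 * (c * r x ^ m)⁻¹ := by
          have hW := le_avgMass hσ hF hr (hx.trans one_le_two)
          exact mul_le_mul (avgWeight_le_one r x y) (inv_anti₀ (by positivity) hW)
            (inv_nonneg.mpr ((by positivity : 0 ≤ c * r x ^ m).trans hW)) zero_le_one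
      _ = _ := one_mul _
  · rw [indicator_of_notMem hy, avgKernel, avgWeight_eq_zero hr (not_lt.mp hy), zero_div]

/-- A quotient rule: weight and mass each have relative variation of order `dist x x' / r x`, and
the mass is at least of order `r x ^ m`. -/
theorem exists_abs_avgKernel_sub_le (hσ : IsAhlforsRegular σ F m c C) (hF : F.Nonempty) :
    ∃ K, 0 ≤ K ∧ ∀ r : E → ℝ, IsScale F r → ∀ x x' y, r x ≤ 1 → dist x x' ≤ r x / 2 →
      |avgKernel σ r x y - avgKernel σ r x' y| ≤
        (Metric.ball x (6 * r x)).indicator (fun _ => K * dist x x' * (r x)⁻¹ ^ (m + 1)) y := by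
  obtain ⟨M, hM⟩ := exists_lipschitzWith_unitBump E
  have hc := hσ.pos
  have hC := hσ.nonneg
  -- The first summand comes from varying the weight, the second from varying the mass. Here `12 ^ m
  -- = 6 ^ m * 2 ^ m`: radius `6 * r x` in the upper bound, scale at least `r x / 2` in the lower
  -- one.
  refine ⟨8 * M * c⁻¹ + 8 * M * C * 12 ^ m * c⁻¹ * c⁻¹, by positivity, ?_⟩
  intro r hr x x' y hx h
  have h0 := hr.pos x
  have h0' := hr.pos x'
  obtain ⟨hh1, hh2⟩ := hr.half_le h
  have hW := avgMass_pos hσ hF hr x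
  have hW' := avgMass_pos hσ hF hr x'
  have hWl : c * r x ^ m ≤ avgMass σ r x := le_avgMass hσ hF hr (hx.trans one_le_two)
  have hWl' : c * (r x / 2) ^ m ≤ avgMass σ r x' :=
    le_trans (by gcongr) (le_avgMass hσ hF hr (x := x') (by linarith))
  have hWd := abs_avgMass_sub_le hσ hr hM h
  have hwd := abs_avgWeight_sub_le hr hM h y
  by_cases hy : y ∈ Metric.ball x (6 * r x)
  · rw [indicator_of_mem hy] at hwd ⊢
    have e : avgKernel σ r x y - avgKernel σ r x' y =
        (avgWeight r x y - avgWeight r x' y) * (avgMass σ r x)⁻¹ -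
        avgWeight r x' y * ((avgMass σ r x - avgMass σ r x') *
          (avgMass σ r x)⁻¹ * (avgMass σ r x')⁻¹) := by
      rw [avgKernel, avgKernel]
      field_simp
      ring
    have b1 : |(avgWeight r x y - avgWeight r x' y) * (avgMass σ r x)⁻¹| ≤
        (8 * M * dist x x' / r x) * (c * r x ^ m)⁻¹ := by
      rw [abs_mul, abs_of_pos (inv_pos.mpr hW)]
      gcongr
    have b2 : |avgWeight r x' y * ((avgMass σ r x - avgMass σ r x') *
          (avgMass σ r x)⁻¹ * (avgMass σ r x')⁻¹)| ≤
        1 * ((8 * M * dist x x' / r x * (C * (6 * r x) ^ m)) * (c * r x ^ m)⁻¹ *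
          (c * (r x / 2) ^ m)⁻¹) := by
      rw [abs_mul, abs_mul, abs_mul, abs_of_pos (inv_pos.mpr hW), abs_of_pos (inv_pos.mpr hW'),
        abs_of_nonneg (avgWeight_nonneg _ _ _)]
      gcongr
      exact avgWeight_le_one _ _ _
    rw [e]
    refine (abs_sub _ _).trans ((add_le_add b1 b2).trans (le_of_eq ?_))
    have : (12 : ℝ) ^ m = 6 ^ m * 2 ^ m := by rw [← mul_pow]; norm_num
    rw [this, mul_pow, div_pow, inv_pow, pow_succ]
    field_simp
  · rw [indicator_of_notMem hy]
    rw [Metric.mem_ball, not_lt] at hy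
    have hy' : 3 * r x' ≤ dist y x' := by
      have := dist_triangle y x' x
      rw [dist_comm x' x] at this
      linarith
    rw [avgKernel, avgKernel, avgWeight_eq_zero hr hy', avgWeight_eq_zero hr (by linarith)]
    simp

end Kernel

/-! ### Averages of functions on the boundary: smoothness and oscillation bounds. -/

theorem sq_setLIntegral_le {α : Type*} [MeasurableSpace α] (μ : Measure α) (s : Set α)
    {f : α → ENNReal} (hf : AEMeasurable f (μ.restrict s)) :
    (∫⁻ x in s, f x ∂μ) ^ 2 ≤ μ s * ∫⁻ x in s, f x ^ 2 ∂μ := by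
  have h := ENNReal.lintegral_mul_le_Lp_mul_Lq (μ.restrict s) Real.HolderConjugate.two_two
    (f := fun _ => 1) (g := f) aemeasurable_const hf
  simp only [Pi.mul_apply, one_mul, ENNReal.one_rpow, lintegral_const, Measure.restrict_apply,
    MeasurableSet.univ, univ_inter] at h
  calc (∫⁻ x in s, f x ∂μ) ^ 2 ≤
      (μ s ^ (1 / 2 : ℝ) * (∫⁻ x in s, f x ^ (2 : ℝ) ∂μ) ^ (1 / 2 : ℝ)) ^ 2 := by gcongr
    _ = _ := by
      rw [mul_pow, ← ENNReal.rpow_natCast, ← ENNReal.rpow_natCast, ← ENNReal.rpow_mul,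
        ← ENNReal.rpow_mul]
      norm_num

section SmoothAvg

variable {E : Type*} [NormedAddCommGroup E] [InnerProductSpace ℝ E] [FiniteDimensional ℝ E]
  [MeasurableSpace E] [BorelSpace E] {σ : Measure E} [IsFiniteMeasure σ]
  {V : Type*} [NormedAddCommGroup V] [NormedSpace ℝ V] [CompleteSpace V]
  {F : Set E} {r : E → ℝ} {m : ℕ} {c C : ℝ}

/-- The average of `φ` around `x` at scale `r x`. -/
noncomputable def smoothAvg (σ : Measure E) (r : E → ℝ) (φ : E → V) (x : E) : V :=
  ∫ y, avgKernel σ r x y • φ y ∂σ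

/-- With the scale `p` frozen the integral is a convolution against `σ`, jointly smooth in `(p, x)`;
then substitute the smooth map `x ↦ (r x, x)`. -/
theorem contDiff_integral_avgWeight_smul (hr : IsScale F r) {φ : E → V} (hφ : Integrable φ σ) :
    ContDiff ℝ ∞ fun x => ∫ y, avgWeight r x y • φ y ∂σ := by
  rw [contDiff_iff_contDiffAt]
  intro x₀
  -- An upper bound for the scales near `x₀`, which puts the supports of all the kernels into one
  -- compact ball of radius `3 * R`.
  set R := r x₀ + 1 with hR
  set g : ℝ → E → ℝ := fun p z => unitBump E (p⁻¹ • z) with hg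
  have hcd : ContDiffOn ℝ ∞ (fun q : ℝ × E => convolution φ (g q.1)
      (ContinuousLinearMap.lsmul ℝ ℝ (E := V)).flip σ q.2) (Ioo 0 R ×ˢ univ) := by
    refine contDiffOn_convolution_right_with_param (n := ⊤) _ isOpen_Ioo
      (isCompact_closedBall (0 : E) (3 * R)) ?_ hφ.locallyIntegrable ?_
    · intro p z hp hz
      refine (unitBump E).zero_of_le_dist ?_
      rw [mem_closedBall_zero_iff, not_le] at hz
      rw [dist_zero_right, norm_smul, Real.norm_of_nonneg (inv_nonneg.mpr hp.1.le), inv_mul_eq_div,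
        le_div_iff₀ hp.1]
      change 3 * p ≤ ‖z‖
      nlinarith [hp.2]
    · refine (unitBump E).contDiff.comp_contDiffOn ?_
      refine ContDiffOn.smul (ContDiffOn.inv contDiffOn_fst ?_) contDiffOn_snd
      rintro ⟨p, z⟩ ⟨hp, -⟩
      exact hp.1.ne'
  have hmem : (r x₀, x₀) ∈ Ioo 0 R ×ˢ (univ : Set E) := ⟨⟨hr.pos x₀, by linarith⟩, mem_univ _⟩
  have hat := hcd.contDiffAt ((isOpen_Ioo.prod isOpen_univ).mem_nhds hmem)
  have := ContDiffAt.comp (f := fun x => (r x, x)) x₀ hat (hr.contDiff.prodMk contDiff_id).contDiffAt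
  exact this

theorem smoothAvg_eq (φ : E → V) (x : E) :
    smoothAvg σ r φ x = (avgMass σ r x)⁻¹ • ∫ y, avgWeight r x y • φ y ∂σ := by
  rw [smoothAvg, ← integral_smul]
  congr 1
  ext y
  rw [avgKernel, smul_smul, div_eq_inv_mul]

theorem contDiff_smoothAvg (hσ : IsAhlforsRegular σ F m c C) (hF : F.Nonempty) (hr : IsScale F r)
    {φ : E → V} (hφ : Integrable φ σ) : ContDiff ℝ ∞ (smoothAvg σ r φ) := by
  have h1 : ContDiff ℝ ∞ (avgMass σ r) := by
    have := contDiff_integral_avgWeight_smul (σ := σ) hr (φ := fun _ => (1 : ℝ))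
      (integrable_const _)
    simp only [smul_eq_mul, mul_one] at this
    exact this
  have e : smoothAvg σ r φ =
      fun x => (avgMass σ r x)⁻¹ • ∫ y, avgWeight r x y • φ y ∂σ := funext (smoothAvg_eq φ)
  rw [e]
  exact (h1.inv fun x => (avgMass_pos hσ hF hr x).ne').smul
    (contDiff_integral_avgWeight_smul hr hφ)

theorem integrable_avgKernel_smul (r : E → ℝ) (x : E) {φ : E → V} (hφ : Integrable φ σ) :
    Integrable (fun y => avgKernel σ r x y • φ y) σ := by
  refine hφ.bdd_smul (C := ‖(avgMass σ r x)⁻¹‖)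
    (continuous_avgKernel σ r x).aestronglyMeasurable (Filter.Eventually.of_forall fun y => ?_)
  rw [avgKernel, div_eq_mul_inv, norm_mul, Real.norm_of_nonneg (avgWeight_nonneg r x y)]
  exact mul_le_of_le_one_left (norm_nonneg _) (avgWeight_le_one r x y)

/-- The kernel has total mass one, so constants pass through the average. All later estimates use
this to see only differences of `φ`. -/
theorem smoothAvg_sub_const (hσ : IsAhlforsRegular σ F m c C) (hF : F.Nonempty) (hr : IsScale F r)
    {φ : E → V} (hφ : Integrable φ σ) (x : E) (v : V) :
    smoothAvg σ r φ x - v = ∫ y, avgKernel σ r x y • (φ y - v) ∂σ := by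
  simp only [smul_sub]
  rw [integral_sub (integrable_avgKernel_smul r x hφ)
    ((integrable_avgKernel r x).smul_const v), integral_smul_const, integral_avgKernel hσ hF hr,
    one_smul, smoothAvg]

theorem enorm_integral_smul_le_of_le_indicator {p : E → ℝ} {s : Set E} (hs : MeasurableSet s)
    {K : ℝ} (hp : ∀ y, |p y| ≤ s.indicator (fun _ => K) y) (f : E → V) :
    ‖∫ y, p y • f y ∂σ‖ₑ ≤ ENNReal.ofReal K * ∫⁻ y in s, ‖f y‖ₑ ∂σ := by
  refine (enorm_integral_le_lintegral_enorm _).trans ?_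
  rw [← lintegral_const_mul' _ _ ENNReal.ofReal_ne_top, ← lintegral_indicator hs]
  refine lintegral_mono fun y => ?_
  have h := hp y
  by_cases hy : y ∈ s
  · rw [indicator_of_mem hy] at h ⊢
    rw [enorm_smul]
    gcongr
    rw [Real.enorm_eq_ofReal_abs]
    exact ENNReal.ofReal_le_ofReal h
  · rw [indicator_of_notMem hy] at h ⊢
    have : p y = 0 := abs_nonpos_iff.mp h
    simp [this]

theorem enorm_smoothAvg_sub_const_le (hσ : IsAhlforsRegular σ F m c C) (hF : F.Nonempty)
    (hr : IsScale F r) {φ : E → V} (hφ : Integrable φ σ) {x : E} (hx : r x ≤ 1) (v : V) :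
    ‖smoothAvg σ r φ x - v‖ₑ ≤
      ENNReal.ofReal (c⁻¹ * (r x)⁻¹ ^ m) * ∫⁻ y in Metric.ball x (3 * r x), ‖φ y - v‖ₑ ∂σ := by
  rw [smoothAvg_sub_const hσ hF hr hφ]
  refine enorm_integral_smul_le_of_le_indicator Metric.isOpen_ball.measurableSet (fun y => ?_) _
  rw [abs_of_nonneg (avgKernel_nonneg σ r x y)]
  exact avgKernel_le hσ hF hr hx y

theorem exists_enorm_smoothAvg_sub_le (hσ : IsAhlforsRegular σ F m c C) (hF : F.Nonempty) :
    ∃ K, 0 ≤ K ∧ ∀ r : E → ℝ, IsScale F r → ∀ φ : E → V, Integrable φ σ → ∀ (x x' : E) (v : V),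
      r x ≤ 1 → dist x x' ≤ r x / 2 →
      ‖smoothAvg σ r φ x - smoothAvg σ r φ x'‖ₑ ≤
        ENNReal.ofReal (K * dist x x' * (r x)⁻¹ ^ (m + 1)) *
          ∫⁻ y in Metric.ball x (6 * r x), ‖φ y - v‖ₑ ∂σ := by
  obtain ⟨K, hK, h⟩ := exists_abs_avgKernel_sub_le hσ hF
  refine ⟨K, hK, fun r hr φ hφ x x' v hx hxx' => ?_⟩
  have e : smoothAvg σ r φ x - smoothAvg σ r φ x' =
      ∫ y, (avgKernel σ r x y - avgKernel σ r x' y) • (φ y - v) ∂σ := by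
    have hφv : Integrable (fun y => φ y - v) σ := hφ.sub (integrable_const v)
    simp only [sub_smul (avgKernel σ r x _)]
    rw [integral_sub (integrable_avgKernel_smul r x hφv) (integrable_avgKernel_smul r x' hφv),
      ← smoothAvg_sub_const hσ hF hr hφ, ← smoothAvg_sub_const hσ hF hr hφ, sub_sub_sub_cancel_right]
  rw [e]
  exact enorm_integral_smul_le_of_le_indicator Metric.isOpen_ball.measurableSet
    (fun y => h r hr x x' y hx hxx') _

/-- Cauchy–Schwarz on the ball: the squared kernel bound `r^{-2m}` times the ball mass `r^m` leaves
`r^{-m}`. -/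
theorem exists_enorm_smoothAvg_sub_const_sq_le (hσ : IsAhlforsRegular σ F m c C)
    (hF : F.Nonempty) :
    ∃ K, 0 ≤ K ∧ ∀ r : E → ℝ, IsScale F r → ∀ φ : E → V, Integrable φ σ → ∀ (x : E) (v : V),
      r x ≤ 1 → ‖smoothAvg σ r φ x - v‖ₑ ^ 2 ≤
        ENNReal.ofReal (K * (r x)⁻¹ ^ m) *
          ∫⁻ y in Metric.ball x (3 * r x), ‖φ y - v‖ₑ ^ 2 ∂σ := by
  have hc := hσ.pos
  have hC := hσ.nonneg
  refine ⟨c⁻¹ ^ 2 * C * 3 ^ m, by positivity, fun r hr φ hφ x v hx => ?_⟩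
  have h0 := hr.pos x
  have hm : AEMeasurable (fun y => ‖φ y - v‖ₑ) σ :=
    (hφ.aestronglyMeasurable.sub aestronglyMeasurable_const).enorm
  calc ‖smoothAvg σ r φ x - v‖ₑ ^ 2
      ≤ (ENNReal.ofReal (c⁻¹ * (r x)⁻¹ ^ m) *
          ∫⁻ y in Metric.ball x (3 * r x), ‖φ y - v‖ₑ ∂σ) ^ 2 := by
        gcongr
        exact enorm_smoothAvg_sub_const_le hσ hF hr hφ hx v
    _ ≤ ENNReal.ofReal (c⁻¹ * (r x)⁻¹ ^ m) ^ 2 * (ENNReal.ofReal (C * (3 * r x) ^ m) *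
          ∫⁻ y in Metric.ball x (3 * r x), ‖φ y - v‖ₑ ^ 2 ∂σ) := by
        rw [mul_pow]
        gcongr
        refine (sq_setLIntegral_le σ _ hm.restrict).trans ?_
        gcongr
        exact hσ.ball_le _ _ (by positivity)
    _ = _ := by
        rw [← mul_assoc, ← ENNReal.ofReal_pow (by positivity), ← ENNReal.ofReal_mul (by positivity)]
        congr 2
        simp only [mul_pow, inv_pow]
        field_simp

/-- Take the free constant to be `φ z` and average over `z` in the ball. Cauchy–Schwarz gives
`r^{-2(m+1)} r^m`, and dividing by the mass of the ball gives one more `r^{-m}`. -/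
theorem exists_enorm_smoothAvg_sub_sq_le (hσ : IsAhlforsRegular σ F m c C) (hF : F.Nonempty) :
    ∃ K, 0 ≤ K ∧ ∀ r : E → ℝ, IsScale F r → ∀ φ : E → V, Integrable φ σ → ∀ x x' : E,
      r x ≤ 1 → dist x x' ≤ r x / 2 →
      ‖smoothAvg σ r φ x - smoothAvg σ r φ x'‖ₑ ^ 2 ≤
        ENNReal.ofReal (K * dist x x' ^ 2 * (r x)⁻¹ ^ (2 * m + 2)) *
          ∫⁻ z in Metric.ball x (6 * r x), ∫⁻ y in Metric.ball x (6 * r x),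
            ‖φ y - φ z‖ₑ ^ 2 ∂σ ∂σ := by
  have hc := hσ.pos
  have hC := hσ.nonneg
  obtain ⟨K, hK, h⟩ := exists_enorm_smoothAvg_sub_le (V := V) hσ hF
  refine ⟨K ^ 2 * C * 6 ^ m * c⁻¹, by positivity, fun r hr φ hφ x x' hx hxx' => ?_⟩
  have h0 := hr.pos x
  set B := Metric.ball x (6 * r x) with hB
  set X := ‖smoothAvg σ r φ x - smoothAvg σ r φ x'‖ₑ ^ 2 with hX
  have hz : ∀ z, X ≤ ENNReal.ofReal (K ^ 2 * dist x x' ^ 2 * C * 6 ^ m * (r x)⁻¹ ^ (m + 2)) *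
      ∫⁻ y in B, ‖φ y - φ z‖ₑ ^ 2 ∂σ := by
    intro z
    have hm : AEMeasurable (fun y => ‖φ y - φ z‖ₑ) σ :=
      (hφ.aestronglyMeasurable.sub aestronglyMeasurable_const).enorm
    calc X ≤ (ENNReal.ofReal (K * dist x x' * (r x)⁻¹ ^ (m + 1)) *
          ∫⁻ y in B, ‖φ y - φ z‖ₑ ∂σ) ^ 2 := by
          rw [hX]
          gcongr
          exact h r hr φ hφ x x' (φ z) hx hxx'
      _ ≤ ENNReal.ofReal (K * dist x x' * (r x)⁻¹ ^ (m + 1)) ^ 2 *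
          (ENNReal.ofReal (C * (6 * r x) ^ m) * ∫⁻ y in B, ‖φ y - φ z‖ₑ ^ 2 ∂σ) := by
          rw [mul_pow]
          gcongr
          refine (sq_setLIntegral_le σ _ hm.restrict).trans ?_
          gcongr
          exact hσ.ball_le _ _ (by positivity)
      _ = _ := by
          rw [← mul_assoc, ← ENNReal.ofReal_pow (by positivity),
            ← ENNReal.ofReal_mul (by positivity)]
          congr 2
          simp only [mul_pow, inv_pow, pow_succ]
          field_simp
  have hlow : ENNReal.ofReal (c * r x ^ m) ≤ σ B := by
    rw [← ENNReal.ofReal_toReal (measure_ne_top σ B)]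
    refine ENNReal.ofReal_le_ofReal ?_
    refine (measureReal_ball_two_mul_ge hσ hF hr h0 (hx.trans one_le_two) le_rfl).trans ?_
    exact measureReal_mono (Metric.ball_subset_ball (by linarith))
  have hint : ENNReal.ofReal (c * r x ^ m) * X ≤
      ENNReal.ofReal (K ^ 2 * dist x x' ^ 2 * C * 6 ^ m * (r x)⁻¹ ^ (m + 2)) *
      ∫⁻ z in B, ∫⁻ y in B, ‖φ y - φ z‖ₑ ^ 2 ∂σ ∂σ := by
    calc ENNReal.ofReal (c * r x ^ m) * X ≤ σ B * X := by gcongr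
      _ = ∫⁻ z in B, X ∂σ := by rw [setLIntegral_const, mul_comm]
      _ ≤ _ := by
        rw [← lintegral_const_mul' _ _ ENNReal.ofReal_ne_top]
        exact lintegral_mono fun z => hz z
  calc X = ENNReal.ofReal ((c * r x ^ m)⁻¹) * (ENNReal.ofReal (c * r x ^ m) * X) := by
        rw [← mul_assoc, ← ENNReal.ofReal_mul (by positivity), inv_mul_cancel₀ (by positivity),
          ENNReal.ofReal_one, one_mul]
    _ ≤ ENNReal.ofReal ((c * r x ^ m)⁻¹) * _ := mul_le_mul' le_rfl hint
    _ = _ := by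
        rw [← mul_assoc, ← ENNReal.ofReal_mul (by positivity)]
        congr 2
        simp only [mul_pow, inv_pow, pow_succ, pow_mul]
        field_simp
        simp

theorem enorm_fderiv_sq_le_of_eventually {f : E → V} {x : E} {a : ENNReal}
    (h : ∀ᶠ x' in nhds x, ‖f x - f x'‖ₑ ^ 2 ≤ ENNReal.ofReal (dist x x' ^ 2) * a) :
    ‖fderiv ℝ f x‖ₑ ^ 2 ≤ a := by
  by_cases ha : a = ⊤
  · simp [ha]
  have hle : ‖fderiv ℝ f x‖ ≤ Real.sqrt a.toReal := by
    refine norm_fderiv_le_of_lip' ℝ (Real.sqrt_nonneg _) ?_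
    filter_upwards [h] with x' hx'
    have h1 : ‖f x - f x'‖ ^ 2 ≤ dist x x' ^ 2 * a.toReal := by
      have := ENNReal.toReal_mono (ENNReal.mul_ne_top ENNReal.ofReal_ne_top ha) hx'
      rwa [ENNReal.toReal_pow, ENNReal.toReal_mul, toReal_enorm,
        ENNReal.toReal_ofReal (by positivity)] at this
    rw [norm_sub_rev, ← dist_eq_norm x' x, dist_comm x' x]
    refine (Real.le_sqrt_of_sq_le h1).trans (le_of_eq ?_)
    rw [Real.sqrt_mul (by positivity), Real.sqrt_sq dist_nonneg, mul_comm]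
  have h2 : ‖fderiv ℝ f x‖ ^ 2 ≤ a.toReal := by
    calc ‖fderiv ℝ f x‖ ^ 2 ≤ Real.sqrt a.toReal ^ 2 := by gcongr
      _ = _ := Real.sq_sqrt ENNReal.toReal_nonneg
  rw [← ofReal_norm, ← ENNReal.ofReal_pow (norm_nonneg _), ← ENNReal.ofReal_toReal ha]
  exact ENNReal.ofReal_le_ofReal h2

theorem IsScale.eventually_dist_le (hr : IsScale F r) (x : E) :
    ∀ᶠ x' in nhds x, dist x x' ≤ r x / 2 := by
  filter_upwards [Metric.ball_mem_nhds x (half_pos (hr.pos x))] with x' hx'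
  rw [dist_comm]
  exact (Metric.mem_ball.mp hx').le

theorem exists_enorm_fderiv_smoothAvg_sq_le (hσ : IsAhlforsRegular σ F m c C) (hF : F.Nonempty) :
    ∃ K, 0 ≤ K ∧ ∀ r : E → ℝ, IsScale F r → ∀ φ : E → V, Integrable φ σ → ∀ x : E,
      r x ≤ 1 →
      ‖fderiv ℝ (smoothAvg σ r φ) x‖ₑ ^ 2 ≤
        ENNReal.ofReal (K * (r x)⁻¹ ^ (2 * m + 2)) *
          ∫⁻ z in Metric.ball x (6 * r x), ∫⁻ y in Metric.ball x (6 * r x),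
            ‖φ y - φ z‖ₑ ^ 2 ∂σ ∂σ := by
  obtain ⟨K, hK, h⟩ := exists_enorm_smoothAvg_sub_sq_le (V := V) hσ hF
  refine ⟨K, hK, fun r hr φ hφ x hx => enorm_fderiv_sq_le_of_eventually ?_⟩
  filter_upwards [hr.eventually_dist_le x] with x' hx'
  refine (h r hr φ hφ x x' hx hx').trans (le_of_eq ?_)
  rw [← mul_assoc, ← ENNReal.ofReal_mul (by positivity)]
  congr 2
  ring

end SmoothAvg

/-! ### Integrating the oscillation bounds over space. -/

theorem tsum_ofReal_mul_half_pow {K : ℝ} (hK : 0 ≤ K) :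
    ∑' n : ℕ, ENNReal.ofReal (K * (1 / 2) ^ n) = ENNReal.ofReal (2 * K) := by
  rw [← ENNReal.ofReal_tsum_of_nonneg (fun n => by positivity)
    (summable_geometric_two.mul_left K), tsum_mul_left, tsum_geometric_two, mul_comm]

/-- Dyadic decomposition: at distance about `2^{-n} R` the integrand is of order `(2^{-n} R)^{-a}`
and the mass at most of order `(2^{-n} R)^{a+1}`, so the contributions form a geometric series. -/
theorem setLIntegral_ball_inv_dist_pow_le {E : Type*} [MetricSpace E] [MeasurableSpace E]
    [BorelSpace E] (μ : Measure E) {a : ℕ} {C : ℝ} (hC : 0 ≤ C) {x : E}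
    (h : ∀ s, 0 < s → μ (Metric.ball x s) ≤ ENNReal.ofReal (C * s ^ (a + 1))) {R : ℝ}
    (hR : 0 < R) :
    ∫⁻ y in Metric.ball x R, ENNReal.ofReal ((dist x y)⁻¹ ^ a) ∂μ ≤
      ENNReal.ofReal (4 ^ (a + 1) * C * R) := by
  set b : ℕ → ENNReal := fun n => ENNReal.ofReal ((R * (1 / 2) ^ (n + 1))⁻¹ ^ a) with hb
  set B : ℕ → Set E := fun n => Metric.ball x (2 * R * (1 / 2) ^ n) with hB
  have hpt : ∀ y ∈ Metric.ball x R, ENNReal.ofReal ((dist x y)⁻¹ ^ a) ≤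
      ∑' n, (B n).indicator (fun _ => b n) y := by
    intro y hy
    rw [Metric.mem_ball, dist_comm] at hy
    obtain ⟨n, hn1, hn2⟩ : ∃ n : ℕ, dist x y < 2 * R * (1 / 2) ^ n ∧
        (dist x y)⁻¹ ≤ (R * (1 / 2) ^ (n + 1))⁻¹ := by
      rcases (dist_nonneg (x := x) (y := y)).eq_or_lt with h0 | h0
      -- The centre needs no special care because `0⁻¹ = 0`.
      · refine ⟨0, ?_, ?_⟩
        · rw [← h0]; positivity
        · rw [← h0, inv_zero]; positivity
      · obtain ⟨n, hn1, hn2⟩ := exists_nat_pow_near_of_lt_one (x := dist x y / R)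
          (y := (1 / 2 : ℝ)) (by positivity) (by rw [div_le_one hR]; exact hy.le)
          (by norm_num) (by norm_num)
        rw [lt_div_iff₀ hR] at hn1
        rw [div_le_iff₀ hR] at hn2
        refine ⟨n, ?_, ?_⟩
        · have : 0 < R * (1 / 2) ^ n := by positivity
          nlinarith
        · refine inv_anti₀ (by positivity) ?_
          rw [mul_comm]; exact hn1.le
    refine le_trans ?_ (ENNReal.le_tsum n)
    rw [indicator_of_mem (by rw [hB, Metric.mem_ball, dist_comm]; exact hn1)]
    refine ENNReal.ofReal_le_ofReal ?_
    exact pow_le_pow_left₀ (inv_nonneg.mpr dist_nonneg) hn2 a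
  calc ∫⁻ y in Metric.ball x R, ENNReal.ofReal ((dist x y)⁻¹ ^ a) ∂μ
      ≤ ∫⁻ y in Metric.ball x R, ∑' n, (B n).indicator (fun _ => b n) y ∂μ :=
        setLIntegral_mono' Metric.isOpen_ball.measurableSet hpt
    _ ≤ ∫⁻ y, ∑' n, (B n).indicator (fun _ => b n) y ∂μ := setLIntegral_le_lintegral _ _
    _ = ∑' n, b n * μ (B n) := by
        rw [lintegral_tsum fun n =>
          (measurable_const.indicator Metric.isOpen_ball.measurableSet).aemeasurable]
        congr 1
        ext n
        rw [lintegral_indicator_const Metric.isOpen_ball.measurableSet]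
    _ ≤ ∑' n : ℕ, ENNReal.ofReal ((2 ^ (2 * a + 1) * C * R) * (1 / 2) ^ n) := by
        refine ENNReal.tsum_le_tsum fun n => ?_
        refine (mul_le_mul' le_rfl (h _ (by positivity))).trans (le_of_eq ?_)
        rw [hb, ← ENNReal.ofReal_mul (by positivity)]
        congr 1
        have h1 : ((1 / 2 : ℝ) ^ n) ≠ 0 := by positivity
        rw [inv_pow, pow_succ (1 / 2 : ℝ) n, pow_succ _ a]
        generalize (1 / 2 : ℝ) ^ n = t at h1
        simp only [mul_pow, pow_succ, pow_mul, one_div, inv_pow]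
        field_simp
        simp
    _ = _ := by
        rw [tsum_ofReal_mul_half_pow (by positivity)]
        congr 1
        have : (4 : ℝ) = 2 ^ 2 := by norm_num
        rw [this, ← pow_mul]
        ring

/-- Scaling by `s` turns the integrand into `s^{-2n}` times a fixed function, integrable as `2n >
n`; the Jacobian gives back `s^n`. -/
theorem exists_lintegral_inv_add_norm_pow_le (E : Type*) [NormedAddCommGroup E]
    [InnerProductSpace ℝ E] [FiniteDimensional ℝ E] [MeasurableSpace E] [BorelSpace E]
    {n : ℕ} (hn : Module.finrank ℝ E = n) (hn0 : 0 < n) :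
    ∃ J, 0 ≤ J ∧ ∀ s, 0 < s → ∀ y : E,
      ∫⁻ x : E, ENNReal.ofReal ((s + dist x y)⁻¹ ^ (2 * n)) ≤ ENNReal.ofReal (J * s⁻¹ ^ n) := by
  set f : E → ℝ := fun z => (1 + ‖z‖)⁻¹ ^ (2 * n) with hf
  have hfi : Integrable f := by
    have h := integrable_one_add_norm (μ := (volume : Measure E)) (r := ((2 * n : ℕ) : ℝ))
      (by rw [hn]; exact_mod_cast (by omega : n < 2 * n))
    refine h.congr (Filter.Eventually.of_forall fun z => ?_)
    simp only [hf]
    rw [Real.rpow_neg (by positivity), Real.rpow_natCast, inv_pow]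
  have hf0 : ∀ z, 0 ≤ f z := fun z => by positivity
  refine ⟨∫ z, f z, integral_nonneg hf0, fun s hs y => ?_⟩
  have e : ∀ x, (s + dist x y)⁻¹ ^ (2 * n) = s⁻¹ ^ (2 * n) * f (s⁻¹ • (x - y)) := by
    intro x
    simp only [hf]
    rw [← mul_pow, ← mul_inv, norm_smul, Real.norm_of_nonneg (inv_nonneg.mpr hs.le), mul_add,
      mul_inv_cancel_left₀ hs.ne', mul_one, dist_eq_norm]
  have hi : Integrable fun x => s⁻¹ ^ (2 * n) * f (s⁻¹ • (x - y)) :=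
    ((hfi.comp_smul (inv_ne_zero hs.ne')).comp_sub_right y).const_mul _
  simp only [e]
  rw [← ofReal_integral_eq_lintegral_ofReal hi
    (Filter.Eventually.of_forall fun x => mul_nonneg (by positivity) (hf0 _))]
  refine ENNReal.ofReal_le_ofReal (le_of_eq ?_)
  rw [integral_const_mul, integral_sub_right_eq_self (fun x => f (s⁻¹ • x)),
    Measure.integral_comp_inv_smul_of_nonneg _ _ hs.le, hn, smul_eq_mul]
  have : s⁻¹ ^ (2 * n) = s⁻¹ ^ n * s⁻¹ ^ n := by ring
  rw [this]
  have h1 : s⁻¹ ^ n * s ^ n = 1 := by rw [← mul_pow, inv_mul_cancel₀ hs.ne', one_pow]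
  linear_combination (s⁻¹ ^ n * ∫ z, f z) * h1

section Energy

variable {E : Type*} [NormedAddCommGroup E] [InnerProductSpace ℝ E] [FiniteDimensional ℝ E]
  [MeasurableSpace E] [BorelSpace E]
  {F : Set E} {r : E → ℝ} {m : ℕ} {c C : ℝ}

/-- If `y` and `z` are within `6 * r x` of `x`, then `dist y z + dist x y ≤ 18 * r x`. So by Tonelli
the weight integrates over `x` to at most a multiple of `∫ (|y - z| + |x - y|)^{-2(m+1)} dx`, which
is of order `|y - z|^{-(m+1)}`. The diagonal is dealt with by `G z z = 0`, since there the inverse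
distance is `0`. -/
theorem exists_lintegral_double_average_le (hE : Module.finrank ℝ E = m + 1) :
    ∃ K, 0 ≤ K ∧ ∀ (σ : Measure E) [IsFiniteMeasure σ] (r : E → ℝ), IsScale F r →
      ∀ G : E → E → ENNReal, Measurable (Function.uncurry G) → (∀ z, G z z = 0) →
      ∫⁻ x, ENNReal.ofReal ((r x)⁻¹ ^ (2 * m + 2)) *
        ∫⁻ z in Metric.ball x (6 * r x), ∫⁻ y in Metric.ball x (6 * r x), G y z ∂σ ∂σ ≤
      ENNReal.ofReal K * ∫⁻ z, ∫⁻ y, G y z * ENNReal.ofReal ((dist y z)⁻¹ ^ (m + 1)) ∂σ ∂σ := by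
  obtain ⟨J, hJ, hJb⟩ := exists_lintegral_inv_add_norm_pow_le E hE m.succ_pos
  refine ⟨18 ^ (2 * (m + 1)) * J, by positivity, fun σ _ r hr G hG hG0 => ?_⟩
  obtain ⟨H, hH⟩ : ∃ H : E → E → E → ENNReal, H = fun x z y =>
    ENNReal.ofReal ((18 * (dist y z + dist x y)⁻¹) ^ (2 * (m + 1))) * G y z := ⟨_, rfl⟩
  have hHm : Measurable fun p : E × E × E => H p.1 p.2.1 p.2.2 := by
    rw [hH]
    refine Measurable.mul ?_ ?_
    · exact (by fun_prop : Measurable fun p : E × E × E =>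
        (18 * (dist p.2.2 p.2.1 + dist p.1 p.2.2)⁻¹) ^ (2 * (m + 1))).ennreal_ofReal
    · exact hG.comp (measurable_snd.snd.prodMk measurable_snd.fst)
  have hpt : ∀ x, ENNReal.ofReal ((r x)⁻¹ ^ (2 * m + 2)) *
        ∫⁻ z in Metric.ball x (6 * r x), ∫⁻ y in Metric.ball x (6 * r x), G y z ∂σ ∂σ ≤
        ∫⁻ z, ∫⁻ y, H x z y ∂σ ∂σ := by
    intro x
    have h0 := hr.pos x
    rw [← lintegral_const_mul' _ _ ENNReal.ofReal_ne_top]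
    refine le_trans ?_ (setLIntegral_le_lintegral (Metric.ball x (6 * r x)) _)
    refine setLIntegral_mono' Metric.isOpen_ball.measurableSet fun z hz => ?_
    rw [← lintegral_const_mul' _ _ ENNReal.ofReal_ne_top]
    refine le_trans ?_ (setLIntegral_le_lintegral (Metric.ball x (6 * r x)) _)
    refine setLIntegral_mono' Metric.isOpen_ball.measurableSet fun y hy => ?_
    rcases eq_or_ne y z with rfl | hyz
    · rw [hH]; simp [hG0]
    rw [hH]
    simp only
    gcongr
    rw [show 2 * m + 2 = 2 * (m + 1) by ring]
    refine pow_le_pow_left₀ (inv_nonneg.mpr h0.le) ?_ _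
    rw [Metric.mem_ball] at hy hz
    have h1 := dist_triangle y x z
    rw [dist_comm x z] at h1
    have h2 : 0 < dist y z := dist_pos.mpr hyz
    have h3 : dist y z + dist x y ≤ 18 * r x := by rw [dist_comm x y]; linarith
    rw [← div_eq_mul_inv, inv_eq_one_div, div_le_div_iff₀ h0 (by positivity)]
    linarith
  calc _ ≤ ∫⁻ x, ∫⁻ z, ∫⁻ y, H x z y ∂σ ∂σ := lintegral_mono hpt
    _ = ∫⁻ z, (∫⁻ x, ∫⁻ y, H x z y ∂σ) ∂σ := by
        have h1 : Measurable fun q : (E × E) × E => H q.1.1 q.1.2 q.2 :=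
          hHm.comp (measurable_fst.fst.prodMk (measurable_fst.snd.prodMk measurable_snd))
        exact lintegral_lintegral_swap (f := fun x z => ∫⁻ y, H x z y ∂σ)
          (h1.lintegral_prod_right' (ν := σ)).aemeasurable
    _ = ∫⁻ z, ∫⁻ y, (∫⁻ x, H x z y) ∂σ ∂σ := by
        refine lintegral_congr fun z => ?_
        have h1 : Measurable fun q : E × E => H q.1 z q.2 :=
          hHm.comp (measurable_fst.prodMk (measurable_const.prodMk measurable_snd))
        exact lintegral_lintegral_swap (f := fun x y => H x z y) h1.aemeasurable
    _ ≤ ∫⁻ z, ∫⁻ y, ENNReal.ofReal (18 ^ (2 * (m + 1)) * J) *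
          (G y z * ENNReal.ofReal ((dist y z)⁻¹ ^ (m + 1))) ∂σ ∂σ := by
        refine lintegral_mono fun z => lintegral_mono fun y => ?_
        rcases eq_or_ne y z with rfl | hyz
        · simp [hH, hG0]
        simp only [hH, mul_pow]
        have hm1 : Measurable fun x : E =>
            ENNReal.ofReal (18 ^ (2 * (m + 1)) * (dist y z + dist x y)⁻¹ ^ (2 * (m + 1))) :=
          (by fun_prop : Measurable fun x : E =>
            (18 ^ (2 * (m + 1)) * (dist y z + dist x y)⁻¹ ^ (2 * (m + 1)))).ennreal_ofReal
        rw [lintegral_mul_const _ hm1]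
        simp only [ENNReal.ofReal_mul (by positivity : (0 : ℝ) ≤ 18 ^ (2 * (m + 1)))]
        rw [lintegral_const_mul' _ _ ENNReal.ofReal_ne_top, mul_assoc, mul_assoc]
        refine mul_le_mul' le_rfl ?_
        rw [mul_left_comm, mul_comm _ (G y z)]
        refine mul_le_mul' le_rfl ?_
        rw [← ENNReal.ofReal_mul hJ]
        exact hJb _ (dist_pos.mpr hyz) y
    _ = _ := by
        simp only [lintegral_const_mul' _ _ ENNReal.ofReal_ne_top]

/-- Tonelli again: `x` sees `y` only if `dist y x < 3 * r x ≤ 3 * δ`, so the weight is at most `3^m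
|x - y|^{-m}`, whose integral over a ball of radius `3 * δ` in dimension `m + 1` is of order `δ`. -/
theorem exists_setLIntegral_average_le (hE : Module.finrank ℝ E = m + 1) :
    ∃ K, 0 ≤ K ∧ ∀ (σ : Measure E) [IsFiniteMeasure σ] (r : E → ℝ), IsScale F r →
      ∀ δ, 0 < δ → ∀ f : E → ENNReal, Measurable f →
      ∫⁻ x in {x | r x ≤ δ}, ENNReal.ofReal ((r x)⁻¹ ^ m) *
        ∫⁻ y in Metric.ball x (3 * r x), f y ∂σ ≤ ENNReal.ofReal (K * δ) * ∫⁻ y, f y ∂σ := by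
  have hnt : Nontrivial E := Module.nontrivial_of_finrank_pos (R := ℝ) (by omega)
  set v : ℝ := (volume (Metric.ball (0 : E) 1)).toReal with hv
  have hv0 : 0 ≤ v := ENNReal.toReal_nonneg
  have hvol : ∀ (y : E) s, 0 < s →
      volume (Metric.ball y s) ≤ ENNReal.ofReal (v * s ^ (m + 1)) := by
    intro y s hs
    rw [Measure.addHaar_ball _ _ hs.le, mul_comm v, ENNReal.ofReal_mul (by positivity), hv,
      ENNReal.ofReal_toReal measure_ball_lt_top.ne, hE]
  refine ⟨3 ^ m * (4 ^ (m + 1) * v * 3), by positivity, fun σ _ r hr δ hδ f hf => ?_⟩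
  have hS : MeasurableSet {x | r x ≤ δ} := (isClosed_le hr.continuous continuous_const).measurableSet
  set T : Set (E × E) := {p | r p.1 ≤ δ ∧ dist p.2 p.1 < 3 * r p.1} with hT
  have hTm : MeasurableSet T := by
    refine MeasurableSet.inter ?_ ?_
    · exact (isClosed_le (hr.continuous.comp continuous_fst) continuous_const).measurableSet
    · have h3 := hr.continuous
      exact (isOpen_lt (f := fun p : E × E => dist p.2 p.1) (g := fun p => 3 * r p.1)
        (by fun_prop) (by fun_prop)).measurableSet
  set H : E × E → ENNReal := T.indicator fun p => ENNReal.ofReal ((r p.1)⁻¹ ^ m) * f p.2 with hH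
  have hHm : Measurable H := by
    refine Measurable.indicator (Measurable.mul ?_ (hf.comp measurable_snd)) hTm
    have h3 := hr.continuous.measurable
    exact (by fun_prop : Measurable fun p : E × E => (r p.1)⁻¹ ^ m).ennreal_ofReal
  calc ∫⁻ x in {x | r x ≤ δ}, ENNReal.ofReal ((r x)⁻¹ ^ m) *
        ∫⁻ y in Metric.ball x (3 * r x), f y ∂σ
      ≤ ∫⁻ x in {x | r x ≤ δ}, ∫⁻ y, H (x, y) ∂σ := by
        refine setLIntegral_mono' hS fun x hx => ?_
        rw [← lintegral_const_mul' _ _ ENNReal.ofReal_ne_top,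
          ← lintegral_indicator Metric.isOpen_ball.measurableSet]
        refine lintegral_mono fun y => ?_
        by_cases hy : y ∈ Metric.ball x (3 * r x)
        · rw [indicator_of_mem hy, hH, indicator_of_mem (show (x, y) ∈ T from ⟨hx, hy⟩)]
        · rw [indicator_of_notMem hy]; exact zero_le
    _ ≤ ∫⁻ x, ∫⁻ y, H (x, y) ∂σ := setLIntegral_le_lintegral _ _
    _ = ∫⁻ y, (∫⁻ x, H (x, y)) ∂σ :=
        lintegral_lintegral_swap (f := fun x y => H (x, y)) hHm.aemeasurable
    _ ≤ ∫⁻ y, ENNReal.ofReal (3 ^ m * (4 ^ (m + 1) * v * 3) * δ) * f y ∂σ := by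
        refine lintegral_mono fun y => ?_
        calc ∫⁻ x, H (x, y) ≤ ∫⁻ x, (Metric.ball y (3 * δ)).indicator
              (fun x => ENNReal.ofReal (3 ^ m) * ENNReal.ofReal ((dist y x)⁻¹ ^ m)) x * f y := by
              -- At `x = y` the pointwise bound can fail, because `0⁻¹ = 0`; that is a null set.
              have hne : ∀ᵐ x : E, x ≠ y := by
                rw [ae_iff]
                simp
              refine lintegral_mono_ae (hne.mono fun x hx => ?_)
              by_cases hxy : (x, y) ∈ T
              · have h0 := hr.pos x
                have h1 : r x ≤ δ := hxy.1
                have h2 : dist y x < 3 * r x := hxy.2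
                have hmem : x ∈ Metric.ball y (3 * δ) := by
                  rw [Metric.mem_ball, dist_comm]; linarith
                rw [hH, indicator_of_mem hxy, indicator_of_mem hmem,
                  ← ENNReal.ofReal_mul (by positivity), ← mul_pow]
                gcongr
                have h4 : 0 < dist y x := dist_pos.mpr hx.symm
                rw [← div_eq_mul_inv, inv_eq_one_div, div_le_div_iff₀ h0 h4]
                linarith
              · rw [hH, indicator_of_notMem hxy]; exact zero_le
          _ = (∫⁻ x in Metric.ball y (3 * δ),
                ENNReal.ofReal (3 ^ m) * ENNReal.ofReal ((dist y x)⁻¹ ^ m)) * f y := by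
              have hm1 : Measurable fun x : E =>
                  ENNReal.ofReal (3 ^ m) * ENNReal.ofReal ((dist y x)⁻¹ ^ m) :=
                (by fun_prop : Measurable fun x : E => (dist y x)⁻¹ ^ m).ennreal_ofReal.const_mul _
              rw [lintegral_mul_const _ (hm1.indicator Metric.isOpen_ball.measurableSet),
                lintegral_indicator Metric.isOpen_ball.measurableSet]
          _ ≤ _ := by
              rw [lintegral_const_mul' _ _ ENNReal.ofReal_ne_top]
              gcongr
              rw [mul_assoc, ENNReal.ofReal_mul (by positivity)]
              gcongr
              refine (setLIntegral_ball_inv_dist_pow_le volume hv0 (hvol y)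
                (by positivity)).trans (le_of_eq ?_)
              congr 1
              ring
    _ = _ := lintegral_const_mul' _ _ ENNReal.ofReal_ne_top

end Energy

/-! ### The extension to a layer of width `δ` and its energy. -/

theorem ENNReal.add_sq_le_two_mul (a b : ENNReal) : (a + b) ^ 2 ≤ 2 * (a ^ 2 + b ^ 2) := by
  have := ENNReal.rpow_add_le_mul_rpow_add_rpow a b (p := 2) one_le_two
  norm_num at this
  exact this

/-- A fixed bump function on the line, equal to `1` on `[-1/2, 1/2]` and vanishing off `(-1, 1)`. -/
noncomputable def heightBump : ContDiffBump (0 : ℝ) := ⟨1 / 2, 1, by norm_num, by norm_num⟩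

theorem exists_lipschitzWith_heightBump : ∃ M, LipschitzWith M heightBump :=
  ContDiff.lipschitzWith_of_hasCompactSupport (𝕂 := ℝ) (n := 1) heightBump.hasCompactSupport
    heightBump.contDiff one_ne_zero

section Layer

variable {E : Type*} [NormedAddCommGroup E] [InnerProductSpace ℝ E] [FiniteDimensional ℝ E]

/-- Cutoff to the layer where `r ≤ δ`. -/
noncomputable def layerCutoff (r : E → ℝ) (δ : ℝ) (x : E) : ℝ := heightBump (r x / δ)

variable {F : Set E} {r : E → ℝ} {δ : ℝ}

theorem layerCutoff_nonneg (r : E → ℝ) (δ : ℝ) (x : E) : 0 ≤ layerCutoff r δ x := heightBump.nonneg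

theorem layerCutoff_le_one (r : E → ℝ) (δ : ℝ) (x : E) : layerCutoff r δ x ≤ 1 := heightBump.le_one

theorem contDiff_layerCutoff (hr : IsScale F r) : ContDiff ℝ ∞ (layerCutoff r δ) :=
  heightBump.contDiff.comp (hr.contDiff.div_const δ)

theorem layerCutoff_eq_one (hr : IsScale F r) (hδ : 0 < δ) {x : E} (h : r x ≤ δ / 2) :
    layerCutoff r δ x = 1 := by
  refine heightBump.one_of_mem_closedBall ?_
  rw [mem_closedBall_zero_iff, Real.norm_of_nonneg (div_nonneg (hr.pos x).le hδ.le),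
    div_le_iff₀ hδ]
  change r x ≤ 1 / 2 * δ
  linarith

theorem layerCutoff_eq_zero (hr : IsScale F r) (hδ : 0 < δ) {x : E} (h : δ ≤ r x) :
    layerCutoff r δ x = 0 := by
  refine heightBump.zero_of_le_dist ?_
  rw [dist_zero_right, Real.norm_of_nonneg (div_nonneg (hr.pos x).le hδ.le), le_div_iff₀ hδ]
  change 1 * δ ≤ r x
  linarith

theorem norm_fderiv_layerCutoff_le (hr : IsScale F r) (hδ : 0 < δ) {M : NNReal}
    (hM : LipschitzWith M heightBump) (x : E) : ‖fderiv ℝ (layerCutoff r δ) x‖ ≤ M / δ := by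
  refine norm_fderiv_le_of_lip' ℝ (by positivity) (Filter.Eventually.of_forall fun x' => ?_)
  rw [← dist_eq_norm, ← dist_eq_norm]
  refine (hM.dist_le_mul _ _).trans ?_
  rw [Real.dist_eq, ← sub_div, abs_div, abs_of_pos hδ, div_mul_eq_mul_div, mul_div_assoc]
  have := hr.abs_sub_le x' x
  gcongr

variable [MeasurableSpace E] [BorelSpace E] {σ : Measure E} [IsFiniteMeasure σ]
  {V : Type*} [NormedAddCommGroup V] [NormedSpace ℝ V] [CompleteSpace V]
  {m : ℕ} {c C : ℝ}

/-- The extension of `φ` by averages at scale `r`, cut off to the layer where `r ≤ δ`. -/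
noncomputable def layerExtension (σ : Measure E) (r : E → ℝ) (δ : ℝ) (φ : E → V) (x : E) : V :=
  layerCutoff r δ x • smoothAvg σ r φ x

theorem contDiff_layerExtension (hσ : IsAhlforsRegular σ F m c C) (hF : F.Nonempty)
    (hr : IsScale F r) {φ : E → V} (hφ : Integrable φ σ) :
    ContDiff ℝ ∞ (layerExtension σ r δ φ) :=
  (contDiff_layerCutoff hr).smul (contDiff_smoothAvg hσ hF hr hφ)

theorem layerExtension_eq_zero (hr : IsScale F r) (hδ : 0 < δ) (φ : E → V) {x : E} (h : δ ≤ r x) :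
    layerExtension σ r δ φ x = 0 := by
  rw [layerExtension, layerCutoff_eq_zero hr hδ h, zero_smul]

theorem hasCompactSupport_layerExtension (hF : F.Nonempty) (hFb : Bornology.IsBounded F)
    (hr : IsScale F r) (hδ : 0 < δ) (φ : E → V) : HasCompactSupport (layerExtension σ r δ φ) := by
  have hK : IsCompact (closure (Metric.thickening δ F)) := hFb.thickening.isCompact_closure
  refine HasCompactSupport.intro hK fun x hx => layerExtension_eq_zero hr hδ φ ?_
  by_contra hlt
  rw [not_le] at hlt
  refine hx (subset_closure ?_)
  rw [Metric.mem_thickening_iff]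
  obtain ⟨y, hy, hxy⟩ := hr.exists_mem_dist_lt hF x
  exact ⟨y, hy, hxy.trans hlt⟩

/-- The squared Gagliardo seminorm of order `1/2` over an `m`-dimensional measure. -/
noncomputable def gagliardoEnergy (σ : Measure E) (m : ℕ) (φ : E → V) : ENNReal :=
  ∫⁻ z, ∫⁻ y, ‖φ y - φ z‖ₑ ^ 2 * ENNReal.ofReal ((dist y z)⁻¹ ^ (m + 1)) ∂σ ∂σ

/-- By the product rule the gradient splits into the gradient of the average, which yields the
Gagliardo energy, and the average times the gradient of the cutoff: `(M / δ)^2` against the squared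
`L²` norm of order `δ` on the layer, hence `δ⁻¹`. That `K` does not depend on `r` allows the scale
to approach the distance function later. -/
theorem exists_lintegral_layerExtension_sq_le (hE : Module.finrank ℝ E = m + 1)
    (hσ : IsAhlforsRegular σ F m c C) (hF : F.Nonempty) :
    ∃ K, 0 ≤ K ∧ ∀ r : E → ℝ, IsScale F r → ∀ δ, 0 < δ → δ ≤ 1 →
      ∀ φ : E → V, StronglyMeasurable φ → Integrable φ σ →
      ∫⁻ x, ‖layerExtension σ r δ φ x‖ₑ ^ 2 ≤ ENNReal.ofReal (K * δ) * ∫⁻ y, ‖φ y‖ₑ ^ 2 ∂σ ∧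
      ∫⁻ x, ‖fderiv ℝ (layerExtension σ r δ φ) x‖ₑ ^ 2 ≤
        ENNReal.ofReal K * gagliardoEnergy σ m φ +
          ENNReal.ofReal (K * δ⁻¹) * ∫⁻ y, ‖φ y‖ₑ ^ 2 ∂σ := by
  obtain ⟨M, hM⟩ := exists_lipschitzWith_heightBump
  obtain ⟨K₁, hK₁, h₁⟩ := exists_enorm_smoothAvg_sub_const_sq_le (V := V) hσ hF
  obtain ⟨K₂, hK₂, h₂⟩ := exists_enorm_fderiv_smoothAvg_sq_le (V := V) hσ hF
  obtain ⟨K₃, hK₃, h₃⟩ := exists_setLIntegral_average_le hE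
  obtain ⟨K₄, hK₄, h₄⟩ := exists_lintegral_double_average_le hE
  have hM0 := M.coe_nonneg
  refine ⟨K₁ * K₃ + 2 * (K₂ * K₄) + 2 * (M ^ 2 * (K₁ * K₃)), by positivity,
    fun r hr δ hδ hδ1 φ hφm hφ => ?_⟩
  set S : Set E := {x | r x ≤ δ} with hS
  have hSm : MeasurableSet S := (isClosed_le hr.continuous continuous_const).measurableSet
  set N : ENNReal := ∫⁻ y, ‖φ y‖ₑ ^ 2 ∂σ with hN
  have hA : ∫⁻ x in S, ‖smoothAvg σ r φ x‖ₑ ^ 2 ≤ ENNReal.ofReal (K₁ * K₃ * δ) * N := by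
    calc ∫⁻ x in S, ‖smoothAvg σ r φ x‖ₑ ^ 2
        ≤ ∫⁻ x in S, ENNReal.ofReal K₁ * (ENNReal.ofReal ((r x)⁻¹ ^ m) *
            ∫⁻ y in Metric.ball x (3 * r x), ‖φ y‖ₑ ^ 2 ∂σ) := by
          refine setLIntegral_mono' hSm fun x hx => ?_
          have := h₁ r hr φ hφ x 0 (le_trans hx hδ1)
          rw [ENNReal.ofReal_mul hK₁] at this
          simpa [mul_assoc] using this
      _ ≤ ENNReal.ofReal K₁ * (ENNReal.ofReal (K₃ * δ) * N) := by
          rw [lintegral_const_mul' _ _ ENNReal.ofReal_ne_top]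
          gcongr
          exact h₃ σ r hr δ hδ _ (hφm.enorm.pow_const 2)
      _ = _ := by rw [← mul_assoc, ← ENNReal.ofReal_mul hK₁, mul_assoc]
  have hG : ∫⁻ x in S, ‖fderiv ℝ (smoothAvg σ r φ) x‖ₑ ^ 2 ≤
      ENNReal.ofReal (K₂ * K₄) * gagliardoEnergy σ m φ := by
    have hmeas : Measurable (Function.uncurry fun y z => ‖φ y - φ z‖ₑ ^ 2) :=
      ((hφm.comp_measurable measurable_fst).sub
        (hφm.comp_measurable measurable_snd)).enorm.pow_const 2
    calc ∫⁻ x in S, ‖fderiv ℝ (smoothAvg σ r φ) x‖ₑ ^ 2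
        ≤ ∫⁻ x in S, ENNReal.ofReal K₂ * (ENNReal.ofReal ((r x)⁻¹ ^ (2 * m + 2)) *
          ∫⁻ z in Metric.ball x (6 * r x), ∫⁻ y in Metric.ball x (6 * r x),
            ‖φ y - φ z‖ₑ ^ 2 ∂σ ∂σ) := by
          refine setLIntegral_mono' hSm fun x hx => ?_
          have := h₂ r hr φ hφ x (le_trans hx hδ1)
          rw [ENNReal.ofReal_mul hK₂] at this
          simpa [mul_assoc] using this
      _ ≤ ∫⁻ x, ENNReal.ofReal K₂ * (ENNReal.ofReal ((r x)⁻¹ ^ (2 * m + 2)) *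
          ∫⁻ z in Metric.ball x (6 * r x), ∫⁻ y in Metric.ball x (6 * r x),
            ‖φ y - φ z‖ₑ ^ 2 ∂σ ∂σ) := setLIntegral_le_lintegral _ _
      _ ≤ ENNReal.ofReal K₂ * (ENNReal.ofReal K₄ * gagliardoEnergy σ m φ) := by
          rw [lintegral_const_mul' _ _ ENNReal.ofReal_ne_top]
          gcongr
          exact h₄ σ r hr (fun y z => ‖φ y - φ z‖ₑ ^ 2) hmeas (by simp)
      _ = _ := by rw [← mul_assoc, ← ENNReal.ofReal_mul hK₂]
  constructor
  · calc ∫⁻ x, ‖layerExtension σ r δ φ x‖ₑ ^ 2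
        ≤ ∫⁻ x, S.indicator (fun x => ‖smoothAvg σ r φ x‖ₑ ^ 2) x := by
          refine lintegral_mono fun x => ?_
          by_cases hx : x ∈ S
          · rw [indicator_of_mem hx, layerExtension, enorm_smul]
            gcongr
            refine mul_le_of_le_one_left zero_le ?_
            rw [Real.enorm_of_nonneg (layerCutoff_nonneg r δ x), ENNReal.ofReal_le_one]
            exact layerCutoff_le_one r δ x
          · rw [layerExtension_eq_zero hr hδ φ (not_le.mp hx).le]; simp
      _ ≤ ENNReal.ofReal (K₁ * K₃ * δ) * N := by rw [lintegral_indicator hSm]; exact hA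
      _ ≤ _ := by
          gcongr
          have : 0 ≤ 2 * (K₂ * K₄) + 2 * (M ^ 2 * (K₁ * K₃)) := by positivity
          linarith
  · have hpt : ∀ x, ‖fderiv ℝ (layerExtension σ r δ φ) x‖ₑ ^ 2 ≤
        S.indicator (fun x => ENNReal.ofReal 2 * ‖fderiv ℝ (smoothAvg σ r φ) x‖ₑ ^ 2 +
          ENNReal.ofReal (2 * (M / δ) ^ 2) * ‖smoothAvg σ r φ x‖ₑ ^ 2) x := by
      intro x
      by_cases hx : x ∈ S
      · rw [indicator_of_mem hx]
        have hd1 : DifferentiableAt ℝ (layerCutoff r δ) x :=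
          ((contDiff_layerCutoff hr).differentiable (by simp)).differentiableAt
        have hd2 : DifferentiableAt ℝ (smoothAvg σ r φ) x :=
          ((contDiff_smoothAvg hσ hF hr hφ).differentiable (by simp)).differentiableAt
        have hn : ‖fderiv ℝ (layerExtension σ r δ φ) x‖ₑ ≤
            ‖fderiv ℝ (smoothAvg σ r φ) x‖ₑ +
              ENNReal.ofReal (M / δ) * ‖smoothAvg σ r φ x‖ₑ := by
          have e : fderiv ℝ (layerExtension σ r δ φ) x = _ := fderiv_fun_smul hd1 hd2
          rw [e]
          simp only [← ofReal_norm]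
          rw [← ENNReal.ofReal_mul (by positivity), ← ENNReal.ofReal_add (norm_nonneg _)
            (by positivity)]
          refine ENNReal.ofReal_le_ofReal ((norm_add_le _ _).trans (add_le_add ?_ ?_))
          · rw [norm_smul, Real.norm_of_nonneg (layerCutoff_nonneg r δ x)]
            exact mul_le_of_le_one_left (norm_nonneg _) (layerCutoff_le_one r δ x)
          · rw [ContinuousLinearMap.norm_smulRight_apply]
            gcongr
            exact norm_fderiv_layerCutoff_le hr hδ hM x
        calc ‖fderiv ℝ (layerExtension σ r δ φ) x‖ₑ ^ 2
            ≤ (‖fderiv ℝ (smoothAvg σ r φ) x‖ₑ +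
              ENNReal.ofReal (M / δ) * ‖smoothAvg σ r φ x‖ₑ) ^ 2 := by gcongr
          _ ≤ _ := ENNReal.add_sq_le_two_mul _ _
          _ = _ := by
              rw [mul_pow, ← ENNReal.ofReal_pow (by positivity), mul_add, ← mul_assoc,
                ENNReal.ofReal_mul two_pos.le]
              simp
      · have h0 : layerExtension σ r δ φ =ᶠ[nhds x] fun _ => 0 := by
          have : ∀ᶠ x' in nhds x, δ < r x' :=
            hr.continuous.continuousAt.eventually (lt_mem_nhds (not_le.mp hx))
          filter_upwards [this] with x' hx'
          exact layerExtension_eq_zero hr hδ φ hx'.le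
        rw [h0.fderiv_eq, ← ofReal_norm]
        simp
    have hmd : Measurable fun x => ‖fderiv ℝ (smoothAvg σ r φ) x‖ₑ ^ 2 := by
      have := ((contDiff_smoothAvg hσ hF hr hφ).continuous_fderiv (by simp))
      fun_prop
    calc ∫⁻ x, ‖fderiv ℝ (layerExtension σ r δ φ) x‖ₑ ^ 2 ≤ _ := lintegral_mono hpt
      _ = ENNReal.ofReal 2 * (∫⁻ x in S, ‖fderiv ℝ (smoothAvg σ r φ) x‖ₑ ^ 2) +
          ENNReal.ofReal (2 * (M / δ) ^ 2) * ∫⁻ x in S, ‖smoothAvg σ r φ x‖ₑ ^ 2 := by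
          rw [lintegral_indicator hSm, lintegral_add_left (hmd.const_mul _),
            lintegral_const_mul' _ _ ENNReal.ofReal_ne_top,
            lintegral_const_mul' _ _ ENNReal.ofReal_ne_top]
      _ ≤ ENNReal.ofReal 2 * (ENNReal.ofReal (K₂ * K₄) * gagliardoEnergy σ m φ) +
          ENNReal.ofReal (2 * (M / δ) ^ 2) * (ENNReal.ofReal (K₁ * K₃ * δ) * N) := by gcongr
      _ = ENNReal.ofReal (2 * (K₂ * K₄)) * gagliardoEnergy σ m φ +
          ENNReal.ofReal (2 * (M ^ 2 * (K₁ * K₃)) * δ⁻¹) * N := by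
          rw [← mul_assoc, ← mul_assoc, ← ENNReal.ofReal_mul two_pos.le,
            ← ENNReal.ofReal_mul (by positivity)]
          congr 3
          field_simp
      _ ≤ _ := by
          have h5 : 0 ≤ K₁ * K₃ := by positivity
          have h6 : 0 ≤ 2 * (K₂ * K₄) := by positivity
          have h7 : 0 ≤ 2 * (M ^ 2 * (K₁ * K₃)) := by positivity
          gcongr
          · linarith
          · linarith

end Layer

/-! ### The mismatch between a test function and its averages. -/

section Lipschitz

variable {E : Type*} [NormedAddCommGroup E] [InnerProductSpace ℝ E] [FiniteDimensional ℝ E]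
  [MeasurableSpace E] [BorelSpace E] {σ : Measure E} [IsFiniteMeasure σ]
  {V : Type*} [NormedAddCommGroup V] [NormedSpace ℝ V] [CompleteSpace V]
  {F : Set E} {m : ℕ} {c C : ℝ}

theorem setLIntegral_ball_enorm_sub_le (hσ : IsAhlforsRegular σ F m c C) {φ : E → V}
    {Λ : NNReal} (hφ : LipschitzWith Λ φ) (x : E) {s : ℝ} (hs : 0 < s) :
    ∫⁻ y in Metric.ball x s, ‖φ y - φ x‖ₑ ∂σ ≤ ENNReal.ofReal (Λ * s * (C * s ^ m)) := by
  calc ∫⁻ y in Metric.ball x s, ‖φ y - φ x‖ₑ ∂σ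
      ≤ ∫⁻ _ in Metric.ball x s, ENNReal.ofReal (Λ * s) ∂σ := by
        refine setLIntegral_mono' Metric.isOpen_ball.measurableSet fun y hy => ?_
        rw [← ofReal_norm, ← dist_eq_norm]
        refine ENNReal.ofReal_le_ofReal ((hφ.dist_le_mul y x).trans ?_)
        exact mul_le_mul_of_nonneg_left (Metric.mem_ball.mp hy).le Λ.coe_nonneg
    _ = ENNReal.ofReal (Λ * s) * σ (Metric.ball x s) := setLIntegral_const _ _
    _ ≤ _ := by
        rw [ENNReal.ofReal_mul (by positivity : 0 ≤ (Λ : ℝ) * s)]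
        gcongr
        exact hσ.ball_le x s hs

theorem exists_norm_smoothAvg_sub_le_of_lipschitz (hσ : IsAhlforsRegular σ F m c C)
    (hF : F.Nonempty) {φ : E → V} {Λ : NNReal} (hφ : LipschitzWith Λ φ) (hφi : Integrable φ σ) :
    ∃ K, 0 ≤ K ∧ ∀ r : E → ℝ, IsScale F r → ∀ x, r x ≤ 1 →
      ‖smoothAvg σ r φ x - φ x‖ ≤ K * r x ∧ ‖fderiv ℝ (smoothAvg σ r φ) x‖ ≤ K := by
  obtain ⟨K, hK, h⟩ := exists_enorm_smoothAvg_sub_le (V := V) hσ hF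
  have hc := hσ.pos
  have hC := hσ.nonneg
  have hΛ := Λ.coe_nonneg
  refine ⟨c⁻¹ * Λ * 3 * C * 3 ^ m + K * Λ * 6 * C * 6 ^ m, by positivity, fun r hr x hx => ?_⟩
  have h0 := hr.pos x
  constructor
  · have h1 : ‖smoothAvg σ r φ x - φ x‖ₑ ≤ ENNReal.ofReal (c⁻¹ * Λ * 3 * C * 3 ^ m * r x) := by
      refine (enorm_smoothAvg_sub_const_le hσ hF hr hφi hx (φ x)).trans ?_
      refine (mul_le_mul' le_rfl
        (setLIntegral_ball_enorm_sub_le hσ hφ x (by positivity : 0 < 3 * r x))).trans (le_of_eq ?_)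
      rw [← ENNReal.ofReal_mul (by positivity)]
      congr 1
      simp only [mul_pow, inv_pow]
      field_simp
    rw [← ofReal_norm, ENNReal.ofReal_le_ofReal_iff (by positivity)] at h1
    refine h1.trans ?_
    have : 0 ≤ K * Λ * 6 * C * 6 ^ m := by positivity
    gcongr
    linarith
  · refine norm_fderiv_le_of_lip' ℝ (by positivity) ?_
    filter_upwards [hr.eventually_dist_le x] with x' hx'
    have h1 : ‖smoothAvg σ r φ x - smoothAvg σ r φ x'‖ₑ ≤
        ENNReal.ofReal (K * Λ * 6 * C * 6 ^ m * dist x x') := by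
      refine (h r hr φ hφi x x' (φ x) hx hx').trans ?_
      refine (mul_le_mul' le_rfl
        (setLIntegral_ball_enorm_sub_le hσ hφ x (by positivity : 0 < 6 * r x))).trans (le_of_eq ?_)
      rw [← ENNReal.ofReal_mul (by positivity)]
      congr 1
      simp only [mul_pow, inv_pow, pow_succ]
      field_simp
    rw [← ofReal_norm, ENNReal.ofReal_le_ofReal_iff (by positivity), norm_sub_rev] at h1
    refine h1.trans ?_
    rw [← dist_eq_norm, dist_comm]
    have : 0 ≤ c⁻¹ * Λ * 3 * C * 3 ^ m := by positivity
    gcongr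
    linarith

/-- The derivative of the cutoff is of size `M / δ`, but where `r x ≤ δ` a Lipschitz `φ` differs
from its average by at most a multiple of `δ`. The bound depends on `φ`, not on `δ` or `r`; that is
enough for a term that will tend to zero. -/
theorem exists_norm_layerCutoff_smul_sub_le (hσ : IsAhlforsRegular σ F m c C) (hF : F.Nonempty)
    {φ : E → V} (hφs : ContDiff ℝ ∞ φ) (hφc : HasCompactSupport φ) :
    ∃ K, 0 ≤ K ∧ ∀ r : E → ℝ, IsScale F r → ∀ δ, 0 < δ → δ ≤ 1 → ∀ x,
      ‖layerCutoff r δ x • (φ x - smoothAvg σ r φ x)‖ ≤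
        {x | r x ≤ δ}.indicator (fun _ => K) x ∧
      ‖fderiv ℝ (fun x => layerCutoff r δ x • (φ x - smoothAvg σ r φ x)) x‖ ≤
        {x | r x ≤ δ}.indicator (fun _ => K) x := by
  obtain ⟨Λ, hΛ⟩ := ContDiff.lipschitzWith_of_hasCompactSupport (𝕂 := ℝ) hφc hφs (by simp)
  have hφi : Integrable φ σ := hφs.continuous.integrable_of_hasCompactSupport hφc
  obtain ⟨M, hM⟩ := exists_lipschitzWith_heightBump
  obtain ⟨K, hK, h⟩ := exists_norm_smoothAvg_sub_le_of_lipschitz hσ hF hΛ hφi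
  have hΛ0 := Λ.coe_nonneg
  have hM0 := M.coe_nonneg
  refine ⟨K + Λ + M * K, by positivity, fun r hr δ hδ hδ1 x => ?_⟩
  have h0 := hr.pos x
  by_cases hx : r x ≤ δ
  · rw [indicator_of_mem (show x ∈ {x | r x ≤ δ} from hx)]
    obtain ⟨hA, hD⟩ := h r hr x (hx.trans hδ1)
    rw [norm_sub_rev] at hA
    have hθ : ‖layerCutoff r δ x‖ ≤ 1 := by
      rw [Real.norm_of_nonneg (layerCutoff_nonneg r δ x)]
      exact layerCutoff_le_one r δ x
    have hMK : 0 ≤ M * K := by positivity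
    constructor
    · rw [norm_smul]
      have : K * r x ≤ K := mul_le_of_le_one_right hK (hx.trans hδ1)
      calc ‖layerCutoff r δ x‖ * ‖φ x - smoothAvg σ r φ x‖ ≤ 1 * (K * r x) := by gcongr
        _ ≤ _ := by linarith
    · have hd1 : DifferentiableAt ℝ (layerCutoff r δ) x :=
        ((contDiff_layerCutoff hr).differentiable (by simp)).differentiableAt
      have hd2 : DifferentiableAt ℝ (smoothAvg σ r φ) x :=
        ((contDiff_smoothAvg hσ hF hr hφi).differentiable (by simp)).differentiableAt
      have hd3 : DifferentiableAt ℝ φ x := (hφs.differentiable (by simp)).differentiableAt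
      rw [fderiv_fun_smul hd1 (hd3.fun_sub hd2), fderiv_fun_sub hd3 hd2]
      refine (norm_add_le _ _).trans ?_
      rw [norm_smul, ContinuousLinearMap.norm_smulRight_apply]
      have h1 : ‖fderiv ℝ φ x - fderiv ℝ (smoothAvg σ r φ) x‖ ≤ Λ + K :=
        (norm_sub_le _ _).trans (add_le_add (norm_fderiv_le_of_lipschitz ℝ hΛ) hD)
      have h2 : ‖fderiv ℝ (layerCutoff r δ) x‖ * ‖φ x - smoothAvg σ r φ x‖ ≤ M * K := by
        calc _ ≤ M / δ * (K * δ) := by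
              gcongr
              · exact norm_fderiv_layerCutoff_le hr hδ hM x
              · exact hA.trans (by gcongr)
          _ = M * K := by field_simp
      have h3 : ‖layerCutoff r δ x‖ * ‖fderiv ℝ φ x - fderiv ℝ (smoothAvg σ r φ) x‖ ≤
          1 * (Λ + K) := by gcongr
      linarith
  · rw [indicator_of_notMem (show x ∉ {x | r x ≤ δ} from hx)]
    have hev : (fun x => layerCutoff r δ x • (φ x - smoothAvg σ r φ x)) =ᶠ[nhds x]
        fun _ => 0 := by
      have : ∀ᶠ x' in nhds x, δ < r x' :=
        hr.continuous.continuousAt.eventually (lt_mem_nhds (not_le.mp hx))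
      filter_upwards [this] with x' hx'
      rw [layerCutoff_eq_zero hr hδ hx'.le, zero_smul]
    rw [hev.fderiv_eq, layerCutoff_eq_zero hr hδ (not_le.mp hx).le]
    simp

end Lipschitz

/-! ### Green's functional on test functions. -/

section Green

variable {𝕜 : Type*} [RCLike 𝕜] {d : ℕ}

theorem norm_dotGrad_le (v : EuclideanSpace 𝕜 (Fin d)) (Φ : EuclideanSpace ℝ (Fin d) → 𝕜)
    (x : EuclideanSpace ℝ (Fin d)) : ‖dotGrad v Φ x‖ ≤ d * (‖v‖ * ‖fderiv ℝ Φ x‖) := by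
  calc ‖dotGrad v Φ x‖ ≤ ∑ _i : Fin d, ‖v‖ * ‖fderiv ℝ Φ x‖ := by
        refine norm_sum_le_of_le _ fun i _ => ?_
        rw [norm_mul]
        gcongr
        · exact PiLp.norm_apply_le v i
        · refine (ContinuousLinearMap.le_opNorm _ _).trans ?_
          simp
    _ = _ := by simp

/-- The right-hand side `∫_O (u · ∇Φ + g Φ)` of Green's formula. -/
noncomputable def greenIntegral (O : Set (EuclideanSpace ℝ (Fin d)))
    (u : Lp (EuclideanSpace 𝕜 (Fin d)) 2 (volume.restrict O)) (g : Lp 𝕜 2 (volume.restrict O))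
    (Φ : EuclideanSpace ℝ (Fin d) → 𝕜) : 𝕜 :=
  ∫ x in O, (dotGrad (u x) Φ x + g x * Φ x)

variable {O : Set (EuclideanSpace ℝ (Fin d))}
  {u : Lp (EuclideanSpace 𝕜 (Fin d)) 2 (volume.restrict O)} {g : Lp 𝕜 2 (volume.restrict O)}
  {Φ Ψ : EuclideanSpace ℝ (Fin d) → 𝕜}

theorem integrable_dotGrad (hΦ : ContDiff ℝ ∞ Φ) (hc : HasCompactSupport Φ) :
    Integrable (fun x => dotGrad (u x) Φ x) (volume.restrict O) := by
  refine integrable_finsetSum _ fun i _ => ?_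
  have h1 : MemLp (fun x => u x i) 2 (volume.restrict O) :=
    (Lp.memLp u).of_le ((EuclideanSpace.proj (𝕜 := 𝕜) i).continuous.comp_aestronglyMeasurable
      (Lp.aestronglyMeasurable u)) (Filter.Eventually.of_forall fun x => PiLp.norm_apply_le (u x) i)
  have h2 : MemLp (fun x => fderiv ℝ Φ x (EuclideanSpace.single i 1)) 2 (volume.restrict O) := by
    refine Continuous.memLp_of_hasCompactSupport ?_ ?_
    · exact (hΦ.continuous_fderiv (by simp)).clm_apply continuous_const
    · exact (hc.fderiv ℝ).comp_left (g := fun A => A (EuclideanSpace.single i 1)) rfl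
  exact h1.integrable_mul h2

theorem integrable_mul_of_hasCompactSupport (hΦ : ContDiff ℝ ∞ Φ) (hc : HasCompactSupport Φ) :
    Integrable (fun x => g x * Φ x) (volume.restrict O) := by
  have h : MemLp Φ 2 (volume.restrict O) := hΦ.continuous.memLp_of_hasCompactSupport hc
  exact (Lp.memLp g).integrable_mul h

theorem integrable_green (hΦ : ContDiff ℝ ∞ Φ) (hc : HasCompactSupport Φ) :
    Integrable (fun x => dotGrad (u x) Φ x + g x * Φ x) (volume.restrict O) :=
  (integrable_dotGrad hΦ hc).add (integrable_mul_of_hasCompactSupport hΦ hc)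

theorem dotGrad_add (v : EuclideanSpace 𝕜 (Fin d)) {x : EuclideanSpace ℝ (Fin d)}
    (hΦ : DifferentiableAt ℝ Φ x) (hΨ : DifferentiableAt ℝ Ψ x) :
    dotGrad v (fun x => Φ x + Ψ x) x = dotGrad v Φ x + dotGrad v Ψ x := by
  simp only [dotGrad, fderiv_fun_add hΦ hΨ, ← Finset.sum_add_distrib]
  exact Finset.sum_congr rfl fun i _ => by simp [mul_add]

theorem dotGrad_const_mul (v : EuclideanSpace 𝕜 (Fin d)) {x : EuclideanSpace ℝ (Fin d)} (a : 𝕜)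
    (hΦ : DifferentiableAt ℝ Φ x) :
    dotGrad v (fun x => a * Φ x) x = a * dotGrad v Φ x := by
  simp only [dotGrad, fderiv_const_mul hΦ, Finset.mul_sum]
  refine Finset.sum_congr rfl fun i _ => ?_
  simp only [smul_apply, smul_eq_mul]
  ring

theorem greenIntegral_add (hΦ : ContDiff ℝ ∞ Φ) (hΦc : HasCompactSupport Φ)
    (hΨ : ContDiff ℝ ∞ Ψ) (hΨc : HasCompactSupport Ψ) :
    greenIntegral O u g (fun x => Φ x + Ψ x) = greenIntegral O u g Φ + greenIntegral O u g Ψ := by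
  rw [greenIntegral, greenIntegral, greenIntegral, ← integral_add (integrable_green hΦ hΦc)
    (integrable_green hΨ hΨc)]
  refine integral_congr_ae (Filter.Eventually.of_forall fun x => ?_)
  simp only
  rw [dotGrad_add _ ((hΦ.differentiable (by simp)).differentiableAt)
    ((hΨ.differentiable (by simp)).differentiableAt)]
  ring

theorem greenIntegral_const_mul (a : 𝕜) (hΦ : ContDiff ℝ ∞ Φ) :
    greenIntegral O u g (fun x => a * Φ x) = a * greenIntegral O u g Φ := by
  rw [greenIntegral, greenIntegral, ← integral_const_mul]
  refine integral_congr_ae (Filter.Eventually.of_forall fun x => ?_)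
  simp only
  rw [dotGrad_const_mul _ _ ((hΦ.differentiable (by simp)).differentiableAt)]
  ring

theorem enorm_greenIntegral_le (Φ : EuclideanSpace ℝ (Fin d) → 𝕜) :
    ‖greenIntegral O u g Φ‖ₑ ≤
      ∫⁻ x in O, (d * (‖u x‖ₑ * ‖fderiv ℝ Φ x‖ₑ) + ‖g x‖ₑ * ‖Φ x‖ₑ) := by
  refine (enorm_integral_le_lintegral_enorm _).trans (lintegral_mono fun x => ?_)
  refine (enorm_add_le _ _).trans (add_le_add ?_ (enorm_mul _ _).le)
  have := ENNReal.ofReal_le_ofReal (norm_dotGrad_le (u x) Φ x)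
  rwa [ENNReal.ofReal_mul (Nat.cast_nonneg _), ENNReal.ofReal_mul (norm_nonneg _), ofReal_norm,
    ofReal_norm, ofReal_norm, ENNReal.ofReal_natCast] at this

/-- Since `Φ` vanishes near the frontier, its extension by zero from `O` is smooth with support
inside `O`, hence admissible in the definition of the weak divergence. -/
theorem greenIntegral_eq_zero_of_eventually_eq_zero (hO : IsOpen O) (hdiv : HasWeakDiv O u g)
    (hΦ : ContDiff ℝ ∞ Φ) (hΦc : HasCompactSupport Φ)
    (h : ∀ x ∈ frontier O, Φ =ᶠ[nhds x] 0) : greenIntegral O u g Φ = 0 := by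
  set f : EuclideanSpace ℝ (Fin d) → 𝕜 := O.indicator Φ with hf
  have hfO : ∀ x ∈ O, f =ᶠ[nhds x] Φ := fun x hx => by
    filter_upwards [hO.mem_nhds hx] with y hy
    rw [hf, indicator_of_mem hy]
  have hfout : ∀ x ∉ O, f =ᶠ[nhds x] 0 := by
    intro x hx
    by_cases hcl : x ∈ closure O
    · have hfr : x ∈ frontier O := by rw [hO.frontier_eq]; exact ⟨hcl, hx⟩
      filter_upwards [h x hfr] with y hy
      by_cases hyO : y ∈ O
      · rw [hf, indicator_of_mem hyO, hy]
      · rw [hf, indicator_of_notMem hyO]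
        rfl
    · filter_upwards [isClosed_closure.isOpen_compl.mem_nhds hcl] with y hy
      rw [hf, indicator_of_notMem (fun hyO => hy (subset_closure hyO))]
      rfl
  have hfs : ContDiff ℝ ∞ f := by
    rw [contDiff_iff_contDiffAt]
    intro x
    by_cases hx : x ∈ O
    · exact hΦ.contDiffAt.congr_of_eventuallyEq (hfO x hx)
    · exact (contDiffAt_const (c := (0 : 𝕜))).congr_of_eventuallyEq (hfout x hx)
  have hfc : HasCompactSupport f := hΦc.mono (by rw [hf, Set.support_indicator]; exact inter_subset_right)
  have hft : tsupport f ⊆ O := by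
    intro x hx
    by_contra hxO
    exact (notMem_tsupport_iff_eventuallyEq.mpr (hfout x hxO)) hx
  have hkey := hdiv f hfs hfc hft
  have e1 : ∫ x in O, g x * f x = ∫ x in O, g x * Φ x :=
    setIntegral_congr_fun hO.measurableSet fun x hx => by
      simp only [(hfO x hx).eq_of_nhds]
  have e2 : ∫ x in O, dotGrad (u x) f x = ∫ x in O, dotGrad (u x) Φ x :=
    setIntegral_congr_fun hO.measurableSet fun x hx => by
      simp only [dotGrad, (hfO x hx).fderiv_eq]
  rw [e1, e2] at hkey
  rw [greenIntegral, integral_add (integrable_dotGrad hΦ hΦc)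
    (integrable_mul_of_hasCompactSupport hΦ hΦc), hkey, add_neg_cancel]

end Green

/-! ### The bound for Green's functional, with `δ` still free. -/

theorem lintegral_enorm_coeFn_sq {α V : Type*} [MeasurableSpace α] {μ : Measure α}
    [NormedAddCommGroup V] (f : Lp V 2 μ) : ∫⁻ x, ‖f x‖ₑ ^ 2 ∂μ = ‖f‖ₑ ^ 2 := by
  rw [Lp.enorm_def, eLpNorm_eq_lintegral_rpow_enorm_toReal two_ne_zero ENNReal.ofNat_ne_top,
    ← ENNReal.rpow_natCast, ← ENNReal.rpow_mul]
  simp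

theorem lintegral_enorm_mul_enorm_le {α V W : Type*} [MeasurableSpace α] {μ : Measure α}
    [NormedAddCommGroup V] [NormedAddCommGroup W] (f : Lp V 2 μ) {h : α → W}
    (hh : AEStronglyMeasurable h μ) :
    ∫⁻ x, ‖f x‖ₑ * ‖h x‖ₑ ∂μ ≤ ‖f‖ₑ * (∫⁻ x, ‖h x‖ₑ ^ 2 ∂μ) ^ (1 / 2 : ℝ) := by
  have := ENNReal.lintegral_mul_le_Lp_mul_Lq μ Real.HolderConjugate.two_two
    (Lp.aestronglyMeasurable f).enorm hh.enorm
  have e : ‖f‖ₑ = (∫⁻ x, ‖f x‖ₑ ^ (2 : ℝ) ∂μ) ^ (1 / 2 : ℝ) := by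
    have h2 := lintegral_enorm_coeFn_sq f
    simp only [ENNReal.rpow_ofNat]
    rw [h2, ← ENNReal.rpow_natCast, ← ENNReal.rpow_mul]
    norm_num
  rw [e]
  simpa only [Pi.mul_apply, ENNReal.rpow_ofNat] using this

section Bound

variable {𝕜 : Type*} [RCLike 𝕜] {d m : ℕ} {O : Set (EuclideanSpace ℝ (Fin d))}
  {σ : Measure (EuclideanSpace ℝ (Fin d))} [IsFiniteMeasure σ] {c C : ℝ}

/-- Closed thickenings of the frontier shrink to the frontier, which misses the open set `O`; this
needs no information on the Lebesgue measure of the frontier. Then use absolute continuity of the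
integral. -/
theorem tendsto_setLIntegral_cthickening_frontier (hO : IsOpen O) (hOb : Bornology.IsBounded O)
    {f : EuclideanSpace ℝ (Fin d) → ENNReal} (hf : ∫⁻ x in O, f x ≠ ⊤) :
    Filter.Tendsto (fun t => ∫⁻ x in Metric.cthickening t (frontier O), f x ∂(volume.restrict O))
      (nhds 0) (nhds 0) := by
  refine tendsto_setLIntegral_zero hf ?_
  have hfin : (volume.restrict O) (Metric.cthickening 1 (frontier O)) ≠ ⊤ := by
    have : volume O ≠ ⊤ := hOb.measure_lt_top.ne
    refine ne_top_of_le_ne_top this ?_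
    rw [← Measure.restrict_apply_univ (μ := volume) O]
    exact measure_mono (subset_univ _)
  have h := tendsto_measure_cthickening (μ := volume.restrict O) ⟨1, one_pos, hfin⟩
  have h0 : (volume.restrict O) (closure (frontier O)) = 0 := by
    rw [isClosed_frontier.closure_eq, Measure.restrict_apply isClosed_frontier.measurableSet,
      inter_comm, hO.inter_frontier_eq, measure_empty]
  rw [h0] at h
  exact h

/-- Write `Φ = Φ₁ + D + Ψ`, with `Ψ` the layer extension of width `δ` and `D` the mismatch cut off
to width `t`. The part `Φ₁` vanishes near the frontier and contributes nothing, `Ψ` satisfies the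
energy bounds, and `D` disappears as `t → 0`. -/
theorem exists_enorm_greenIntegral_le (hd : d = m + 1) (hO : IsOpen O)
    (hOb : Bornology.IsBounded O) (hF : (frontier O).Nonempty)
    (hσ : IsAhlforsRegular σ (frontier O) m c C) :
    ∃ K, 0 ≤ K ∧ ∀ (u : Lp (EuclideanSpace 𝕜 (Fin d)) 2 (volume.restrict O))
      (g : Lp 𝕜 2 (volume.restrict O)), HasWeakDiv O u g →
      ∀ Φ : EuclideanSpace ℝ (Fin d) → 𝕜, ContDiff ℝ ∞ Φ → HasCompactSupport Φ →
      ∀ δ, 0 < δ → δ ≤ 1 →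
      ‖greenIntegral O u g Φ‖ₑ ≤
        d * (‖u‖ₑ * (ENNReal.ofReal (K * δ⁻¹) *
          (gagliardoEnergy σ m Φ + ∫⁻ y, ‖Φ y‖ₑ ^ 2 ∂σ)) ^ (1 / 2 : ℝ)) +
        ‖g‖ₑ * (ENNReal.ofReal (K * δ) *
          (gagliardoEnergy σ m Φ + ∫⁻ y, ‖Φ y‖ₑ ^ 2 ∂σ)) ^ (1 / 2 : ℝ) := by
  have hE : Module.finrank ℝ (EuclideanSpace ℝ (Fin d)) = m + 1 := by
    rw [finrank_euclideanSpace_fin, hd]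
  obtain ⟨K, hK, hen⟩ := exists_lintegral_layerExtension_sq_le (V := 𝕜) hE hσ hF
  refine ⟨K, hK, fun u g hdiv Φ hΦ hΦc δ hδ hδ1 => ?_⟩
  have hΦi : Integrable Φ σ := hΦ.continuous.integrable_of_hasCompactSupport hΦc
  have hΦm : StronglyMeasurable Φ := hΦ.continuous.stronglyMeasurable
  have hFb : Bornology.IsBounded (frontier O) := hOb.closure.subset frontier_subset_closure
  set X := gagliardoEnergy σ m Φ + ∫⁻ y, ‖Φ y‖ₑ ^ 2 ∂σ with hX
  set B := d * (‖u‖ₑ * (ENNReal.ofReal (K * δ⁻¹) * X) ^ (1 / 2 : ℝ)) +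
        ‖g‖ₑ * (ENNReal.ofReal (K * δ) * X) ^ (1 / 2 : ℝ) with hB
  obtain ⟨K', hK', hD⟩ := exists_norm_layerCutoff_smul_sub_le hσ hF hΦ hΦc
  set f : EuclideanSpace ℝ (Fin d) → ENNReal := fun x => d * ‖u x‖ₑ + ‖g x‖ₑ with hf
  have hfin : ∫⁻ x in O, f x ≠ ⊤ := by
    have : IsFiniteMeasure (volume.restrict O) :=
      ⟨by rw [Measure.restrict_apply_univ]; exact hOb.measure_lt_top⟩
    have hu : ∫⁻ x in O, ‖u x‖ₑ < ⊤ := ((Lp.memLp u).integrable one_le_two).2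
    have hg : ∫⁻ x in O, ‖g x‖ₑ < ⊤ := ((Lp.memLp g).integrable one_le_two).2
    rw [hf, lintegral_add_left' ((Lp.aestronglyMeasurable u).enorm.const_mul _),
      lintegral_const_mul' _ _ (ENNReal.natCast_ne_top d)]
    exact ENNReal.add_ne_top.mpr ⟨ENNReal.mul_ne_top (ENNReal.natCast_ne_top d) hu.ne, hg.ne⟩
  have key : ∀ t, 0 < t → t ≤ δ / 2 → ‖greenIntegral O u g Φ‖ₑ ≤
      ENNReal.ofReal K' *
        (∫⁻ x in Metric.cthickening t (frontier O), f x ∂(volume.restrict O)) + B := by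
    intro t ht htδ
    -- With `ε = t / 16` the scale is at most `3 * t / 16 < t / 2` on the frontier, so both cutoffs
    -- equal `1` in a neighbourhood of it.
    obtain ⟨r, hr, hrb⟩ := exists_isScale (frontier O) (ε := t / 16) (by positivity)
    set Ψ := layerExtension σ r δ Φ with hΨ
    set D : EuclideanSpace ℝ (Fin d) → 𝕜 :=
      fun x => layerCutoff r t x • (Φ x - smoothAvg σ r Φ x) with hDdef
    have hA : ContDiff ℝ ∞ (smoothAvg σ r Φ) := contDiff_smoothAvg hσ hF hr hΦi
    have hΨs : ContDiff ℝ ∞ Ψ := contDiff_layerExtension hσ hF hr hΦi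
    have hΨc : HasCompactSupport Ψ := hasCompactSupport_layerExtension hF hFb hr hδ Φ
    have hDs : ContDiff ℝ ∞ D := (contDiff_layerCutoff hr).smul (hΦ.sub hA)
    have hDc : HasCompactSupport D := by
      have e : D = fun x => (layerCutoff r t • Φ) x - layerExtension σ r t Φ x := by
        ext x
        simp only [hDdef, smul_sub, layerExtension, Pi.smul_apply']
      rw [e]
      exact (hΦc.smul_left (f := layerCutoff r t)).sub
        (hasCompactSupport_layerExtension hF hFb hr ht Φ)
    set Φ₁ : EuclideanSpace ℝ (Fin d) → 𝕜 := fun x => Φ x - Ψ x - D x with hΦ₁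
    have hΦ₁s : ContDiff ℝ ∞ Φ₁ := (hΦ.sub hΨs).sub hDs
    have hΦ₁c : HasCompactSupport Φ₁ := (hΦc.sub hΨc).sub hDc
    have hΦ₁0 : greenIntegral O u g Φ₁ = 0 := by
      refine greenIntegral_eq_zero_of_eventually_eq_zero hO hdiv hΦ₁s hΦ₁c fun x hx => ?_
      have hrx : r x < t / 2 := by
        have := (hrb x).2
        rw [Metric.infDist_zero_of_mem hx] at this
        linarith
      filter_upwards [hr.continuous.continuousAt.eventually (gt_mem_nhds hrx)] with y hy
      simp only [hΦ₁, hΨ, hDdef, layerExtension, layerCutoff_eq_one hr ht hy.le,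
        layerCutoff_eq_one hr hδ (x := y) (by linarith), one_smul, sub_self, Pi.zero_apply]
    have hsplit : greenIntegral O u g Φ = greenIntegral O u g D + greenIntegral O u g Ψ := by
      have e : Φ = fun x => Φ₁ x + (D x + Ψ x) := by
        ext x
        simp only [hΦ₁]
        ring
      rw [e, greenIntegral_add hΦ₁s hΦ₁c (hDs.add hΨs) (hDc.add hΨc), hΦ₁0, zero_add,
        greenIntegral_add hDs hDc hΨs hΨc]
    have hDb : ‖greenIntegral O u g D‖ₑ ≤ ENNReal.ofReal K' *
        (∫⁻ x in Metric.cthickening t (frontier O), f x ∂(volume.restrict O)) := by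
      rw [← lintegral_const_mul' _ _ ENNReal.ofReal_ne_top,
        ← lintegral_indicator Metric.isClosed_cthickening.measurableSet]
      refine (enorm_greenIntegral_le D).trans (lintegral_mono fun x => ?_)
      obtain ⟨h1, h2⟩ := hD r hr t ht (by linarith) x
      by_cases hx : r x ≤ t
      · have hxt : x ∈ Metric.cthickening t (frontier O) := by
          obtain ⟨y, hy, hxy⟩ := hr.exists_mem_dist_lt hF x
          exact Metric.mem_cthickening_of_dist_le x y t _ hy (hxy.le.trans hx)
        rw [indicator_of_mem (show x ∈ {x | r x ≤ t} from hx)] at h1 h2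
        rw [indicator_of_mem hxt]
        have h1' := ENNReal.ofReal_le_ofReal h1
        have h2' := ENNReal.ofReal_le_ofReal h2
        rw [ofReal_norm] at h1' h2'
        calc _ ≤ (d : ENNReal) * (‖u x‖ₑ * ENNReal.ofReal K') + ‖g x‖ₑ * ENNReal.ofReal K' := by
              gcongr
          _ = _ := by simp only [hf]; ring
      · rw [indicator_of_notMem (show x ∉ {x | r x ≤ t} from hx)] at h1 h2
        have h1' : D x = 0 := norm_le_zero_iff.mp h1
        have h2' : fderiv ℝ D x = 0 := norm_le_zero_iff.mp h2
        rw [h1', h2', ← ofReal_norm (0 : EuclideanSpace ℝ (Fin d) →L[ℝ] 𝕜)]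
        simp
    have hΨb : ‖greenIntegral O u g Ψ‖ₑ ≤ B := by
      obtain ⟨h1, h2⟩ := hen r hr δ hδ hδ1 Φ hΦm hΦi
      have h1' : ∫⁻ x in O, ‖Ψ x‖ₑ ^ 2 ≤ ENNReal.ofReal (K * δ) * X := by
        refine (setLIntegral_le_lintegral _ _).trans (h1.trans ?_)
        gcongr
        exact le_add_self
      have h2' : ∫⁻ x in O, ‖fderiv ℝ Ψ x‖ₑ ^ 2 ≤ ENNReal.ofReal (K * δ⁻¹) * X := by
        refine (setLIntegral_le_lintegral _ _).trans (h2.trans ?_)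
        rw [hX, mul_add]
        gcongr
        -- Since `δ ≤ 1`, the constant in front of the energy is absorbed into `K * δ⁻¹`.
        exact le_mul_of_one_le_right hK ((one_le_inv₀ hδ).mpr hδ1)
      have hm1 : AEStronglyMeasurable (fun x => fderiv ℝ Ψ x) (volume.restrict O) :=
        (hΨs.continuous_fderiv (by simp)).aestronglyMeasurable
      have hm2 : AEStronglyMeasurable Ψ (volume.restrict O) := hΨs.continuous.aestronglyMeasurable
      have hm3 : AEMeasurable (fun x => (d : ENNReal) * (‖u x‖ₑ * ‖fderiv ℝ Ψ x‖ₑ))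
          (volume.restrict O) := ((Lp.aestronglyMeasurable u).enorm.mul hm1.enorm).const_mul _
      refine (enorm_greenIntegral_le Ψ).trans ?_
      rw [lintegral_add_left' hm3, lintegral_const_mul' _ _ (ENNReal.natCast_ne_top d), hB]
      refine add_le_add (mul_le_mul' le_rfl ?_) ?_
      · exact (lintegral_enorm_mul_enorm_le u hm1).trans (by gcongr)
      · exact (lintegral_enorm_mul_enorm_le g hm2).trans (by gcongr)
    rw [hsplit]
    exact (enorm_add_le _ _).trans (add_le_add hDb hΨb)
  -- `Ψ` and `D` depend on `t` through the scale `r`, but `B` and `K'` do not, so the limit can be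
  -- taken in the bound alone.
  have hlim : Filter.Tendsto (fun t => ENNReal.ofReal K' *
      (∫⁻ x in Metric.cthickening t (frontier O), f x ∂(volume.restrict O)) + B)
      (nhdsWithin 0 (Ioi 0)) (nhds (ENNReal.ofReal K' * 0 + B)) := by
    refine Filter.Tendsto.add ?_ tendsto_const_nhds
    refine ENNReal.Tendsto.const_mul ?_ (Or.inr ENNReal.ofReal_ne_top)
    exact (tendsto_setLIntegral_cthickening_frontier hO hOb hfin).mono_left nhdsWithin_le_nhds
  rw [mul_zero, zero_add] at hlim
  refine ge_of_tendsto hlim ?_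
  filter_upwards [self_mem_nhdsWithin, mem_nhdsWithin_of_mem_nhds (gt_mem_nhds (half_pos hδ))]
    with t ht1 ht2
  exact key t ht1 (le_of_lt ht2)

end Bound

/-! ### Averages restricted to the boundary: estimates for pairs of boundary points. -/

section Density

variable {E : Type*} [NormedAddCommGroup E] [InnerProductSpace ℝ E] [FiniteDimensional ℝ E]
  [MeasurableSpace E] [BorelSpace E] {σ : Measure E} [IsFiniteMeasure σ]
  {F : Set E} {m : ℕ} {c C : ℝ}

theorem measurable_setLIntegral_ball {W : E → E → ENNReal} (hW : Measurable (Function.uncurry W))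
    (s : ℝ) : Measurable fun p : E × E => ∫⁻ z in Metric.ball p.2 s, W p.1 z ∂σ := by
  have e : (fun p : E × E => ∫⁻ z in Metric.ball p.2 s, W p.1 z ∂σ) = fun p =>
      ∫⁻ z, {q : (E × E) × E | dist q.2 q.1.2 < s}.indicator (fun q => W q.1.1 q.2) (p, z) ∂σ := by
    ext p
    rw [← lintegral_indicator Metric.isOpen_ball.measurableSet]
    rfl
  rw [e]
  refine Measurable.lintegral_prod_right' (ν := σ) (Measurable.indicator ?_ ?_)
  · exact hW.comp (measurable_fst.fst.prodMk measurable_snd)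
  · exact (isOpen_lt (by fun_prop) continuous_const).measurableSet

theorem lintegral_setLIntegral_ball_le (hσ : IsAhlforsRegular σ F m c C) {f : E → ENNReal}
    (hf : Measurable f) {s : ℝ} (hs : 0 < s) :
    ∫⁻ x, ∫⁻ z in Metric.ball x s, f z ∂σ ∂σ ≤ ENNReal.ofReal (C * s ^ m) * ∫⁻ z, f z ∂σ := by
  set H : E × E → ENNReal := {p : E × E | dist p.2 p.1 < s}.indicator fun p => f p.2 with hH
  have hHm : Measurable H := (hf.comp measurable_snd).indicator
    (isOpen_lt (by fun_prop) continuous_const).measurableSet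
  calc ∫⁻ x, ∫⁻ z in Metric.ball x s, f z ∂σ ∂σ = ∫⁻ x, ∫⁻ z, H (x, z) ∂σ ∂σ := by
        refine lintegral_congr fun x => ?_
        rw [← lintegral_indicator Metric.isOpen_ball.measurableSet]
        rfl
    _ = ∫⁻ z, ∫⁻ x, H (x, z) ∂σ ∂σ :=
        lintegral_lintegral_swap (f := fun x z => H (x, z)) hHm.aemeasurable
    _ ≤ ∫⁻ z, ENNReal.ofReal (C * s ^ m) * f z ∂σ := by
        refine lintegral_mono fun z => ?_
        have e : ∀ x, H (x, z) = (Metric.ball z s).indicator (fun _ => f z) x := by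
          intro x
          by_cases hx : dist z x < s
          · rw [hH, indicator_of_mem (show (x, z) ∈ {p : E × E | dist p.2 p.1 < s} from hx),
              indicator_of_mem (by rw [Metric.mem_ball, dist_comm]; exact hx)]
          · rw [hH, indicator_of_notMem (show (x, z) ∉ {p : E × E | dist p.2 p.1 < s} from hx),
              indicator_of_notMem (by rw [Metric.mem_ball, dist_comm]; exact hx)]
        simp only [e]
        rw [lintegral_indicator_const Metric.isOpen_ball.measurableSet, mul_comm]
        gcongr
        exact hσ.ball_le z s hs
    _ = _ := lintegral_const_mul' _ _ ENNReal.ofReal_ne_top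

theorem lintegral_lintegral_setLIntegral_ball_le (hσ : IsAhlforsRegular σ F m c C)
    {W : E → E → ENNReal} (hW : Measurable (Function.uncurry W)) {s : ℝ} (hs : 0 < s) :
    ∫⁻ x, ∫⁻ x', ∫⁻ y in Metric.ball x s, ∫⁻ z in Metric.ball x' s, W y z ∂σ ∂σ ∂σ ∂σ ≤
      ENNReal.ofReal (C * s ^ m) * (ENNReal.ofReal (C * s ^ m) * ∫⁻ y, ∫⁻ z, W y z ∂σ ∂σ) := by
  have hm := measurable_setLIntegral_ball (σ := σ) hW s
  calc _ = ∫⁻ x, ∫⁻ y in Metric.ball x s, ∫⁻ x', ∫⁻ z in Metric.ball x' s, W y z ∂σ ∂σ ∂σ ∂σ := by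
        refine lintegral_congr fun x => ?_
        exact lintegral_lintegral_swap (f := fun x' y => ∫⁻ z in Metric.ball x' s, W y z ∂σ)
          (hm.comp measurable_swap).aemeasurable
    _ ≤ ∫⁻ x, ∫⁻ y in Metric.ball x s,
          ENNReal.ofReal (C * s ^ m) * ∫⁻ z, W y z ∂σ ∂σ ∂σ := by
        refine lintegral_mono fun x => lintegral_mono fun y => ?_
        exact lintegral_setLIntegral_ball_le hσ (hW.comp (measurable_const.prodMk measurable_id)) hs
    _ ≤ ENNReal.ofReal (C * s ^ m) *
          ∫⁻ y, ENNReal.ofReal (C * s ^ m) * ∫⁻ z, W y z ∂σ ∂σ :=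
        lintegral_setLIntegral_ball_le hσ
          ((Measurable.lintegral_prod_right' (ν := σ) hW).const_mul _) hs
    _ = _ := by rw [lintegral_const_mul' _ _ ENNReal.ofReal_ne_top]

variable {V : Type*} [NormedAddCommGroup V]

/-- The integrand of the squared Gagliardo seminorm. -/
noncomputable def gagliardoDensity (m : ℕ) (φ : E → V) (y z : E) : ENNReal :=
  ‖φ y - φ z‖ₑ ^ 2 * ENNReal.ofReal ((dist y z)⁻¹ ^ (m + 1))

theorem measurable_gagliardoDensity_swap (m : ℕ) {φ : E → V} (hφ : StronglyMeasurable φ) :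
    Measurable fun p : E × E => gagliardoDensity m φ p.2 p.1 := by
  have h1 : Measurable fun p : E × E => ‖φ p.2 - φ p.1‖ₑ ^ 2 :=
    ((hφ.comp_measurable measurable_snd).sub (hφ.comp_measurable measurable_fst)).enorm.pow_const 2
  have h2 : Measurable fun p : E × E => (dist p.2 p.1)⁻¹ ^ (m + 1) := by fun_prop
  exact h1.mul h2.ennreal_ofReal

theorem measurable_gagliardoDensity_left (m : ℕ) {φ : E → V} (hφ : StronglyMeasurable φ) (z : E) :
    Measurable fun y => gagliardoDensity m φ y z := by
  have h1 : Measurable fun y => ‖φ y - φ z‖ₑ ^ 2 :=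
    (hφ.sub stronglyMeasurable_const).enorm.pow_const 2
  have h2 : Measurable fun y => (dist y z)⁻¹ ^ (m + 1) := by fun_prop
  exact h1.mul h2.ennreal_ofReal

/-- At `y = z` both sides vanish, so dividing by the distance is harmless. It serves with `A = 1`
for close pairs and with `A` an inverse distance for separated ones. -/
theorem enorm_sub_sq_mul_le_gagliardoDensity (φ : E → V) {y z : E} {A B : ℝ} (hA : 0 ≤ A)
    (hB : 0 ≤ B) (h : A * dist y z ≤ B) :
    ENNReal.ofReal (A ^ (m + 1)) * ‖φ y - φ z‖ₑ ^ 2 ≤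
      ENNReal.ofReal (B ^ (m + 1)) * gagliardoDensity m φ y z := by
  rcases eq_or_ne y z with rfl | hyz
  · simp
  have h0 : 0 < dist y z := dist_pos.mpr hyz
  rw [gagliardoDensity, mul_left_comm, mul_comm (ENNReal.ofReal _),
    ← ENNReal.ofReal_mul (by positivity), ← mul_pow]
  gcongr
  rwa [← div_eq_mul_inv, le_div_iff₀ h0]

theorem enorm_sub_sq_le_gagliardoDensity (φ : E → V) {y z : E} {B : ℝ} (h : dist y z ≤ B) :
    ‖φ y - φ z‖ₑ ^ 2 ≤ ENNReal.ofReal (B ^ (m + 1)) * gagliardoDensity m φ y z := by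
  have := enorm_sub_sq_mul_le_gagliardoDensity (m := m) φ zero_le_one (dist_nonneg.trans h)
    (by rwa [one_mul])
  simpa using this

variable [NormedSpace ℝ V] [CompleteSpace V]

/-- On `F` the scale is comparable to `ε`, so only pairs within `9 * ε` enter, and `ε^{-m} (9
ε)^{m+1}` leaves one power of `ε`. -/
theorem exists_lintegral_smoothAvg_sub_sq_le (hσ : IsAhlforsRegular σ F m c C) (hF : F.Nonempty)
    (hσF : ∀ᵐ x ∂σ, x ∈ F) :
    ∃ K, 0 ≤ K ∧ ∀ r : E → ℝ, IsScale F r → ∀ ε, 0 < ε → 3 * ε ≤ 1 →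
      (∀ x ∈ F, ε ≤ r x ∧ r x ≤ 3 * ε) → ∀ φ : E → V, Integrable φ σ →
      ∫⁻ x, ‖smoothAvg σ r φ x - φ x‖ₑ ^ 2 ∂σ ≤
        ENNReal.ofReal (K * ε) * gagliardoEnergy σ m φ := by
  obtain ⟨K, hK, h⟩ := exists_enorm_smoothAvg_sub_const_sq_le (V := V) hσ hF
  refine ⟨K * 9 ^ (m + 1), by positivity, fun r hr ε hε hε1 hrε φ hφ => ?_⟩
  change _ ≤ _ * ∫⁻ z, ∫⁻ y, gagliardoDensity m φ y z ∂σ ∂σ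
  rw [← lintegral_const_mul' _ _ ENNReal.ofReal_ne_top]
  refine lintegral_mono_ae (hσF.mono fun x hx => ?_)
  obtain ⟨h1, h2⟩ := hrε x hx
  have h0 := hr.pos x
  calc ‖smoothAvg σ r φ x - φ x‖ₑ ^ 2
      ≤ ENNReal.ofReal (K * (r x)⁻¹ ^ m) *
          ∫⁻ y in Metric.ball x (3 * r x), ‖φ y - φ x‖ₑ ^ 2 ∂σ := h r hr φ hφ x _ (by linarith)
    _ ≤ ENNReal.ofReal (K * ε⁻¹ ^ m) * ∫⁻ y in Metric.ball x (3 * r x),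
          ENNReal.ofReal ((9 * ε) ^ (m + 1)) * gagliardoDensity m φ y x ∂σ := by
        refine mul_le_mul' (ENNReal.ofReal_le_ofReal (by gcongr)) ?_
        refine setLIntegral_mono' Metric.isOpen_ball.measurableSet fun y hy => ?_
        refine enorm_sub_sq_le_gagliardoDensity φ ?_
        rw [Metric.mem_ball] at hy
        linarith
    _ ≤ ENNReal.ofReal (K * ε⁻¹ ^ m) * (ENNReal.ofReal ((9 * ε) ^ (m + 1)) *
          ∫⁻ y, gagliardoDensity m φ y x ∂σ) := by
        rw [lintegral_const_mul' _ _ ENNReal.ofReal_ne_top]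
        refine mul_le_mul' le_rfl (mul_le_mul' le_rfl ?_)
        exact setLIntegral_le_lintegral _ _
    _ = _ := by
        rw [← mul_assoc, ← ENNReal.ofReal_mul (by positivity)]
        congr 2
        simp only [mul_pow, inv_pow, pow_succ]
        field_simp

/-- Below the averaging scale the average is Lipschitz: the squared difference gains `dist ^ 2`,
which reduces the singularity from order `a + 2` to order `a`. This is integrable in dimension `a +
1` and yields a factor `ε`. -/
theorem exists_lintegral_double_average_le_near {a : ℕ} (hσ : IsAhlforsRegular σ F (a + 1) c C)
    (hF : F.Nonempty) :
    ∃ K, 0 ≤ K ∧ ∀ r : E → ℝ, IsScale F r → ∀ ε, 0 < ε → 3 * ε ≤ 1 →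
      ∀ φ : E → V, Integrable φ σ → ∀ x, ε ≤ r x → r x ≤ 3 * ε →
      ∫⁻ x' in Metric.ball x (ε / 2), gagliardoDensity (a + 1) (smoothAvg σ r φ) x' x ∂σ ≤
        ENNReal.ofReal (K * ε⁻¹ ^ (2 * a + 3)) *
          ∫⁻ z in Metric.ball x (18 * ε), ∫⁻ y in Metric.ball x (18 * ε),
            ‖φ y - φ z‖ₑ ^ 2 ∂σ ∂σ := by
  obtain ⟨K, hK, h⟩ := exists_enorm_smoothAvg_sub_sq_le (V := V) hσ hF
  have hC := hσ.nonneg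
  refine ⟨K * (4 ^ (a + 1) * C), by positivity, fun r hr ε hε hε1 φ hφ x h1 h2 => ?_⟩
  have h0 := hr.pos x
  set Q := ∫⁻ z in Metric.ball x (18 * ε), ∫⁻ y in Metric.ball x (18 * ε),
            ‖φ y - φ z‖ₑ ^ 2 ∂σ ∂σ with hQ
  have hQ' : ∫⁻ z in Metric.ball x (6 * r x), ∫⁻ y in Metric.ball x (6 * r x),
            ‖φ y - φ z‖ₑ ^ 2 ∂σ ∂σ ≤ Q := by
    have hsub : Metric.ball x (6 * r x) ⊆ Metric.ball x (18 * ε) :=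
      Metric.ball_subset_ball (by linarith)
    refine (lintegral_mono_set hsub).trans (lintegral_mono fun z => lintegral_mono_set hsub)
  calc ∫⁻ x' in Metric.ball x (ε / 2), gagliardoDensity (a + 1) (smoothAvg σ r φ) x' x ∂σ
      ≤ ∫⁻ x' in Metric.ball x (ε / 2), ENNReal.ofReal (K * ε⁻¹ ^ (2 * (a + 1) + 2)) * Q *
          ENNReal.ofReal ((dist x x')⁻¹ ^ a) ∂σ := by
        refine setLIntegral_mono' Metric.isOpen_ball.measurableSet fun x' hx' => ?_
        rw [Metric.mem_ball, dist_comm] at hx'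
        rcases eq_or_ne x' x with rfl | hne
        · simp [gagliardoDensity]
        have hd : 0 < dist x x' := dist_pos.mpr hne.symm
        rw [gagliardoDensity, ← enorm_neg, neg_sub, dist_comm x' x]
        calc _ ≤ ENNReal.ofReal (K * dist x x' ^ 2 * ε⁻¹ ^ (2 * (a + 1) + 2)) * Q *
              ENNReal.ofReal ((dist x x')⁻¹ ^ (a + 1 + 1)) := by
              gcongr
              refine (h r hr φ hφ x x' (by linarith) (by linarith)).trans ?_
              gcongr
          _ = _ := by
              rw [mul_right_comm, mul_right_comm (ENNReal.ofReal _) Q,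
                ← ENNReal.ofReal_mul (by positivity), ← ENNReal.ofReal_mul (by positivity)]
              congr 2
              simp only [inv_pow, pow_succ]
              field_simp
    _ = ENNReal.ofReal (K * ε⁻¹ ^ (2 * (a + 1) + 2)) * Q *
          ∫⁻ x' in Metric.ball x (ε / 2), ENNReal.ofReal ((dist x x')⁻¹ ^ a) ∂σ := by
        rw [lintegral_const_mul]
        exact (by fun_prop : Measurable fun x' : E => (dist x x')⁻¹ ^ a).ennreal_ofReal
    _ ≤ ENNReal.ofReal (K * ε⁻¹ ^ (2 * (a + 1) + 2)) * Q *
          ENNReal.ofReal (4 ^ (a + 1) * C * ε) := by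
        gcongr
        refine (lintegral_mono_set (Metric.ball_subset_ball (by linarith))).trans
          (setLIntegral_ball_inv_dist_pow_le σ hC (fun s hs => hσ.ball_le x s hs) hε)
    _ = _ := by
        rw [mul_right_comm, ← ENNReal.ofReal_mul (by positivity)]
        congr 2
        rw [show 2 * (a + 1) + 2 = 2 * a + 3 + 1 by ring, pow_succ]
        field_simp

/-- Above the averaging scale, average in each variable separately: the pointwise bound is used at
`x`, then at `x'`. The new pair is at distance at most `18 * ε + dist x' x ≤ 37 * dist x' x`, so the
weights are comparable. -/
theorem exists_gagliardoDensity_smoothAvg_le_far (hσ : IsAhlforsRegular σ F m c C)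
    (hF : F.Nonempty) :
    ∃ K, 0 ≤ K ∧ ∀ r : E → ℝ, IsScale F r → ∀ ε, 0 < ε → 3 * ε ≤ 1 →
      (∀ x ∈ F, ε ≤ r x ∧ r x ≤ 3 * ε) → ∀ φ : E → V, Integrable φ σ → ∀ x ∈ F, ∀ x' ∈ F,
      ε / 2 ≤ dist x' x →
      gagliardoDensity m (smoothAvg σ r φ) x' x ≤
        ENNReal.ofReal (K * ε⁻¹ ^ (2 * m)) *
          ∫⁻ y in Metric.ball x (9 * ε), ∫⁻ z in Metric.ball x' (9 * ε),
            gagliardoDensity m φ z y ∂σ ∂σ := by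
  obtain ⟨K, hK, h⟩ := exists_enorm_smoothAvg_sub_const_sq_le (V := V) hσ hF
  refine ⟨K ^ 2 * 37 ^ (m + 1), by positivity, fun r hr ε hε hε1 hrε φ hφ x hx x' hx' hd => ?_⟩
  have key : ∀ x ∈ F, ∀ v : V, ‖smoothAvg σ r φ x - v‖ₑ ^ 2 ≤ ENNReal.ofReal (K * ε⁻¹ ^ m) *
      ∫⁻ y in Metric.ball x (9 * ε), ‖φ y - v‖ₑ ^ 2 ∂σ := by
    intro x hx v
    obtain ⟨h1, h2⟩ := hrε x hx
    have h0 := hr.pos x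
    refine (h r hr φ hφ x v (by linarith)).trans ?_
    exact mul_le_mul' (ENNReal.ofReal_le_ofReal (by gcongr))
      (lintegral_mono_set (Metric.ball_subset_ball (by linarith)))
  have hd0 : 0 < dist x' x := by linarith
  have hfin1 : ENNReal.ofReal ((dist x' x)⁻¹ ^ (m + 1)) ≠ ⊤ := ENNReal.ofReal_ne_top
  calc gagliardoDensity m (smoothAvg σ r φ) x' x
      ≤ (ENNReal.ofReal (K * ε⁻¹ ^ m) * ∫⁻ y in Metric.ball x (9 * ε),
          ENNReal.ofReal (K * ε⁻¹ ^ m) * ∫⁻ z in Metric.ball x' (9 * ε),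
            ‖φ z - φ y‖ₑ ^ 2 ∂σ ∂σ) * ENNReal.ofReal ((dist x' x)⁻¹ ^ (m + 1)) := by
        rw [gagliardoDensity]
        gcongr
        rw [← enorm_neg, neg_sub]
        refine (key x hx _).trans ?_
        gcongr with y
        rw [← enorm_neg, neg_sub]
        exact key x' hx' _
    _ = ENNReal.ofReal (K ^ 2 * ε⁻¹ ^ (2 * m)) * ∫⁻ y in Metric.ball x (9 * ε),
          ∫⁻ z in Metric.ball x' (9 * ε),
            ENNReal.ofReal ((dist x' x)⁻¹ ^ (m + 1)) * ‖φ z - φ y‖ₑ ^ 2 ∂σ ∂σ := by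
        simp only [lintegral_const_mul' _ _ hfin1, lintegral_const_mul' _ _ ENNReal.ofReal_ne_top]
        rw [← mul_assoc, mul_right_comm, ← ENNReal.ofReal_mul (by positivity), mul_assoc]
        congr 2
        ring
    _ ≤ ENNReal.ofReal (K ^ 2 * ε⁻¹ ^ (2 * m)) * ∫⁻ y in Metric.ball x (9 * ε),
          ∫⁻ z in Metric.ball x' (9 * ε),
            ENNReal.ofReal (37 ^ (m + 1)) * gagliardoDensity m φ z y ∂σ ∂σ := by
        gcongr ENNReal.ofReal (K ^ 2 * ε⁻¹ ^ (2 * m)) * ?_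
        refine setLIntegral_mono' Metric.isOpen_ball.measurableSet fun y hy => ?_
        refine setLIntegral_mono' Metric.isOpen_ball.measurableSet fun z hz => ?_
        refine enorm_sub_sq_mul_le_gagliardoDensity φ (by positivity) (by norm_num) ?_
        rw [Metric.mem_ball] at hy hz
        rw [inv_mul_le_iff₀ hd0]
        have t1 := dist_triangle z x' y
        have t2 := dist_triangle x' x y
        rw [dist_comm x y] at t2
        linarith
    _ = _ := by
        simp only [lintegral_const_mul' _ _ ENNReal.ofReal_ne_top]
        rw [← mul_assoc, ← ENNReal.ofReal_mul (by positivity)]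
        congr 2
        ring

end Density

/-! ### Near-diagonal energy and density of smooth functions. -/

section NearDiagonal

variable {E : Type*} [NormedAddCommGroup E] [InnerProductSpace ℝ E] [FiniteDimensional ℝ E]
  [MeasurableSpace E] [BorelSpace E] {σ : Measure E} [IsFiniteMeasure σ]
  {F : Set E} {m : ℕ} {c C : ℝ}
  {V : Type*} [NormedAddCommGroup V]

/-- The part of the squared Gagliardo seminorm within distance `η` of the diagonal. -/
noncomputable def nearGagliardoEnergy (σ : Measure E) (m : ℕ) (η : ℝ) (φ : E → V) : ENNReal :=
  ∫⁻ z, ∫⁻ y in Metric.ball z η, gagliardoDensity m φ y z ∂σ ∂σ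

theorem measurable_setLIntegral_ball_gagliardoDensity (m : ℕ) {φ : E → V}
    (hφ : StronglyMeasurable φ) (η : ℝ) :
    Measurable fun z => ∫⁻ y in Metric.ball z η, gagliardoDensity m φ y z ∂σ := by
  have h := measurable_setLIntegral_ball (σ := σ) (W := fun z y => gagliardoDensity m φ y z)
    (measurable_gagliardoDensity_swap m hφ) η
  exact h.comp (measurable_id.prodMk measurable_id)

/-- Absolute continuity of the integral over pairs: the strip of width `η` around the diagonal has
product measure of order `η ^ (a + 1)`. The exponent is positive because the boundary has dimension
at least one. -/
theorem tendsto_nearGagliardoEnergy {a : ℕ} (hσ : IsAhlforsRegular σ F (a + 1) c C) {φ : E → V}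
    (hφ : StronglyMeasurable φ) (hfin : gagliardoEnergy σ m φ ≠ ⊤) :
    Filter.Tendsto (fun η => nearGagliardoEnergy σ m η φ) (nhdsWithin 0 (Ioi 0)) (nhds 0) := by
  have hm : Measurable fun p : E × E => gagliardoDensity m φ p.2 p.1 :=
    measurable_gagliardoDensity_swap m hφ
  have hS : ∀ η : ℝ, MeasurableSet {p : E × E | dist p.2 p.1 < η} := fun η =>
    (isOpen_lt (by fun_prop) continuous_const).measurableSet
  have e1 : gagliardoEnergy σ m φ = ∫⁻ p, gagliardoDensity m φ p.2 p.1 ∂(σ.prod σ) := by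
    rw [lintegral_prod _ hm.aemeasurable]
    rfl
  have e2 : ∀ η, nearGagliardoEnergy σ m η φ =
      ∫⁻ p in {p : E × E | dist p.2 p.1 < η}, gagliardoDensity m φ p.2 p.1 ∂(σ.prod σ) := by
    intro η
    rw [← lintegral_indicator (hS η), lintegral_prod _ (hm.indicator (hS η)).aemeasurable]
    refine lintegral_congr fun z => ?_
    rw [← lintegral_indicator Metric.isOpen_ball.measurableSet]
    rfl
  simp only [e2]
  rw [e1] at hfin
  refine tendsto_setLIntegral_zero hfin ?_
  have hle : ∀ η ∈ Ioi (0 : ℝ), (σ.prod σ) {p : E × E | dist p.2 p.1 < η} ≤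
      ENNReal.ofReal (C * η ^ (a + 1)) * σ univ := by
    intro η hη
    rw [Measure.prod_apply (hS η), ← lintegral_const]
    refine lintegral_mono fun z => ?_
    exact hσ.ball_le z η hη
  have hz : Filter.Tendsto (fun η : ℝ => ENNReal.ofReal (C * η ^ (a + 1)) * σ univ)
      (nhdsWithin 0 (Ioi 0)) (nhds 0) := by
    have hc : Continuous fun η : ℝ => C * η ^ (a + 1) := by fun_prop
    have h1 : Filter.Tendsto (fun η : ℝ => ENNReal.ofReal (C * η ^ (a + 1)))
        (nhds 0) (nhds (ENNReal.ofReal (C * 0 ^ (a + 1)))) :=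
      (ENNReal.continuous_ofReal.comp hc).continuousAt
    simp only [ne_eq, Nat.succ_ne_zero, not_false_eq_true, zero_pow, mul_zero,
      ENNReal.ofReal_zero] at h1
    have h2 := ENNReal.Tendsto.mul_const h1 (Or.inr (measure_ne_top σ univ))
    rw [zero_mul] at h2
    exact h2.mono_left nhdsWithin_le_nhds
  refine tendsto_of_tendsto_of_tendsto_of_le_of_le' tendsto_const_nhds hz
    (Filter.Eventually.of_forall fun _ => zero_le) ?_
  filter_upwards [self_mem_nhdsWithin] with η hη
  exact hle η hη

variable [NormedSpace ℝ V] [CompleteSpace V]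

/-- Two points within `18 * ε` of `x` are within `36 * ε` of each other, and each is counted by a
ball of mass of order `ε ^ (a + 1)`. All powers of `ε` cancel. -/
theorem exists_nearGagliardoEnergy_smoothAvg_le_self {a : ℕ}
    (hσ : IsAhlforsRegular σ F (a + 1) c C) (hF : F.Nonempty) (hσF : ∀ᵐ x ∂σ, x ∈ F) :
    ∃ K, 0 ≤ K ∧ ∀ r : E → ℝ, IsScale F r → ∀ ε, 0 < ε → 3 * ε ≤ 1 →
      (∀ x ∈ F, ε ≤ r x ∧ r x ≤ 3 * ε) →
      ∀ φ : E → V, StronglyMeasurable φ → Integrable φ σ →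
      nearGagliardoEnergy σ (a + 1) (ε / 2) (smoothAvg σ r φ) ≤
        ENNReal.ofReal K * nearGagliardoEnergy σ (a + 1) (36 * ε) φ := by
  obtain ⟨K, hK, h⟩ := exists_lintegral_double_average_le_near (V := V) hσ hF
  have hC := hσ.nonneg
  refine ⟨K * 36 ^ (a + 2) * (C * 18 ^ (a + 1)), by positivity,
    fun r hr ε hε hε1 hrε φ hφm hφ => ?_⟩
  calc nearGagliardoEnergy σ (a + 1) (ε / 2) (smoothAvg σ r φ)
      ≤ ∫⁻ x, ENNReal.ofReal (K * ε⁻¹ ^ (2 * a + 3)) *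
          ∫⁻ z in Metric.ball x (18 * ε), ∫⁻ y in Metric.ball x (18 * ε),
            ‖φ y - φ z‖ₑ ^ 2 ∂σ ∂σ ∂σ :=
        lintegral_mono_ae (hσF.mono fun x hx =>
          h r hr ε hε hε1 φ hφ x (hrε x hx).1 (hrε x hx).2)
    _ ≤ ∫⁻ x, ENNReal.ofReal (K * ε⁻¹ ^ (2 * a + 3)) *
          ∫⁻ z in Metric.ball x (18 * ε), ENNReal.ofReal ((36 * ε) ^ (a + 1 + 1)) *
            ∫⁻ y in Metric.ball z (36 * ε), gagliardoDensity (a + 1) φ y z ∂σ ∂σ ∂σ := by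
        refine lintegral_mono fun x => mul_le_mul' le_rfl ?_
        refine setLIntegral_mono' Metric.isOpen_ball.measurableSet fun z hz => ?_
        rw [Metric.mem_ball] at hz
        rw [← lintegral_const_mul' _ _ ENNReal.ofReal_ne_top]
        have hsub : Metric.ball x (18 * ε) ⊆ Metric.ball z (36 * ε) :=
          Metric.ball_subset_ball' (by rw [dist_comm]; linarith)
        refine (lintegral_mono_set hsub).trans ?_
        refine setLIntegral_mono' Metric.isOpen_ball.measurableSet fun y hy => ?_
        exact enorm_sub_sq_le_gagliardoDensity φ (Metric.mem_ball.mp hy).le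
    _ ≤ ENNReal.ofReal (K * ε⁻¹ ^ (2 * a + 3)) * (ENNReal.ofReal ((36 * ε) ^ (a + 1 + 1)) *
          (ENNReal.ofReal (C * (18 * ε) ^ (a + 1)) *
            nearGagliardoEnergy σ (a + 1) (36 * ε) φ)) := by
        simp only [lintegral_const_mul' _ _ ENNReal.ofReal_ne_top]
        refine mul_le_mul' le_rfl (mul_le_mul' le_rfl ?_)
        exact lintegral_setLIntegral_ball_le hσ
          (measurable_setLIntegral_ball_gagliardoDensity _ hφm _) (by positivity)
    _ = _ := by
        rw [← mul_assoc, ← mul_assoc, ← ENNReal.ofReal_mul (by positivity),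
          ← ENNReal.ofReal_mul (by positivity)]
        congr 2
        rw [show 2 * a + 3 = (a + 1) + (a + 1 + 1) by ring, pow_add, mul_pow, mul_pow]
        simp only [inv_pow]
        field_simp

/-- Averaging does not concentrate energy at the diagonal, uniformly in `ε ≤ η`. Pairs closer than
`ε / 2` fall under the Lipschitz estimate, the others under the far estimate, whose averaged pairs
are still within `36 * η`. -/
theorem exists_nearGagliardoEnergy_smoothAvg_le {a : ℕ}
    (hσ : IsAhlforsRegular σ F (a + 1) c C) (hF : F.Nonempty) (hσF : ∀ᵐ x ∂σ, x ∈ F) :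
    ∃ K, 0 ≤ K ∧ ∀ r : E → ℝ, IsScale F r → ∀ ε, 0 < ε → 3 * ε ≤ 1 →
      (∀ x ∈ F, ε ≤ r x ∧ r x ≤ 3 * ε) →
      ∀ φ : E → V, StronglyMeasurable φ → Integrable φ σ → ∀ η, ε ≤ η →
      nearGagliardoEnergy σ (a + 1) η (smoothAvg σ r φ) ≤
        ENNReal.ofReal K * nearGagliardoEnergy σ (a + 1) (36 * η) φ := by
  obtain ⟨K₁, hK₁, h₁⟩ := exists_nearGagliardoEnergy_smoothAvg_le_self (V := V) hσ hF hσF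
  obtain ⟨K₂, hK₂, h₂⟩ := exists_gagliardoDensity_smoothAvg_le_far (V := V) hσ hF
  have hC := hσ.nonneg
  refine ⟨K₁ + K₂ * (C * 9 ^ (a + 1)) ^ 2, by positivity,
    fun r hr ε hε hε1 hrε φ hφm hφ η hη => ?_⟩
  set A := smoothAvg σ r φ with hA
  have hAm : StronglyMeasurable A :=
    (contDiff_smoothAvg hσ hF hr hφ).continuous.stronglyMeasurable
  set W : E → E → ENNReal := fun y z =>
    (Metric.ball y (36 * η)).indicator (fun z => gagliardoDensity (a + 1) φ z y) z with hW
  have hWm : Measurable (Function.uncurry W) := by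
    have : Function.uncurry W = {p : E × E | dist p.2 p.1 < 36 * η}.indicator
        fun p => gagliardoDensity (a + 1) φ p.2 p.1 := rfl
    rw [this]
    exact (measurable_gagliardoDensity_swap (a + 1) hφm).indicator
      (isOpen_lt (by fun_prop) continuous_const).measurableSet
  have hWi : ∫⁻ y, ∫⁻ z, W y z ∂σ ∂σ = nearGagliardoEnergy σ (a + 1) (36 * η) φ := by
    refine lintegral_congr fun y => ?_
    exact lintegral_indicator Metric.isOpen_ball.measurableSet _
  have hfar : ∀ x ∈ F, ∫⁻ x' in Metric.ball x η \ Metric.ball x (ε / 2),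
      gagliardoDensity (a + 1) A x' x ∂σ ≤ ∫⁻ x', ENNReal.ofReal (K₂ * ε⁻¹ ^ (2 * (a + 1))) *
        ∫⁻ y in Metric.ball x (9 * ε), ∫⁻ z in Metric.ball x' (9 * ε), W y z ∂σ ∂σ ∂σ := by
    intro x hx
    refine le_trans ?_ (setLIntegral_le_lintegral (Metric.ball x η \ Metric.ball x (ε / 2)) _)
    refine setLIntegral_mono_ae' (Metric.isOpen_ball.measurableSet.diff
      Metric.isOpen_ball.measurableSet) (hσF.mono fun x' hx' hmem => ?_)
    obtain ⟨hm1, hm2⟩ := hmem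
    rw [Metric.mem_ball] at hm1
    rw [Metric.mem_ball, not_lt] at hm2
    refine (h₂ r hr ε hε hε1 hrε φ hφ x hx x' hx' hm2).trans (mul_le_mul' le_rfl ?_)
    refine setLIntegral_mono' Metric.isOpen_ball.measurableSet fun y hy => ?_
    refine setLIntegral_mono' Metric.isOpen_ball.measurableSet fun z hz => ?_
    rw [Metric.mem_ball] at hy hz
    have hzy : z ∈ Metric.ball y (36 * η) := by
      rw [Metric.mem_ball]
      have t1 := dist_triangle z x' y
      have t2 := dist_triangle x' x y
      rw [dist_comm x y] at t2
      linarith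
    rw [hW]
    simp only
    rw [indicator_of_mem hzy]
  calc nearGagliardoEnergy σ (a + 1) η A
      ≤ ∫⁻ x, (∫⁻ x' in Metric.ball x (ε / 2), gagliardoDensity (a + 1) A x' x ∂σ) +
          (∫⁻ x', ENNReal.ofReal (K₂ * ε⁻¹ ^ (2 * (a + 1))) *
        ∫⁻ y in Metric.ball x (9 * ε), ∫⁻ z in Metric.ball x' (9 * ε), W y z ∂σ ∂σ ∂σ) ∂σ := by
        refine lintegral_mono_ae (hσF.mono fun x hx => ?_)
        rw [← lintegral_inter_add_sdiff _ (Metric.ball x η)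
          (measurableSet_ball (x := x) (ε := ε / 2))]
        exact add_le_add (lintegral_mono_set inter_subset_right) (hfar x hx)
    _ = nearGagliardoEnergy σ (a + 1) (ε / 2) A +
          ENNReal.ofReal (K₂ * ε⁻¹ ^ (2 * (a + 1))) * ∫⁻ x, ∫⁻ x',
        ∫⁻ y in Metric.ball x (9 * ε), ∫⁻ z in Metric.ball x' (9 * ε), W y z ∂σ ∂σ ∂σ ∂σ := by
        rw [lintegral_add_left (measurable_setLIntegral_ball_gagliardoDensity (a + 1) hAm (ε / 2))]
        simp only [lintegral_const_mul' _ _ ENNReal.ofReal_ne_top]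
        rfl
    _ ≤ ENNReal.ofReal K₁ * nearGagliardoEnergy σ (a + 1) (36 * η) φ +
          ENNReal.ofReal (K₂ * ε⁻¹ ^ (2 * (a + 1))) *
            (ENNReal.ofReal (C * (9 * ε) ^ (a + 1)) * (ENNReal.ofReal (C * (9 * ε) ^ (a + 1)) *
              nearGagliardoEnergy σ (a + 1) (36 * η) φ)) := by
        refine add_le_add ((h₁ r hr ε hε hε1 hrε φ hφm hφ).trans (mul_le_mul' le_rfl ?_))
          (mul_le_mul' le_rfl ?_)
        · exact lintegral_mono fun z =>
            lintegral_mono_set (Metric.ball_subset_ball (by linarith))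
        · rw [← hWi]
          exact lintegral_lintegral_setLIntegral_ball_le hσ hWm (by positivity)
    _ = _ := by
        rw [ENNReal.ofReal_add hK₁ (by positivity), add_mul, ← mul_assoc, ← mul_assoc,
          ← ENNReal.ofReal_mul (by positivity), ← ENNReal.ofReal_mul (by positivity)]
        congr 3
        simp only [mul_pow, inv_pow, pow_mul]
        field_simp
        ring

theorem gagliardoDensity_sub_le (m : ℕ) (φ ψ : E → V) (y z : E) :
    gagliardoDensity m (fun x => φ x - ψ x) y z ≤
      2 * (gagliardoDensity m φ y z + gagliardoDensity m ψ y z) := by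
  simp only [gagliardoDensity]
  rw [← add_mul, ← mul_assoc]
  refine mul_le_mul' ?_ le_rfl
  have : φ y - ψ y - (φ z - ψ z) = (φ y - φ z) - (ψ y - ψ z) := by abel
  rw [this]
  refine le_trans ?_ (ENNReal.add_sq_le_two_mul _ _)
  gcongr
  exact enorm_sub_le

theorem gagliardoDensity_le_of_le_dist (m : ℕ) (φ : E → V) {y z : E} {η : ℝ} (hη : 0 < η)
    (h : η ≤ dist y z) :
    gagliardoDensity m φ y z ≤
      ENNReal.ofReal (η⁻¹ ^ (m + 1)) * (2 * (‖φ y‖ₑ ^ 2 + ‖φ z‖ₑ ^ 2)) := by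
  rw [gagliardoDensity, mul_comm]
  refine mul_le_mul' (ENNReal.ofReal_le_ofReal ?_) ?_
  · gcongr
  · refine le_trans ?_ (ENNReal.add_sq_le_two_mul _ _)
    gcongr
    exact enorm_sub_le

theorem gagliardoEnergy_le_near_add {m : ℕ} {φ : E → V} (hφ : StronglyMeasurable φ) {η : ℝ}
    (hη : 0 < η) :
    gagliardoEnergy σ m φ ≤ nearGagliardoEnergy σ m η φ +
      ENNReal.ofReal (η⁻¹ ^ (m + 1)) * (4 * σ univ) * ∫⁻ x, ‖φ x‖ₑ ^ 2 ∂σ := by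
  have hm2 : Measurable fun x => ‖φ x‖ₑ ^ 2 := hφ.enorm.pow_const 2
  set N := ∫⁻ x, ‖φ x‖ₑ ^ 2 ∂σ with hN
  calc gagliardoEnergy σ m φ ≤ ∫⁻ z, (∫⁻ y in Metric.ball z η, gagliardoDensity m φ y z ∂σ) +
        ENNReal.ofReal (η⁻¹ ^ (m + 1)) * (2 * (N + ‖φ z‖ₑ ^ 2 * σ univ)) ∂σ := by
        refine lintegral_mono fun z => ?_
        refine (lintegral_add_compl _
          (measurableSet_ball (x := z) (ε := η))).symm.le.trans ?_
        refine add_le_add le_rfl ?_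
        calc ∫⁻ y in (Metric.ball z η)ᶜ, gagliardoDensity m φ y z ∂σ
            ≤ ∫⁻ y in (Metric.ball z η)ᶜ, ENNReal.ofReal (η⁻¹ ^ (m + 1)) *
                (2 * (‖φ y‖ₑ ^ 2 + ‖φ z‖ₑ ^ 2)) ∂σ := by
              refine setLIntegral_mono' Metric.isOpen_ball.measurableSet.compl fun y hy => ?_
              refine gagliardoDensity_le_of_le_dist m φ hη ?_
              rwa [mem_compl_iff, Metric.mem_ball, not_lt] at hy
          _ ≤ ∫⁻ y, ENNReal.ofReal (η⁻¹ ^ (m + 1)) *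
                (2 * (‖φ y‖ₑ ^ 2 + ‖φ z‖ₑ ^ 2)) ∂σ := setLIntegral_le_lintegral _ _
          _ = _ := by
              rw [lintegral_const_mul' _ _ ENNReal.ofReal_ne_top,
                lintegral_const_mul' _ _ ENNReal.ofNat_ne_top, lintegral_add_left hm2,
                lintegral_const]
    _ = nearGagliardoEnergy σ m η φ + ENNReal.ofReal (η⁻¹ ^ (m + 1)) *
          (2 * (N * σ univ + N * σ univ)) := by
        rw [lintegral_add_left (measurable_setLIntegral_ball_gagliardoDensity m hφ η),
          lintegral_const_mul' _ _ ENNReal.ofReal_ne_top,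
          lintegral_const_mul' _ _ ENNReal.ofNat_ne_top, lintegral_add_left measurable_const,
          lintegral_const, lintegral_mul_const _ hm2]
        rfl
    _ = _ := by
        congr 1
        ring

/-- Restrictions of smooth functions are dense among functions of finite Gagliardo energy. -/
theorem exists_contDiff_gagliardoEnergy_sub_le {a : ℕ} (hσ : IsAhlforsRegular σ F (a + 1) c C)
    (hF : F.Nonempty) (hFb : Bornology.IsBounded F) (hσF : ∀ᵐ x ∂σ, x ∈ F) {φ : E → V}
    (hφm : StronglyMeasurable φ) (hφ : Integrable φ σ) (hfin : gagliardoEnergy σ (a + 1) φ ≠ ⊤)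
    {κ : ENNReal} (hκ : 0 < κ) :
    ∃ Ψ : E → V, ContDiff ℝ ∞ Ψ ∧ HasCompactSupport Ψ ∧
      ∫⁻ x, ‖Ψ x - φ x‖ₑ ^ 2 ∂σ ≤ κ ∧ gagliardoEnergy σ (a + 1) (fun x => Ψ x - φ x) ≤ κ := by
  obtain ⟨K₁, hK₁, h₁⟩ := exists_lintegral_smoothAvg_sub_sq_le (V := V) hσ hF hσF
  obtain ⟨K₂, hK₂, h₂⟩ := exists_nearGagliardoEnergy_smoothAvg_le (V := V) hσ hF hσF
  have hκ2 : 0 < κ / 2 := ENNReal.half_pos hκ.ne'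
  have hnear := tendsto_nearGagliardoEnergy hσ hφm hfin
  -- First fix `η`, making the near-diagonal energies of `φ` and of all its averages at scales `ε ≤
  -- η` small.
  obtain ⟨η, hη, hηκ⟩ : ∃ η : ℝ, 0 < η ∧
      2 * ((ENNReal.ofReal K₂ + 1) * nearGagliardoEnergy σ (a + 1) (36 * η) φ) ≤ κ / 2 := by
    have hfin2 : ENNReal.ofReal K₂ + 1 ≠ ⊤ := by simp
    have h1 := ENNReal.Tendsto.const_mul (ENNReal.Tendsto.const_mul hnear (Or.inr hfin2))
      (Or.inr (ENNReal.ofNat_ne_top (n := 2)))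
    rw [mul_zero, mul_zero] at h1
    obtain ⟨t, ht1, ht2⟩ := ((h1.eventually (ge_mem_nhds hκ2)).and self_mem_nhdsWithin).exists
    have ht2' : 0 < t := ht2
    refine ⟨t / 36, by positivity, ?_⟩
    rwa [mul_div_cancel₀ t (by norm_num : (36 : ℝ) ≠ 0)]
  set G := gagliardoEnergy σ (a + 1) φ with hG
  set M := ENNReal.ofReal (η⁻¹ ^ (a + 1 + 1)) * (4 * σ univ) with hM
  have hMfin : M ≠ ⊤ := ENNReal.mul_ne_top ENNReal.ofReal_ne_top
    (ENNReal.mul_ne_top (by norm_num) (measure_ne_top σ univ))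
  -- Only now choose `ε`: away from the diagonal the energy is at most `M`, which depends on `η`,
  -- times the squared `L²` error. The condition `6 * ε ≤ 1` puts `r ≤ 1 / 2` on `F`, where the
  -- cutoff is `1`.
  obtain ⟨ε, hε, hεη, hε1, hε2, hε3⟩ : ∃ ε : ℝ, 0 < ε ∧ ε ≤ η ∧ 6 * ε ≤ 1 ∧
      ENNReal.ofReal (K₁ * ε) * G ≤ κ ∧ M * (ENNReal.ofReal (K₁ * ε) * G) ≤ κ / 2 := by
    have h0 : Filter.Tendsto (fun ε : ℝ => ENNReal.ofReal (K₁ * ε) * G) (nhdsWithin 0 (Ioi 0))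
        (nhds 0) := by
      have hc : Continuous fun ε : ℝ => K₁ * ε := by fun_prop
      have h1 : Filter.Tendsto (fun ε : ℝ => ENNReal.ofReal (K₁ * ε))
          (nhds 0) (nhds (ENNReal.ofReal (K₁ * 0))) :=
        (ENNReal.continuous_ofReal.comp hc).continuousAt
      rw [mul_zero, ENNReal.ofReal_zero] at h1
      have h2 := ENNReal.Tendsto.mul_const h1 (Or.inr hfin)
      rw [zero_mul] at h2
      exact h2.mono_left nhdsWithin_le_nhds
    have h3 := ENNReal.Tendsto.const_mul h0 (Or.inr hMfin)
    rw [mul_zero] at h3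
    have h4 : ∀ᶠ ε : ℝ in nhdsWithin 0 (Ioi 0), ε ≤ min η (1 / 6) :=
      mem_nhdsWithin_of_mem_nhds (ge_mem_nhds (by positivity))
    obtain ⟨ε, ⟨⟨hb, hc⟩, hd⟩, he⟩ := (((h0.eventually (ge_mem_nhds hκ)).and
      (h3.eventually (ge_mem_nhds hκ2))).and h4 |>.and self_mem_nhdsWithin).exists
    refine ⟨ε, he, hd.trans (min_le_left _ _), ?_, hb, hc⟩
    linarith [hd.trans (min_le_right _ _)]
  obtain ⟨r, hr, hrb⟩ := exists_isScale F hε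
  have hrε : ∀ x ∈ F, ε ≤ r x ∧ r x ≤ 3 * ε := by
    intro x hx
    have := hrb x
    rwa [Metric.infDist_zero_of_mem hx, zero_add, zero_add] at this
  set A := smoothAvg σ r φ with hA
  have hAs : ContDiff ℝ ∞ A := contDiff_smoothAvg hσ hF hr hφ
  have hAm : StronglyMeasurable A := hAs.continuous.stronglyMeasurable
  -- The cutoff only serves to give compact support; on `F` it changes nothing.
  have hΨA : ∀ᵐ x ∂σ, layerExtension σ r 1 φ x = A x := by
    filter_upwards [hσF] with x hx
    rw [layerExtension, layerCutoff_eq_one hr one_pos (by linarith [(hrε x hx).2]), one_smul]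
  have hL2 : ∫⁻ x, ‖A x - φ x‖ₑ ^ 2 ∂σ ≤ ENNReal.ofReal (K₁ * ε) * G :=
    h₁ r hr ε hε (by linarith) hrε φ hφ
  have hgag : gagliardoEnergy σ (a + 1) (fun x => A x - φ x) ≤ κ := by
    refine (gagliardoEnergy_le_near_add (hAm.sub hφm) hη).trans ?_
    have hsm : nearGagliardoEnergy σ (a + 1) η (fun x => A x - φ x) ≤ κ / 2 := by
      refine le_trans ?_ hηκ
      calc nearGagliardoEnergy σ (a + 1) η (fun x => A x - φ x)
          ≤ ∫⁻ z, ∫⁻ y in Metric.ball z η, 2 * (gagliardoDensity (a + 1) A y z +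
              gagliardoDensity (a + 1) φ y z) ∂σ ∂σ :=
            lintegral_mono fun z => lintegral_mono fun y => gagliardoDensity_sub_le _ _ _ _ _
        _ = 2 * (nearGagliardoEnergy σ (a + 1) η A + nearGagliardoEnergy σ (a + 1) η φ) := by
            have hmz := measurable_gagliardoDensity_left (a + 1) hAm
            simp only [lintegral_const_mul' _ _ (ENNReal.ofNat_ne_top (n := 2))]
            congr 1
            rw [nearGagliardoEnergy, nearGagliardoEnergy, ← lintegral_add_left
              (measurable_setLIntegral_ball_gagliardoDensity (a + 1) hAm η)]
            exact lintegral_congr fun z => lintegral_add_left (hmz z) _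
        _ ≤ _ := by
            rw [add_mul, one_mul]
            refine mul_le_mul' le_rfl (add_le_add ?_ ?_)
            · exact h₂ r hr ε hε (by linarith) hrε φ hφm hφ η hεη
            · exact lintegral_mono fun z =>
                lintegral_mono_set (Metric.ball_subset_ball (by linarith))
    calc _ ≤ κ / 2 + M * (ENNReal.ofReal (K₁ * ε) * G) :=
          add_le_add hsm (mul_le_mul' le_rfl hL2)
      _ ≤ κ / 2 + κ / 2 := by gcongr
      _ = κ := ENNReal.add_halves κ
  refine ⟨layerExtension σ r 1 φ, contDiff_layerExtension hσ hF hr hφ,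
    hasCompactSupport_layerExtension hF hFb hr one_pos φ, ?_, ?_⟩
  · refine le_trans (le_of_eq ?_) (hL2.trans hε2)
    refine lintegral_congr_ae (hΨA.mono fun x hx => ?_)
    simp only [hx]
  · refine le_trans (le_of_eq ?_) hgag
    refine lintegral_congr_ae (hΨA.mono fun z hz => ?_)
    refine lintegral_congr_ae (hΨA.mono fun y hy => ?_)
    simp only [hz, hy]

end NearDiagonal

/-! ### Hahn–Banach extension and the choice of `δ`. -/

section Extension

/-- The bound forces `f` to vanish on the kernel of `ι`, so `f` descends to the range and extends
from there with the same norm. -/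
theorem exists_strongDual_of_norm_le {𝕜 P H : Type*} [RCLike 𝕜] [AddCommGroup P] [Module 𝕜 P]
    [NormedAddCommGroup H] [NormedSpace 𝕜 H] (ι : P →ₗ[𝕜] H) (f : P →ₗ[𝕜] 𝕜) {B : ℝ} (hB : 0 ≤ B)
    (h : ∀ p, ‖f p‖ ≤ B * ‖ι p‖) :
    ∃ T : StrongDual 𝕜 H, (∀ p, T (ι p) = f p) ∧ ‖T‖ ≤ B := by
  have hker : LinearMap.ker ι ≤ LinearMap.ker f := fun p hp => by
    have := h p
    rw [LinearMap.mem_ker.mp hp, norm_zero, mul_zero] at this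
    exact LinearMap.mem_ker.mpr (norm_le_zero_iff.mp this)
  set L : LinearMap.range ι →ₗ[𝕜] 𝕜 :=
    (LinearMap.ker ι).liftQ f hker ∘ₗ ι.quotKerEquivRange.symm.toLinearMap with hL
  have hLι : ∀ p, L ⟨ι p, p, rfl⟩ = f p := fun p => by
    have : ι.quotKerEquivRange.symm ⟨ι p, p, rfl⟩ = (LinearMap.ker ι).mkQ p :=
      ι.quotKerEquivRange_symm_apply_image p _
    simp only [hL, LinearMap.comp_apply, LinearEquiv.coe_coe, this, Submodule.mkQ_apply,
      Submodule.liftQ_apply]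
  have hLB : ∀ x, ‖L x‖ ≤ B * ‖x‖ := by
    rintro ⟨_, p, rfl⟩
    rw [hLι]
    exact h p
  obtain ⟨T, hT, hTn⟩ := exists_extension_norm_eq _ (L.mkContinuous B hLB)
  refine ⟨T, fun p => ?_, hTn.le.trans (L.mkContinuous_norm_le hB hLB)⟩
  exact (hT ⟨ι p, p, rfl⟩).trans (hLι p)

/-- The choice `δ = U / (U + G) ≤ 1` makes the first term equal to, and the second at most, a
multiple of `√(U * (U + G))`. -/
theorem le_sqrt_mul_of_forall_le {U G K W X n : ℝ} (hU : 0 ≤ U) (hG : 0 ≤ G) (hK : 0 ≤ K)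
    (hW : 0 ≤ W) (_hn : 0 ≤ n)
    (h : ∀ δ, 0 < δ → δ ≤ 1 → X ≤ n * (U * (√(K * δ⁻¹) * W)) + G * (√(K * δ) * W)) :
    X ≤ (n + 1) * √K * √(U * (U + G)) * W := by
  -- For `U = 0` that `δ` is not positive; instead let `δ → 0`.
  rcases hU.eq_or_lt with rfl | hU
  · have hlim : Filter.Tendsto (fun δ => G * (√(K * δ) * W)) (nhdsWithin 0 (Ioi 0))
        (nhds (G * (√(K * 0) * W))) :=
      ((by fun_prop : Continuous fun δ => G * (√(K * δ) * W)).tendsto 0).mono_left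
        nhdsWithin_le_nhds
    have := ge_of_tendsto hlim (b := X) (by
      filter_upwards [Ioc_mem_nhdsGT zero_lt_one] with δ hδ
      simpa using h δ hδ.1 hδ.2)
    simpa using this
  · have hs : 0 < U + G := by linarith
    have h1 : U * √(K * (U / (U + G))⁻¹) = √K * √(U * (U + G)) := by
      rw [← Real.sqrt_mul hK, ← Real.sqrt_sq hU.le, ← Real.sqrt_mul (sq_nonneg _),
        Real.sqrt_sq hU.le]
      congr 1
      field_simp
    have h2 : G * √(K * (U / (U + G))) ≤ √K * √(U * (U + G)) := by
      calc G * √(K * (U / (U + G))) ≤ (U + G) * √(K * (U / (U + G))) := by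
            gcongr
            linarith
        _ = √K * √(U * (U + G)) := by
            rw [← Real.sqrt_mul hK, ← Real.sqrt_sq hs.le, ← Real.sqrt_mul (sq_nonneg _),
              Real.sqrt_sq hs.le]
            congr 1
            field_simp
    calc X ≤ n * (U * (√(K * (U / (U + G))⁻¹) * W)) + G * (√(K * (U / (U + G))) * W) :=
          h _ (by positivity) ((div_le_one hs).mpr (by linarith))
      _ = n * (U * √(K * (U / (U + G))⁻¹)) * W + G * √(K * (U / (U + G))) * W := by ring
      _ ≤ n * (√K * √(U * (U + G))) * W + √K * √(U * (U + G)) * W := by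
          rw [h1]
          gcongr
      _ = _ := by ring

theorem ENNReal.ofReal_mul_sq_rpow_half {A W : ℝ} (hA : 0 ≤ A) (hW : 0 ≤ W) :
    (ENNReal.ofReal A * ENNReal.ofReal W ^ 2) ^ (1 / 2 : ℝ) = ENNReal.ofReal (√A * W) := by
  rw [← ENNReal.ofReal_pow hW, ← ENNReal.ofReal_mul hA,
    ENNReal.ofReal_rpow_of_nonneg (by positivity) (by norm_num), ← Real.sqrt_eq_rpow,
    Real.sqrt_mul hA, Real.sqrt_sq hW]

theorem le_of_ofReal_le_add_rpow_half {X U G A B W : ℝ} {n : ℕ} {S : ENNReal} (hU : 0 ≤ U)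
    (hG : 0 ≤ G) (hA : 0 ≤ A) (hB : 0 ≤ B) (hW : 0 ≤ W) (hS : S = ENNReal.ofReal W ^ 2)
    (h : ENNReal.ofReal X ≤ n * (ENNReal.ofReal U * (ENNReal.ofReal A * S) ^ (1 / 2 : ℝ)) +
      ENNReal.ofReal G * (ENNReal.ofReal B * S) ^ (1 / 2 : ℝ)) :
    X ≤ n * (U * (√A * W)) + G * (√B * W) := by
  rwa [hS, ENNReal.ofReal_mul_sq_rpow_half hA hW, ENNReal.ofReal_mul_sq_rpow_half hB hW,
    ← ENNReal.ofReal_natCast, ← ENNReal.ofReal_mul hU, ← ENNReal.ofReal_mul hG,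
    ← ENNReal.ofReal_mul (Nat.cast_nonneg _),
    ← ENNReal.ofReal_add (by positivity) (by positivity),
    ENNReal.ofReal_le_ofReal_iff (by positivity)] at h

theorem norm_sq_le_of_enorm_sq_le_ofReal {V : Type*} [NormedAddCommGroup V] {v : V} {b : ℝ}
    (hb : 0 ≤ b) (h : ‖v‖ₑ ^ 2 ≤ ENNReal.ofReal b) : ‖v‖ ^ 2 ≤ b := by
  rwa [← ofReal_norm, ← ENNReal.ofReal_pow (norm_nonneg _), ENNReal.ofReal_le_ofReal_iff hb] at h

end Extension

/-! ### The norm of `H^{1/2}`, the trace functional and its uniqueness. -/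

section Trace

variable {𝕜 : Type*} [RCLike 𝕜] {a : ℕ}

theorem enorm_gagliardoQuotient_sq (φ : EuclideanSpace ℝ (Fin (a + 2)) → 𝕜)
    (p : EuclideanSpace ℝ (Fin (a + 2)) × EuclideanSpace ℝ (Fin (a + 2))) :
    ‖gagliardoQuotient φ p‖ₑ ^ 2 = gagliardoDensity (a + 1) φ p.2 p.1 := by
  have h : ‖(‖p.1 - p.2‖ ^ (((a + 2 : ℕ) : ℝ) / 2))⁻¹‖ ^ 2 = (dist p.2 p.1)⁻¹ ^ (a + 1 + 1) := by
    rw [Real.norm_of_nonneg (by positivity), inv_pow, inv_pow, dist_comm, dist_eq_norm,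
      ← Real.rpow_natCast (‖p.1 - p.2‖ ^ _) 2, ← Real.rpow_mul (norm_nonneg _), ← Real.rpow_natCast]
    congr 2
    push_cast
    ring
  rw [gagliardoQuotient, enorm_smul, mul_pow, gagliardoDensity, mul_comm, ← h,
    ENNReal.ofReal_pow (norm_nonneg _), ofReal_norm, ← enorm_neg, neg_sub]

theorem stronglyMeasurable_gagliardoQuotient {φ : EuclideanSpace ℝ (Fin (a + 2)) → 𝕜}
    (hφ : StronglyMeasurable φ) : StronglyMeasurable (gagliardoQuotient φ) := by
  refine StronglyMeasurable.smul (Measurable.stronglyMeasurable (by fun_prop)) ?_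
  exact (hφ.comp_measurable measurable_fst).sub (hφ.comp_measurable measurable_snd)

theorem lintegral_gagliardoQuotient_sq {σ : Measure (EuclideanSpace ℝ (Fin (a + 2)))}
    [IsFiniteMeasure σ] {φ : EuclideanSpace ℝ (Fin (a + 2)) → 𝕜} (hφ : StronglyMeasurable φ) :
    ∫⁻ p, ‖gagliardoQuotient φ p‖ₑ ^ 2 ∂(σ.prod σ) = gagliardoEnergy σ (a + 1) φ := by
  simp only [enorm_gagliardoQuotient_sq]
  exact lintegral_prod _ (measurable_gagliardoDensity_swap (a + 1) hφ).aemeasurable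

theorem gagliardoEnergy_congr_ae {σ : Measure (EuclideanSpace ℝ (Fin (a + 2)))}
    {φ ψ : EuclideanSpace ℝ (Fin (a + 2)) → 𝕜} (h : φ =ᵐ[σ] ψ) :
    gagliardoEnergy σ (a + 1) φ = gagliardoEnergy σ (a + 1) ψ := by
  refine lintegral_congr_ae (h.mono fun z hz => lintegral_congr_ae (h.mono fun y hy => ?_))
  simp only [hz, hy]

variable {O : Set (EuclideanSpace ℝ (Fin (a + 2)))} [IsC1Domain O]

theorem enorm_HHalf_sq (w : HHalf 𝕜 O) :
    ‖w‖ₑ ^ 2 = gagliardoEnergy (boundaryMeasure O) (a + 1) w.1.fst +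
      ∫⁻ y, ‖w.1.fst y‖ₑ ^ 2 ∂(boundaryMeasure O) := by
  have hw : w.1.snd =ᵐ[(boundaryMeasure O).prod (boundaryMeasure O)]
    gagliardoQuotient w.1.fst := w.2
  have h1 : ‖w‖ₑ ^ 2 = ‖w.1.fst‖ₑ ^ 2 + ‖w.1.snd‖ₑ ^ 2 := by
    have := WithLp.prod_norm_sq_eq_of_L2 w.1
    rw [← ofReal_norm, ← ofReal_norm, ← ofReal_norm, ← ENNReal.ofReal_pow (norm_nonneg _),
      ← ENNReal.ofReal_pow (norm_nonneg _), ← ENNReal.ofReal_pow (norm_nonneg _),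
      ← ENNReal.ofReal_add (by positivity) (by positivity), ← this]
    rfl
  rw [h1, add_comm, ← lintegral_enorm_coeFn_sq, ← lintegral_enorm_coeFn_sq,
    ← lintegral_gagliardoQuotient_sq (Lp.stronglyMeasurable _)]
  congr 1
  refine lintegral_congr_ae (hw.mono fun p hp => ?_)
  simp only [hp]

theorem memLp_two_of_lintegral_enorm_sq_ne_top {α V : Type*} [MeasurableSpace α]
    [NormedAddCommGroup V] {μ : Measure α} {f : α → V} (hf : AEStronglyMeasurable f μ)
    (h : ∫⁻ x, ‖f x‖ₑ ^ 2 ∂μ ≠ ⊤) : MemLp f 2 μ := by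
  refine ⟨hf, ?_⟩
  rw [eLpNorm_lt_top_iff_lintegral_rpow_enorm_lt_top (by norm_num) (by norm_num)]
  simpa using h.lt_top

theorem exists_HHalf_fst_ae_eq {ψ : EuclideanSpace ℝ (Fin (a + 2)) → 𝕜} (hψ : StronglyMeasurable ψ)
    (hL : ∫⁻ y, ‖ψ y‖ₑ ^ 2 ∂(boundaryMeasure O) ≠ ⊤)
    (hG : gagliardoEnergy (boundaryMeasure O) (a + 1) ψ ≠ ⊤) :
    ∃ w : HHalf 𝕜 O, w.1.fst =ᵐ[boundaryMeasure O] ψ := by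
  have h1 := memLp_two_of_lintegral_enorm_sq_ne_top hψ.aestronglyMeasurable hL
  have h2 : MemLp (gagliardoQuotient ψ) 2 ((boundaryMeasure O).prod (boundaryMeasure O)) :=
    memLp_two_of_lintegral_enorm_sq_ne_top
      (stronglyMeasurable_gagliardoQuotient hψ).aestronglyMeasurable
      (by rwa [lintegral_gagliardoQuotient_sq hψ])
  refine ⟨⟨WithLp.toLp 2 (h1.toLp ψ, h2.toLp _), ?_⟩, h1.coeFn_toLp⟩
  change h2.toLp _ =ᵐ[_] gagliardoQuotient (h1.toLp ψ)
  have h3 := Measure.quasiMeasurePreserving_fst (μ := boundaryMeasure O)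
    (ν := boundaryMeasure O) |>.ae h1.coeFn_toLp
  have h4 := Measure.quasiMeasurePreserving_snd (μ := boundaryMeasure O)
    (ν := boundaryMeasure O) |>.ae h1.coeFn_toLp
  filter_upwards [h2.coeFn_toLp, h3, h4] with p hp hp1 hp2
  rw [hp, gagliardoQuotient, gagliardoQuotient, hp1, hp2]

variable (𝕜 O) in
/-- The pairs of an element of `H^{1/2}(∂O)` and a test function on `ℝ^d` that restricts to it. -/
def traceGraph : Submodule 𝕜 (HHalf 𝕜 O × (EuclideanSpace ℝ (Fin (a + 2)) → 𝕜)) where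
  carrier := {p | ContDiff ℝ ∞ p.2 ∧ HasCompactSupport p.2 ∧ p.1.1.fst =ᵐ[boundaryMeasure O] p.2}
  add_mem' := by
    rintro p q ⟨hp, hpc, hpe⟩ ⟨hq, hqc, hqe⟩
    refine ⟨hp.add hq, hpc.add hqc, ?_⟩
    filter_upwards [Lp.coeFn_add p.1.1.fst q.1.1.fst, hpe, hqe] with x hx hpx hqx
    exact hx.trans (congr_arg₂ _ hpx hqx)
  zero_mem' := ⟨contDiff_const, HasCompactSupport.zero, Lp.coeFn_zero _ _ _⟩
  smul_mem' := by
    rintro b p ⟨hp, hpc, hpe⟩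
    refine ⟨contDiff_const.smul hp, hpc.smul_left (f := fun _ => b), ?_⟩
    filter_upwards [Lp.coeFn_smul b p.1.1.fst, hpe] with x hx hpx
    exact hx.trans (congr_arg _ hpx)

/-- Green's formula as a linear functional of the test function. -/
noncomputable def greenFunctional (u : Lp (EuclideanSpace 𝕜 (Fin (a + 2))) 2 (volume.restrict O))
    (g : Lp 𝕜 2 (volume.restrict O)) : traceGraph 𝕜 O →ₗ[𝕜] 𝕜 where
  toFun p := greenIntegral O u g p.1.2
  map_add' p q := greenIntegral_add p.2.1 p.2.2.1 q.2.1 q.2.2.1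
  map_smul' b p := greenIntegral_const_mul b p.2.1

theorem traceGraph_energy_eq (p : traceGraph 𝕜 O) :
    gagliardoEnergy (boundaryMeasure O) (a + 1) p.1.2 +
      ∫⁻ y, ‖p.1.2 y‖ₑ ^ 2 ∂(boundaryMeasure O) = ENNReal.ofReal ‖p.1.1‖ ^ 2 := by
  have hp : p.1.1.1.fst =ᵐ[boundaryMeasure O] p.1.2 := p.2.2.2
  have h : ENNReal.ofReal ‖p.1.1‖ = ‖p.1.1‖ₑ := ofReal_norm (E := HHalf 𝕜 O) _
  rw [h, enorm_HHalf_sq, gagliardoEnergy_congr_ae hp]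
  congr 1
  exact lintegral_congr_ae (hp.mono fun y hy => by simp only [hy])

set_option maxHeartbeats 1000000 in
theorem exists_norm_greenFunctional_le (hF : (frontier O).Nonempty) :
    ∃ K, 0 ≤ K ∧ ∀ (u : Lp (EuclideanSpace 𝕜 (Fin (a + 2))) 2 (volume.restrict O))
      (g : Lp 𝕜 2 (volume.restrict O)), HasWeakDiv O u g → ∀ p : traceGraph 𝕜 O,
      ‖greenFunctional u g p‖ ≤
        (((a + 2 : ℕ) : ℝ) + 1) * √K * √(‖u‖ * (‖u‖ + ‖g‖)) * ‖p.1.1‖ := by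
  obtain ⟨c, C, hσ⟩ := isAhlforsRegular_boundaryMeasure O
  have hσ' : IsAhlforsRegular (boundaryMeasure O) (frontier O) (a + 1) c C := hσ
  have h0 := exists_enorm_greenIntegral_le (𝕜 := 𝕜) (d := a + 2) (m := a + 1) (O := O) rfl
    IsC1Domain.isOpen IsC1Domain.isBounded hF hσ'
  obtain ⟨K, hK, h⟩ := h0
  refine ⟨K, hK, fun u g hug p => ?_⟩
  have hW : 0 ≤ ‖p.1.1‖ := norm_nonneg (E := HHalf 𝕜 O) p.1.1
  have hU : 0 ≤ ‖u‖ := norm_nonneg u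
  have hG : 0 ≤ ‖g‖ := norm_nonneg g
  refine le_sqrt_mul_of_forall_le hU hG hK hW (Nat.cast_nonneg _) fun δ hδ hδ1 => ?_
  refine le_of_ofReal_le_add_rpow_half hU hG (by positivity) (by positivity) hW
    (traceGraph_energy_eq p) ?_
  have hp := h u g hug p.1.2 p.2.1 p.2.2.1 δ hδ hδ1
  rw [ofReal_norm, ofReal_norm, ofReal_norm]
  exact hp

theorem ae_boundaryMeasure_mem_frontier (O : Set (EuclideanSpace ℝ (Fin (a + 2)))) :
    ∀ᵐ x ∂(boundaryMeasure O), x ∈ frontier O :=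
  ae_restrict_mem isClosed_frontier.measurableSet

theorem exists_traceGraph_norm_sub_lt (hF : (frontier O).Nonempty) (w : HHalf 𝕜 O) {ε : ℝ}
    (hε : 0 < ε) : ∃ p ∈ traceGraph 𝕜 O, ‖p.1 - w‖ < ε := by
  obtain ⟨c, C, hσ⟩ := isAhlforsRegular_boundaryMeasure O
  have hwn : ‖w‖ₑ ^ 2 ≠ ⊤ := ENNReal.pow_ne_top enorm_ne_top
  rw [enorm_HHalf_sq] at hwn
  -- The `L²` part and the energy are each at most `ε ^ 2 / 4`, for a total below `ε ^ 2`.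
  set κ : ENNReal := ENNReal.ofReal (ε ^ 2 / 4) with hκ
  have hκ0 : 0 < κ := ENNReal.ofReal_pos.mpr (by positivity)
  have hm : StronglyMeasurable (w.1.fst : EuclideanSpace ℝ (Fin (a + 2)) → 𝕜) :=
    Lp.stronglyMeasurable _
  obtain ⟨Ψ, hΨ, hΨc, hΨL, hΨG⟩ := exists_contDiff_gagliardoEnergy_sub_le hσ hF
    (IsC1Domain.isBounded.closure.subset frontier_subset_closure)
    (ae_boundaryMeasure_mem_frontier O) hm
    ((Lp.memLp w.1.fst).integrable one_le_two) (ENNReal.add_ne_top.mp hwn).1 hκ0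
  -- The estimates concern only the difference `Ψ - w`. It defines `v`, and the restriction of `Ψ`
  -- is realized as `v + w`.
  obtain ⟨v, hv⟩ := exists_HHalf_fst_ae_eq (hΨ.continuous.stronglyMeasurable.sub hm)
    (ne_top_of_le_ne_top ENNReal.ofReal_ne_top hΨL) (ne_top_of_le_ne_top ENNReal.ofReal_ne_top hΨG)
  have hvn : ‖v‖ₑ ^ 2 ≤ κ + κ := by
    rw [enorm_HHalf_sq, gagliardoEnergy_congr_ae hv]
    refine add_le_add hΨG (le_trans (le_of_eq ?_) hΨL)
    exact lintegral_congr_ae (hv.mono fun y hy => by simp only [hy, Pi.sub_apply])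
  refine ⟨(v + w, Ψ), ⟨hΨ, hΨc, ?_⟩, ?_⟩
  · filter_upwards [Lp.coeFn_add v.1.fst w.1.fst, hv] with y hy hvy
    refine hy.trans ?_
    rw [Pi.add_apply, hvy, Pi.sub_apply, sub_add_cancel]
  · rw [add_sub_cancel_right]
    have hκ2 : κ + κ = ENNReal.ofReal (ε ^ 2 / 2) := by
      rw [hκ, ← ENNReal.ofReal_add (by positivity) (by positivity)]
      congr 1
      ring
    have hvn' : ‖v‖ ^ 2 ≤ ε ^ 2 / 2 :=
      norm_sq_le_of_enorm_sq_le_ofReal (by positivity) (hvn.trans hκ2.le)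
    exact lt_of_pow_lt_pow_left₀ 2 hε.le (hvn'.trans_lt (half_lt_self (by positivity)))

theorem IsNormalTrace.unique (hF : (frontier O).Nonempty)
    {u : Lp (EuclideanSpace 𝕜 (Fin (a + 2))) 2 (volume.restrict O)}
    {g : Lp 𝕜 2 (volume.restrict O)} {T T' : HMinusHalf 𝕜 O} (hT : IsNormalTrace O u g T)
    (hT' : IsNormalTrace O u g T') : T' = T := by
  have hd : Dense {w : HHalf 𝕜 O | ∃ p ∈ traceGraph 𝕜 O, p.1 = w} := by
    intro w
    rw [Metric.mem_closure_iff]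
    intro ε hε
    obtain ⟨p, hp, hpw⟩ := exists_traceGraph_norm_sub_lt hF w hε
    exact ⟨p.1, ⟨p, hp, rfl⟩, by rwa [dist_comm, dist_eq_norm]⟩
  refine DFunLike.coe_injective (Continuous.ext_on hd T'.continuous T.continuous ?_)
  rintro _ ⟨p, ⟨hp, hpc, hpe⟩, rfl⟩
  rw [hT p.2 hp hpc p.1 hpe, hT' p.2 hp hpc p.1 hpe]

theorem subsingleton_HHalf_of_frontier_eq_empty (hF : frontier O = ∅) :
    Subsingleton (HHalf 𝕜 O) := by
  have h0 : boundaryMeasure O = 0 := by rw [boundaryMeasure, hF, Measure.restrict_empty]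
  refine subsingleton_of_forall_eq 0 fun w => ?_
  have hw : ‖w‖ₑ ^ 2 = 0 := by
    have h1 (f : EuclideanSpace ℝ (Fin (a + 2)) → ENNReal) : ∫⁻ y, f y ∂(boundaryMeasure O) = 0 := by
      rw [h0, lintegral_zero_measure]
    rw [enorm_HHalf_sq, gagliardoEnergy, h1, h1, add_zero]
  exact enorm_eq_zero.mp (pow_eq_zero_iff two_ne_zero |>.mp hw)

theorem IsC1Domain.eq_empty_of_frontier_eq_empty (hF : frontier O = ∅) : O = ∅ := by
  refine (frontier_eq_empty_iff.mp hF).resolve_right fun h => ?_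
  exact NormedSpace.unbounded_univ ℝ (EuclideanSpace ℝ (Fin (a + 2)))
    (h ▸ IsC1Domain.isBounded (O := O))

end Trace

theorem mainTheorem7 {𝕜 : Type*} [RCLike 𝕜] {d : ℕ} (hd : 2 ≤ d)
    (O : Set (EuclideanSpace ℝ (Fin d))) [hO : IsC1Domain O] :
    ∃ C : ℝ, 0 < C ∧
      ∀ (u : Lp (EuclideanSpace 𝕜 (Fin d)) 2 (volume.restrict O))
        (g : Lp 𝕜 2 (volume.restrict O)), HasWeakDiv O u g →
        ∃ T : HMinusHalf 𝕜 O,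
          IsNormalTrace O u g T ∧
          (∀ T' : HMinusHalf 𝕜 O, IsNormalTrace O u g T' → T' = T) ∧
          ‖T‖ ^ 2 ≤ C * ‖u‖ * (‖u‖ + ‖g‖) := by
  -- With `d = a + 2` the boundary dimension is `a + 1 ≥ 1`, as the near-diagonal estimates require.
  obtain ⟨a, rfl⟩ := Nat.exists_eq_add_of_le' hd
  rcases (frontier O).eq_empty_or_nonempty with hF | hF
  -- A bounded open set without frontier is empty, and then all the spaces and integrals are
  -- trivial.
  · have := subsingleton_HHalf_of_frontier_eq_empty (𝕜 := 𝕜) hF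
    refine ⟨1, one_pos, fun u g _ => ⟨0, fun Φ _ _ φ _ => ?_, fun T' _ => ?_, ?_⟩⟩
    · have h0 : (volume : Measure (EuclideanSpace ℝ (Fin (a + 2)))).restrict O = 0 := by
        rw [Measure.restrict_eq_zero, IsC1Domain.eq_empty_of_frontier_eq_empty hF, measure_empty]
      rw [_root_.zero_apply]
      symm
      convert integral_zero_measure _ using 2
    · ext φ
      rw [Subsingleton.elim φ 0, map_zero, map_zero]
    · have h0 : ‖(0 : HMinusHalf 𝕜 O)‖ = 0 := norm_zero (E := HMinusHalf 𝕜 O)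
      rw [h0, zero_pow two_ne_zero]
      exact mul_nonneg (mul_nonneg zero_le_one (norm_nonneg u))
        (add_nonneg (norm_nonneg u) (norm_nonneg g))
  · obtain ⟨K, hK, h⟩ := exists_norm_greenFunctional_le (𝕜 := 𝕜) hF
    -- The summand `1` keeps the constant positive even if `K = 0`.
    refine ⟨(((a + 2 : ℕ) : ℝ) + 1) ^ 2 * K + 1, by positivity, fun u g hug => ?_⟩
    -- The functional lives on pairs `(φ, Φ)`; its bound involves only `φ`, so it factors through
    -- the projection to `H^{1/2}(∂O)`.
    obtain ⟨T, hT, hTn⟩ := exists_strongDual_of_norm_le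
      (LinearMap.fst 𝕜 _ _ ∘ₗ (traceGraph 𝕜 O).subtype) (greenFunctional u g)
      (by positivity) (h u g hug)
    have hTt : IsNormalTrace O u g T := fun Φ hΦ hΦc φ hφ => hT ⟨(φ, Φ), hΦ, hΦc, hφ⟩
    refine ⟨T, hTt, fun T' hT' => hTt.unique hF hT', ?_⟩
    calc ‖T‖ ^ 2 ≤ ((((a + 2 : ℕ) : ℝ) + 1) * √K * √(‖u‖ * (‖u‖ + ‖g‖))) ^ 2 := by gcongr
      _ = (((a + 2 : ℕ) : ℝ) + 1) ^ 2 * K * (‖u‖ * (‖u‖ + ‖g‖)) := by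
          rw [mul_pow, mul_pow, Real.sq_sqrt hK, Real.sq_sqrt (by positivity)]
      _ ≤ ((((a + 2 : ℕ) : ℝ) + 1) ^ 2 * K + 1) * (‖u‖ * (‖u‖ + ‖g‖)) := by
          gcongr
          linarith
      _ = _ := by ring
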